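/- Let $n\ge 0$, let $V=\mathbb{C}^{2n}$ with basis $e_1,\dots,e_{2n}$ and the symmetric bilinear form with matrix $\begin{pmatrix}0&I_n\\ I_n&0\end{pmatrix}$, and let $\mathcal{G}(n,V)\subset\mathbb{P}(\bigwedge^nV)$ be the Grassmannian in its Plücker embedding. Let $\Lambda$ be the set of $n$-element subsets of $\{1,\dots,2n\}$, with coordinate vectors $e_J=e_{j_1}\wedge\dots\wedge e_{j_n}$ for $J=\{j_1<\dots<j_n\}\in\Lambda$. The variety of $n$-dimensional isotropic subspaces of $V$, embedded in $\mathcal{G}(n,V)$, has two connected components when $n\geq 1$; let $\mathcal{S}_n$ be a connected component of it (a Spinor variety in its Plücker embedding) and let $\mathbb{P}(\bigwedge^nV_+)$ be its linear span in $\mathbb{P}(\bigwedge^nV)$. For a variety $X\subset\mathbb{P}^N$ and a smooth point $p\in X$, the $s$-osculating space $T^s_pX$ is the linear span of the partial derivatives of order at most $s$ at $0$ (including order $0$) of a lift to $\mathbb{C}^{N+1}$ of a local holomorphic parametrization $\phi$ of $X$ with $\phi(0)=p$; it does not depend on the parametrization. For $I,J\in\Lambda$ put $d(I,J)=|I|-|I\cap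 J|$ and $I_0=\{1,\dots,n\}$. Let $\sigma_J$ be the permutation of $I_0$ which lists first the elements of $I_0\cap J$ and then those of $I_0\setminus J$, both in increasing order, and let $\epsilon(\sigma_J)$ be its sign. Put $$\Sigma=\{(J,J')\in\Lambda\times\Lambda \mid J'=((I_0\setminus J)+n)\cup((I_0^c\setminus J)-n)\},$$ $$\Sigma_s=\{(J,J')\in\Sigma\mid d(I,J)\le s,\ J\ne J'\}\cup\{(J,J)\in\Sigma\mid d(I,J)\le s \text{ is even}\}.$$ Then $\mathcal{S}_n=\mathcal{G}(n,V)\cap\mathbb{P}(\bigwedge^nV_+)$, and for every $s\ge 0$: 1. For every $I\in\Lambda$ with $e_I\in\mathcal{S}_n$, the space $T^s_{e_I}\mathcal{S}_n$ is spanned by the vectors $e_J$ with $(J,J)\in\Sigma_s$ and the vectors $$\epsilon(\sigma_J)e_J+(-1)^{d(I_0,I)+d(I_0,J)}\epsilon(\sigma_{J'})e_{J'},\qquad (J,J')\in\Sigma_s$$ (for $I=I_0$ the sign is $(-1)^{d(I,J)}$). 2. For every $p\in\mathcal{S}_n$, $T^s_p\mathcal{S}_n=T^s_p\mathcal{G}(n,V)\cap\mathbb{P}(\bigwedge^nV_+)$;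 that is, the linear section $\mathcal{S}_n$ of $\mathcal{G}(n,V)$ is osculating well-behaved. 3. For every $p\in\mathcal{S}_n$, if $s\ge 2\lfloor n/2\rfloor$ then $T^s_p\mathcal{S}_n=\mathbb{P}(\bigwedge^nV_+)$. 4. For every $p\in\mathcal{S}_n$, if $1\le s\le 2\lfloor n/2\rfloor-1$ then $$\dim T^s_p\mathcal{S}_n=\frac12\sum_{k=1}^s\binom nk\left(\binom nk+1\right)-\sum_{k=1}^{\lceil s/2\rceil}\binom n{2k-1}.$$ -/

import Mathlib

open scoped Topology LinearAlgebra.Projectivization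
open Module

noncomputable section

namespace SpinorPlucker

/-! ### Osculating spaces of subsets of a projective space

`E = ℂ^{N+1}` is a finite dimensional space and `X ⊆ ℙ(E)`. Linear subspaces of `ℙ(E)` are
represented by linear subspaces of `E`; the projective dimension is the linear dimension minus
one. -/

section Osculating

variable {E : Type*} [NormedAddCommGroup E] [NormedSpace ℂ E]

/-- The (punctured) affine cone over a set of points of `ℙ(E)`. -/
def affineCone (X : Set (ℙ ℂ E)) : Set E :=
  {x | ∃ h : x ≠ 0, Projectivization.mk ℂ x h ∈ X}

/-- The linear span of a set of points of `ℙ(E)`. -/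
def linearSpan (X : Set (ℙ ℂ E)) : Submodule ℂ E :=
  Submodule.span ℂ (affineCone X)

/-- `φ` is (a lift to `E` of) a local holomorphic parametrization of `X` around `p`, with
`φ 0 = p`: it takes values in `X` near `0`, it is an immersion into `ℙ(E)` at `0`, and it maps
neighbourhoods of `0` onto neighbourhoods of `p` in `X`. The last two conditions are expressed in
the cone: the tangent space of `ℙ(E)` at `[x]` is `E / ℂ x`, and the topology of `ℙ(E)` is the
quotient topology. -/
structure IsLocalParametrization (X : Set (ℙ ℂ E)) (p : ℙ ℂ E) {d : ℕ}
    (φ : (Fin d → ℂ) → E) : Prop where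
  analyticAt : AnalyticAt ℂ φ 0
  base : ∃ h : φ 0 ≠ 0, Projectivization.mk ℂ (φ 0) h = p
  mem : ∀ᶠ t in 𝓝 0, φ t ∈ affineCone X
  immersion : ∀ v : Fin d → ℂ, fderiv ℂ φ 0 v ∈ Submodule.span ℂ {φ 0} → v = 0
  surj : ∀ U ∈ 𝓝 (0 : Fin d → ℂ), ∀ᶠ x in 𝓝[affineCone X] (φ 0),
    ∃ t ∈ U, ∃ c : ℂ, x = c • φ t

/-- The span of all the partial derivatives at `0` of order at most `s` (order `0` included):
the value of the `k`-th derivative at the standard basis vectors indexed by `c` is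
`∂^k φ / ∂t_{c 0} ⋯ ∂t_{c (k-1)}`. -/
def derivativeSpan {d : ℕ} (φ : (Fin d → ℂ) → E) (s : ℕ) : Submodule ℂ E :=
  Submodule.span ℂ {x | ∃ k ≤ s, ∃ c : Fin k → Fin d,
    x = iteratedFDeriv ℂ k φ 0 (fun i => Pi.single (c i) 1)}

/-- `T` is the `s`-osculating space of `X` at `p`: `X` has a local parametrization at `p`, and `T`
is the span of the partial derivatives of order at most `s` of any local parametrization. -/
def IsOsculatingSpace (X : Set (ℙ ℂ E)) (p : ℙ ℂ E) (s : ℕ) (T : Submodule ℂ E) : Prop :=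
  (∃ (d : ℕ) (φ : (Fin d → ℂ) → E), IsLocalParametrization X p φ) ∧
    ∀ (d : ℕ) (φ : (Fin d → ℂ) → E), IsLocalParametrization X p φ → T = derivativeSpan φ s

end Osculating

/-! ### Grassmannian, isotropic Grassmannian and Spinor varieties -/

/-- The set `Λ` of subsets with `n` elements of `{1, …, 2n}`. -/
abbrev Lam (n : ℕ) : Type := Set.powersetCard (Fin (n + n)) n

/-- `⋀ⁿ V` for `V = ℂ^{2n}`, in the coordinates given by the basis `e_J`, `J ∈ Λ`. -/
abbrev PluckerSpace (n : ℕ) : Type := Lam n → ℂ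

variable {n : ℕ}

/-- The Plücker coordinates of `v₁ ∧ ⋯ ∧ vₙ`. -/
def plucker (v : Fin n → (Fin (n + n) → ℂ)) : PluckerSpace n :=
  fun J => ((Pi.basisFun ℂ (Fin (n + n))).exteriorPower n).repr (exteriorPower.ιMulti ℂ n v) J

theorem plucker_apply (v : Fin n → (Fin (n + n) → ℂ)) (J : Lam n) :
    plucker v J = (Matrix.of fun i j => v i (J.1.orderEmbOfFin J.2 j)).det := by
  simp [plucker, exteriorPower.basis_repr_apply, Set.powersetCard.ofFinEmbEquiv_symm_apply]

/-- The basis vector `e_J`. -/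
def e (J : Lam n) : PluckerSpace n := Pi.single J 1

theorem e_ne_zero (J : Lam n) : e J ≠ 0 := by
  simp [e]

/-- The point `e_J` of `ℙ(⋀ⁿ V)`. -/
def coordPoint (J : Lam n) : ℙ ℂ (PluckerSpace n) := Projectivization.mk ℂ (e J) (e_ne_zero J)

/-- `p` is the image under the Plücker embedding of the subspace `W` of dimension `n`. -/
def IsPluckerPoint (W : Submodule ℂ (Fin (n + n) → ℂ)) (p : ℙ ℂ (PluckerSpace n)) : Prop :=
  ∃ v : Fin n → (Fin (n + n) → ℂ), LinearIndependent ℂ v ∧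
    Submodule.span ℂ (Set.range v) = W ∧ p.submodule = Submodule.span ℂ {plucker v}

variable (n) in
/-- The Grassmannian `G(n, V)` in its Plücker embedding. -/
def grassmannian : Set (ℙ ℂ (PluckerSpace n)) :=
  {p | ∃ W : Submodule ℂ (Fin (n + n) → ℂ), finrank ℂ W = n ∧ IsPluckerPoint W p}

/-- The symmetric bilinear form with matrix `(0, Iₙ; Iₙ, 0)`. -/
def Q (x y : Fin (n + n) → ℂ) : ℂ :=
  ∑ i : Fin n, (x (Fin.castAdd n i) * y (Fin.natAdd n i) + x (Fin.natAdd n i) * y (Fin.castAdd n i))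

variable (n) in
/-- The variety of maximal isotropic subspaces of `V`, in the Plücker embedding. -/
def isotropicGrassmannian : Set (ℙ ℂ (PluckerSpace n)) :=
  {p | ∃ W : Submodule ℂ (Fin (n + n) → ℂ), finrank ℂ W = n ∧
    (∀ x ∈ W, ∀ y ∈ W, Q x y = 0) ∧ IsPluckerPoint W p}

/-- `S` is a Spinor variety: a connected component of the variety of maximal isotropic subspaces.
As `ℂ ∖ {0}` is connected, the connected components of a subset of `ℙ(E)` are the images of those of
the cone over it. -/
def IsSpinorVariety (S : Set (ℙ ℂ (PluckerSpace n))) : Prop :=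
  ∃ x ∈ affineCone (isotropicGrassmannian n),
    affineCone S = connectedComponentIn (affineCone (isotropicGrassmannian n)) x

/-! ### The combinatorial data -/

variable (n) in
/-- `I₀ = {1, …, n}`. -/
def Izero : Finset (Fin (n + n)) := Finset.univ.map (Fin.castAddEmb n)

/-- The distance `d(I, J) = |I| - |I ∩ J|`. -/
def dist (I J : Finset (Fin (n + n))) : ℕ := I.card - (I ∩ J).card

/-- The elements of `I₀ ∩ J`, as row indices. -/
def rowsIn (J : Lam n) : Finset (Fin n) := Finset.univ.filter fun i => Fin.castAdd n i ∈ J.1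

/-- The permutation of the rows which lists the rows with index in `I₀ ∩ J` first and
the rows with index in `I₀ ∖ J` next, both in increasing order. -/
def sigma (J : Lam n) : Equiv.Perm (Fin n) :=
  ((finCongr (by rw [Finset.card_add_card_compl, Fintype.card_fin])).trans
    finSumFinEquiv.symm).trans
    (finSumEquivOfFinset (s := rowsIn J) (m := (rowsIn J).card) (n := (rowsIn J)ᶜ.card) rfl rfl)

/-- The sign `ε(σ_J)`. -/
def eps (J : Lam n) : ℂ := ((Equiv.Perm.sign (sigma J) : ℤ) : ℂ)

variable (n) in
/-- The set `Σ` of pairs `(J, J')` with `J' = ((I₀ ∖ J) + n) ∪ ((I₀ᶜ ∖ J) - n)`. -/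
def Sig : Set (Lam n × Lam n) :=
  {P | P.2.1 =
    (Finset.univ.filter fun i : Fin n => Fin.castAdd n i ∉ P.1.1).map (Fin.natAddEmb n) ∪
    (Finset.univ.filter fun i : Fin n => Fin.natAdd n i ∉ P.1.1).map (Fin.castAddEmb n)}

/-- The set `Σ_s` relative to `I`. -/
def SigLE (I : Lam n) (s : ℕ) : Set (Lam n × Lam n) :=
  {P ∈ Sig n | dist I.1 P.1.1 ≤ s ∧ P.1 ≠ P.2} ∪
  {P ∈ Sig n | dist I.1 P.1.1 ≤ s ∧ P.1 = P.2 ∧ Even (dist I.1 P.1.1)}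

/-- The vector `ε(σ_J) e_J + (-1)^{d(I₀,I) + d(I₀,J)} ε(σ_{J'}) e_{J'}`. For `I = I₀` the sign is
`(-1)^{d(I,J)}`: for a skew-symmetric matrix `A`, the minor of `A` of size `k` with rows `R` and
columns `C` is `(-1)^k` times the minor with rows `C` and columns `R`. -/
def pairVector (I J J' : Lam n) : PluckerSpace n :=
  eps J • e J + ((-1) ^ (dist (Izero n) I.1 + dist (Izero n) J.1) * eps J') • e J'

/-- The subspace spanned by the `e_J` with `(J, J) ∈ Σ_s` and by the vectors attached to the pairs
`(J, J') ∈ Σ_s`. -/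
def explicitSpan (I : Lam n) (s : ℕ) : Submodule ℂ (PluckerSpace n) :=
  Submodule.span ℂ ({x | ∃ J, (J, J) ∈ SigLE I s ∧ x = e J} ∪
    {x | ∃ J J', (J, J') ∈ SigLE I s ∧ x = pairVector I J J'})

end SpinorPlucker

end

/-! Near `e_{I₀}` an `n`-space is the row space of `(1 | A)`, and its Plücker coordinate at `J` is
`eps J` times the minor of `A` with rows `I₀ \ J` and columns `(J \ I₀) - n` (`plucker_graph`). It
is homogeneous of degree `deg J = d(I₀, J)` in `A`. The Grassmannian is charted by all `A`, the
isotropic Grassmannian by skew `A`.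

For a chart with homogeneous coordinates, the derivatives at `0` of order at most `s` span exactly
the vectors of degree at most `s` in the linear span of the chart, provided that span is graded
(`derivativeSpan_eq_inf_degLE`). Hence the osculating space is `degLE deg s` for the Grassmannian,
and everything reduces to finding the span of the skew chart. It is the eigenspace `eigen n 1` of a
star operator which pairs the coordinates `J` and `dual J`, since the minors of a skew matrix on
`(R, C)` and `(C, R)` differ by `(-1)^k`.

The eigenspaces are handled without coordinates: `plucker v ∈ eigen n c` iff `vol v w = c * gram v
w` for all `w`. From this, isotropic subspaces lie in one of the eigenspaces for `±1`
(`plucker_mem_eigen_of_isotropic`), and conversely a decomposable vector in such an eigenspace is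
isotropic (`isotropic_of_plucker_mem_eigen`); this gives the linear section statement. Isotropic
subspaces span all of `⋀ⁿ V` (`span_affineCone_isotropic`), so those in an eigenspace span it. The
charts centred at the `e_I` with `I` isotropic cover the variety, and charts of equal parity are
linked by overlaps, so the component of `e_{I₀}` is the part in `eigen n 1` (`baseComponent_eq`),
and by the identity theorem a single chart has the same span (`span_chart_skew`).

Isometries of `V` and scalars carry `e_{I₀}` to any point of the cone (`exists_preserves_of_mem`),
which transports the result; coordinate swaps give the explicit generators at `e_I`. The dimension
is half the trace of identity plus star on degrees at most `s`. That the osculating space does not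
depend on the parametrization is proved by comparing any parametrization with an affine chart
(`IsAffineChart.derivativeSpan_eq`). -/

noncomputable section

namespace SpinorPlucker

/-! ### Derivatives of order at most `s` under reparametrization -/

section Reparametrization

variable {E F G : Type*} [NormedAddCommGroup E] [NormedSpace ℂ E]
  [NormedAddCommGroup F] [NormedSpace ℂ F] [NormedAddCommGroup G] [NormedSpace ℂ G]

/-- By Faà di Bruno, each term of the `k`-th derivative contains a derivative of `f` whose order is
the number of parts of a partition, hence at most `k`. -/
theorem iteratedFDeriv_comp_eq_zero {f : F → G} {g : E → F} {x : E} {s : ℕ}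
    (hf : ContDiffAt ℂ ⊤ f (g x)) (hg : ContDiffAt ℂ ⊤ g x)
    (h : ∀ k ≤ s, iteratedFDeriv ℂ k f (g x) = 0) :
    ∀ k ≤ s, iteratedFDeriv ℂ k (f ∘ g) x = 0 := by
  intro k hk
  rw [iteratedFDeriv_comp (n := ⊤) hf hg le_top]
  unfold FormalMultilinearSeries.taylorComp
  refine Finset.sum_eq_zero fun c _ => ?_
  ext v
  have := h c.length (c.length_le.trans hk)
  simp [FormalMultilinearSeries.compAlongOrderedFinpartition, ftaylorSeries, this]

/-- Leibniz: every term contains a derivative of `f` of order at most `k`. The norm bound for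
products suffices, since only vanishing is needed. -/
theorem iteratedFDeriv_smul_eq_zero {c : E → ℂ} {f : E → F} {x : E} {s : ℕ}
    (hc : ContDiffAt ℂ ⊤ c x) (hf : ContDiffAt ℂ ⊤ f x)
    (h : ∀ k ≤ s, iteratedFDeriv ℂ k f x = 0) :
    ∀ k ≤ s, iteratedFDeriv ℂ k (fun y => c y • f y) x = 0 := by
  intro k hk
  have hc' : ContDiffAt ℂ k c x := hc.of_le le_top
  have hf' : ContDiffAt ℂ k f x := hf.of_le le_top
  obtain ⟨u, hu, hcu⟩ := hc'.contDiffOn le_rfl (by simp)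
  obtain ⟨w, hw, hfw⟩ := hf'.contDiffOn le_rfl (by simp)
  obtain ⟨t, ht, hto, hxt⟩ := mem_nhds_iff.1 (Filter.inter_mem hu hw)
  have key := norm_iteratedFDerivWithin_smul_le (hcu.mono (ht.trans Set.inter_subset_left))
    (hfw.mono (ht.trans Set.inter_subset_right)) hto.uniqueDiffOn hxt (n := k) le_rfl
  rw [iteratedFDerivWithin_of_isOpen _ hto hxt] at key
  rw [← norm_le_zero_iff]
  refine key.trans (le_of_eq (Finset.sum_eq_zero fun i _ => ?_))
  rw [iteratedFDerivWithin_of_isOpen (k - i) hto hxt, h (k - i) (by omega)]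
  simp

/-- Duality: spans of derivatives are tested by linear forms, which turns them into jets of scalar
functions. -/
theorem derivativeSpan_le_ker_iff {d : ℕ} {φ : (Fin d → ℂ) → E} (hφ : ContDiffAt ℂ ⊤ φ 0)
    (s : ℕ) (l : E →L[ℂ] ℂ) :
    derivativeSpan φ s ≤ LinearMap.ker l.toLinearMap ↔
      ∀ k ≤ s, iteratedFDeriv ℂ k (l ∘ φ) 0 = 0 := by
  have hcomp : ∀ k, iteratedFDeriv ℂ k (l ∘ φ) 0 =
      l.compContinuousMultilinearMap (iteratedFDeriv ℂ k φ 0) := fun k =>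
    l.iteratedFDeriv_comp_left hφ le_top
  constructor
  · intro h k hk
    apply ContinuousMultilinearMap.toMultilinearMap_injective
    refine Basis.ext_multilinear (fun _ => Pi.basisFun ℂ (Fin d)) fun c => ?_
    have := h (Submodule.subset_span ⟨k, hk, c, rfl⟩)
    rw [hcomp]
    simpa using this
  · intro h
    refine Submodule.span_le.2 ?_
    rintro _ ⟨k, hk, c, rfl⟩
    have := h k hk
    rw [hcomp] at this
    simpa using congrArg (fun f => f (fun i => Pi.single (c i) 1)) this

theorem le_of_forall_ker [FiniteDimensional ℂ E] {S T : Submodule ℂ E}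
    (h : ∀ l : E →L[ℂ] ℂ, T ≤ LinearMap.ker l.toLinearMap → S ≤ LinearMap.ker l.toLinearMap) :
    S ≤ T := by
  intro x hx
  by_contra hxT
  obtain ⟨f, hf, hT⟩ := Submodule.exists_le_ker_of_notMem hxT
  exact hf (h (LinearMap.toContinuousLinearMap f) hT hx)

/-- If the `s`-jet of `l ∘ φ` vanishes, so does that of `c • (l ∘ φ ∘ g)`, by the chain and product
rules. The factor `c` is the freedom in the choice of a lift from `ℙ(E)`. -/
theorem derivativeSpan_le_of_reparametrization [FiniteDimensional ℂ E] {d d' : ℕ}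
    {φ : (Fin d → ℂ) → E} {χ : (Fin d' → ℂ) → E} {g : (Fin d' → ℂ) → (Fin d → ℂ)}
    {c : (Fin d' → ℂ) → ℂ} (hφ : AnalyticAt ℂ φ 0) (hg : ContDiffAt ℂ ⊤ g 0) (hg0 : g 0 = 0)
    (hc : ContDiffAt ℂ ⊤ c 0) (h : ∀ᶠ t in 𝓝 0, χ t = c t • φ (g t)) (s : ℕ) :
    derivativeSpan χ s ≤ derivativeSpan φ s := by
  have hφg : ContDiffAt ℂ ⊤ (φ ∘ g) 0 :=
    ContDiffAt.comp (𝕜 := ℂ) 0 (by rw [hg0]; exact hφ.contDiffAt) hg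
  have hχ : ContDiffAt ℂ ⊤ χ 0 := (hc.smul hφg).congr_of_eventuallyEq h
  refine le_of_forall_ker fun l hl => ?_
  rw [derivativeSpan_le_ker_iff hφ.contDiffAt] at hl
  rw [derivativeSpan_le_ker_iff hχ]
  intro k hk
  have hlφ : AnalyticAt ℂ (l ∘ φ) (g 0) := by
    rw [hg0]; exact (l.analyticAt _).comp hφ
  have hev : (l ∘ χ) =ᶠ[𝓝 0] fun t => c t • ((l ∘ φ) ∘ g) t := by
    filter_upwards [h] with t ht
    simp [ht]
  rw [hev.iteratedFDeriv ℂ k |>.eq_of_nhds]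
  refine iteratedFDeriv_smul_eq_zero hc (hlφ.contDiffAt.comp 0 hg) ?_ k hk
  exact iteratedFDeriv_comp_eq_zero hlφ.contDiffAt hg (by rw [hg0]; exact hl)

end Reparametrization

/-! ### Affine charts -/

/-- `ψ` is a chart of `X` which is the graph of a map over a linear projection: it is inverted by
`x ↦ m x / l x` on the part of the cone over `X` where the linear form `l` does not vanish. -/
structure IsAffineChart {E : Type*} [NormedAddCommGroup E] [NormedSpace ℂ E] (X : Set (ℙ ℂ E))
    {d : ℕ} (ψ : (Fin d → ℂ) → E) (l : E →L[ℂ] ℂ) (m : E →L[ℂ] (Fin d → ℂ)) : Prop where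
  analyticAt : ∀ t, AnalyticAt ℂ ψ t
  mem : ∀ t, ψ t ∈ affineCone X
  form : ∀ t, l (ψ t) = 1
  proj : ∀ t, m (ψ t) = t
  eq_smul : ∀ x ∈ affineCone X, l x ≠ 0 → ∃ t, x = l x • ψ t

namespace IsAffineChart

variable {E : Type*} [NormedAddCommGroup E] [NormedSpace ℂ E] {X : Set (ℙ ℂ E)}
  {d : ℕ} {ψ : (Fin d → ℂ) → E} {l : E →L[ℂ] ℂ} {m : E →L[ℂ] (Fin d → ℂ)}

theorem eq_smul_proj (h : IsAffineChart X ψ l m) {x : E} (hx : x ∈ affineCone X) (hl : l x ≠ 0) :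
    x = l x • ψ ((l x)⁻¹ • m x) := by
  obtain ⟨t, ht⟩ := h.eq_smul x hx hl
  have : m x = l x • t := by rw [ht]; simp [h.form, h.proj]
  rw [this, smul_smul, inv_mul_cancel₀ hl, one_smul]
  exact ht

theorem ne_zero (h : IsAffineChart X ψ l m) (t : Fin d → ℂ) : ψ t ≠ 0 := fun h0 => by
  have := h.form t
  rw [h0] at this
  simp at this

/-- The immersion property comes from differentiating `l ∘ ψ = 1` and `m ∘ ψ = id`; local
surjectivity from the continuity of the inverse `x ↦ m x / l x`. -/
theorem isLocalParametrization (h : IsAffineChart X ψ l m) :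
    IsLocalParametrization X (Projectivization.mk ℂ (ψ 0) (h.ne_zero 0)) ψ where
  analyticAt := h.analyticAt 0
  base := ⟨h.ne_zero 0, rfl⟩
  mem := Filter.Eventually.of_forall h.mem
  immersion := by
    intro v hv
    obtain ⟨a, ha⟩ := Submodule.mem_span_singleton.1 hv
    have hd : DifferentiableAt ℂ ψ 0 := (h.analyticAt 0).differentiableAt
    have h1 : l (fderiv ℂ ψ 0 v) = 0 := by
      have := (l.hasFDerivAt.comp (0 : Fin d → ℂ) hd.hasFDerivAt).fderiv
      have h2 : l ∘ ψ = fun _ => 1 := funext h.form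
      rw [h2] at this
      simpa using (congrArg (fun f => f v) this).symm
    have h3 : m (fderiv ℂ ψ 0 v) = v := by
      have := (m.hasFDerivAt.comp (0 : Fin d → ℂ) hd.hasFDerivAt).fderiv
      have h2 : m ∘ ψ = id := funext h.proj
      rw [h2] at this
      simpa using (congrArg (fun f => f v) this).symm
    rw [← ha] at h1 h3
    simp only [map_smul, h.form, h.proj, smul_eq_mul, mul_one] at h1 h3
    rw [← h3]; simp
  surj := by
    intro U hU
    have hc : Filter.Tendsto (fun x => (l x)⁻¹ • m x) (𝓝 (ψ 0)) (𝓝 0) := by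
      have : ContinuousAt (fun x => (l x)⁻¹ • m x) (ψ 0) :=
        (l.continuous.continuousAt.inv₀ (by simp [h.form])).smul m.continuous.continuousAt
      have h2 := this.tendsto
      simpa [h.form, h.proj] using h2
    have hl : ∀ᶠ x in 𝓝 (ψ 0), l x ≠ 0 :=
      l.continuous.continuousAt.eventually_ne (by simp [h.form])
    filter_upwards [nhdsWithin_le_nhds (hc hU), nhdsWithin_le_nhds hl, self_mem_nhdsWithin]
      with x hx hlx hX
    exact ⟨_, hx, l x, h.eq_smul_proj hX hlx⟩

/-- Any parametrization factors as `φ = (l ∘ φ) • ψ ∘ A` with transition map `A`. This gives one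
inclusion; the other needs a local inverse of `A`, so that `dA` must be shown to be bijective. -/
theorem derivativeSpan_eq [FiniteDimensional ℂ E] (h : IsAffineChart X ψ l m) {d' : ℕ}
    {φ : (Fin d' → ℂ) → E}
    (hφ : IsLocalParametrization X (Projectivization.mk ℂ (ψ 0) (h.ne_zero 0)) φ) (s : ℕ) :
    derivativeSpan φ s = derivativeSpan ψ s := by
  obtain ⟨hφ0, hbase⟩ := hφ.base
  obtain ⟨c₀, hc₀⟩ := (Projectivization.mk_eq_mk_iff' ℂ _ _ _ _).1 hbase
  have hc₀' : c₀ ≠ 0 := by rintro rfl; exact hφ0 (by simpa using hc₀.symm)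
  set A : (Fin d' → ℂ) → (Fin d → ℂ) := fun t => (l (φ t))⁻¹ • m (φ t) with hA
  have hl0 : l (φ 0) = c₀ := by rw [← hc₀]; simp [h.form]
  have hm0 : m (φ 0) = 0 := by rw [← hc₀]; simp [h.proj]
  have hlφ : AnalyticAt ℂ (fun t => l (φ t)) 0 := (l.analyticAt _).comp hφ.analyticAt
  have hmφ : AnalyticAt ℂ (fun t => m (φ t)) 0 := (m.analyticAt _).comp hφ.analyticAt
  have hAan : AnalyticAt ℂ A 0 := (hlφ.inv (by rw [hl0]; exact hc₀')).smul hmφ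
  have hA0 : A 0 = 0 := by simp [hA, hm0]
  have hlne : ∀ᶠ t in 𝓝 0, l (φ t) ≠ 0 :=
    hlφ.continuousAt.eventually_ne (by rw [hl0]; exact hc₀')
  have hφA : ∀ᶠ t in 𝓝 0, φ t = l (φ t) • ψ (A t) := by
    filter_upwards [hφ.mem, hlne] with t ht hlt using h.eq_smul_proj ht hlt
  refine le_antisymm (derivativeSpan_le_of_reparametrization (h.analyticAt 0) hAan.contDiffAt hA0
    hlφ.contDiffAt hφA s) ?_
  -- If `dA v = 0`, the product rule leaves only a multiple of `ψ 0`, so `dφ v` lies on the line of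
  -- `φ 0`, against the immersion hypothesis.
  have hinj : Function.Injective (fderiv ℂ A 0) := by
    rw [injective_iff_map_eq_zero]
    intro v hv
    refine hφ.immersion v ?_
    have hψA : HasFDerivAt (fun t => ψ (A t)) ((fderiv ℂ ψ 0).comp (fderiv ℂ A 0)) 0 := by
      have h1 : HasFDerivAt ψ (fderiv ℂ ψ 0) (A 0) := by
        rw [hA0]; exact (h.analyticAt 0).differentiableAt.hasFDerivAt
      exact h1.comp 0 hAan.differentiableAt.hasFDerivAt
    have h2 := hlφ.differentiableAt.hasFDerivAt.smul hψA
    have h3 := (h2.congr_of_eventuallyEq hφA).fderiv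
    rw [h3]
    simp only [_root_.add_apply, _root_.smul_apply,
      ContinuousLinearMap.comp_apply, hv, map_zero, smul_zero, zero_add,
      ContinuousLinearMap.smulRight_apply, hA0]
    refine Submodule.smul_mem _ _ (Submodule.mem_span_singleton.2 ⟨c₀⁻¹, ?_⟩)
    rw [← hc₀, smul_smul, inv_mul_cancel₀ hc₀', one_smul]
  -- Local surjectivity of `φ` is applied to the points `c₀ • ψ y`; comparing both sides under `l`
  -- and `m` identifies `y` with `A t`.
  have hsurj : ∀ U ∈ 𝓝 (0 : Fin d' → ℂ), A '' U ∈ 𝓝 (0 : Fin d → ℂ) := by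
    intro U hU
    have h1 := hφ.surj U hU
    have h2 : Filter.Tendsto (fun y => c₀ • ψ y) (𝓝 0) (𝓝[affineCone X] (φ 0)) := by
      refine tendsto_nhdsWithin_iff.2 ⟨?_, Filter.Eventually.of_forall fun y => ?_⟩
      · rw [← hc₀]
        exact ((h.analyticAt 0).continuousAt.const_smul c₀).tendsto
      · obtain ⟨hy, hyX⟩ := h.mem y
        refine ⟨smul_ne_zero hc₀' hy, ?_⟩
        convert hyX using 1
        exact (Projectivization.mk_eq_mk_iff' ℂ _ _ _ _).2 ⟨c₀, rfl⟩
    filter_upwards [h2.eventually h1] with y hy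
    obtain ⟨t, htU, c, hc⟩ := hy
    refine ⟨t, htU, ?_⟩
    have e1 : c₀ = c * l (φ t) := by simpa [h.form] using congrArg l hc
    have e2 : c₀ • y = c • m (φ t) := by simpa [h.proj] using congrArg m hc
    have hc0 : c ≠ 0 := by rintro rfl; simp at e1; exact hc₀' e1
    have hl0' : l (φ t) ≠ 0 := by intro h0; rw [h0] at e1; simp at e1; exact hc₀' e1
    rw [e1, mul_smul] at e2
    have e3 := smul_right_injective _ hc0 e2
    simp only [hA]
    rw [← e3, smul_smul, inv_mul_cancel₀ hl0', one_smul]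
  -- A `C¹` map does not raise Hausdorff dimension, and the image of a ball under `A` is a
  -- neighbourhood of `0`. Real dimensions are twice the complex ones.
  have hdim : d ≤ d' := by
    have hR : ∀ᶠ t in 𝓝 (0 : Fin d' → ℂ), AnalyticAt ℂ A t := hAan.eventually_analyticAt
    obtain ⟨r, hr, hball⟩ := Metric.eventually_nhds_iff_ball.1 hR
    have hC : ContDiffOn ℝ 1 A (Metric.ball 0 r) := fun t ht =>
      (((hball t ht).contDiffAt (n := 1)).restrict_scalars ℝ).contDiffWithinAt
    have h1 := hC.dimH_image_le (convex_ball 0 r) subset_rfl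
    rw [Real.dimH_of_mem_nhds (hsurj _ (Metric.ball_mem_nhds 0 hr)),
      Real.dimH_of_mem_nhds (Metric.ball_mem_nhds 0 hr)] at h1
    have h2 : finrank ℝ (Fin d → ℂ) ≤ finrank ℝ (Fin d' → ℂ) := by exact_mod_cast h1
    rw [← finrank_mul_finrank ℝ ℂ (Fin d → ℂ), ← finrank_mul_finrank ℝ ℂ (Fin d' → ℂ)] at h2
    simp at h2
    exact h2
  have hdim' : d' ≤ d := by
    have := LinearMap.finrank_le_finrank_of_injective (f := (fderiv ℂ A 0).toLinearMap) hinj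
    simpa using this
  obtain rfl : d = d' := le_antisymm hdim hdim'
  -- With equal dimensions the injective differential is invertible, and the inverse function
  -- theorem gives `B` with `ψ = (l ∘ φ ∘ B)⁻¹ • φ ∘ B` near `0`.
  let A' : (Fin d → ℂ) ≃L[ℂ] (Fin d → ℂ) :=
    (LinearEquiv.ofInjectiveEndo (fderiv ℂ A 0).toLinearMap hinj).toContinuousLinearEquiv
  have hA' : HasFDerivAt A (A' : (Fin d → ℂ) →L[ℂ] (Fin d → ℂ)) 0 := by
    have : (A' : (Fin d → ℂ) →L[ℂ] (Fin d → ℂ)) = fderiv ℂ A 0 := by ext v; rfl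
    rw [this]
    exact hAan.differentiableAt.hasFDerivAt
  have hAC : ContDiffAt ℂ ⊤ A 0 := hAan.contDiffAt
  have hstrict := hAC.hasStrictFDerivAt' hA' (by simp)
  set B := hAC.localInverse hA' (by simp) with hB
  have hBC : ContDiffAt ℂ ⊤ B 0 := by
    have := hAC.to_localInverse hA' (by simp)
    rwa [hA0] at this
  have hB0 : B 0 = 0 := by
    have := hAC.localInverse_apply_image hA' (by simp)
    rwa [hA0] at this
  have hAB : ∀ᶠ y in 𝓝 0, A (B y) = y := by
    have := hstrict.eventually_right_inverse
    rwa [hA0] at this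
  have hBt : Filter.Tendsto B (𝓝 0) (𝓝 0) := by
    have := hBC.continuousAt.tendsto
    rwa [hB0] at this
  have hlB : ContDiffAt ℂ ⊤ (fun y => (l (φ (B y)))⁻¹) 0 := by
    have h1 : ContDiffAt ℂ ⊤ (fun t => (l (φ t))⁻¹) (B 0) := by
      rw [hB0]
      exact (hlφ.inv (by rw [hl0]; exact hc₀')).contDiffAt
    exact h1.comp 0 hBC
  refine derivativeSpan_le_of_reparametrization hφ.analyticAt hBC hB0 hlB ?_ s
  filter_upwards [hBt.eventually hφA, hBt.eventually hlne, hAB] with y h1 h2 h3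
  rw [h3] at h1
  rw [h1]
  simp only [map_smul, h.form, smul_eq_mul, mul_one]
  rw [smul_smul, inv_mul_cancel₀ h2, one_smul]

theorem isOsculatingSpace [FiniteDimensional ℂ E] (h : IsAffineChart X ψ l m) (s : ℕ) :
    IsOsculatingSpace X (Projectivization.mk ℂ (ψ 0) (h.ne_zero 0)) s (derivativeSpan ψ s) :=
  ⟨⟨d, ψ, h.isLocalParametrization⟩, fun _ _ hφ => (h.derivativeSpan_eq hφ s).symm⟩

end IsAffineChart

/-! ### Homogeneous parametrizations -/

section Homogeneous

/-- Differentiating `x ↦ f (2x)` in two ways multiplies the `j`-th derivative at `0` by `2 ^ j` and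
by `2 ^ k`. -/
theorem iteratedFDeriv_zero_of_homogeneous {E : Type*} [NormedAddCommGroup E] [NormedSpace ℂ E]
    {f : E → ℂ} (hf : ContDiff ℂ ⊤ f) {k : ℕ}
    (hom : ∀ (a : ℂ) x, f (a • x) = a ^ k * f x) {j : ℕ} (hj : j ≠ k) :
    iteratedFDeriv ℂ j f 0 = 0 := by
  have h1 := ((2 : ℂ) • ContinuousLinearMap.id ℂ E).iteratedFDeriv_comp_right hf 0
    (i := j) le_top
  have h2 : f ∘ ((2 : ℂ) • ContinuousLinearMap.id ℂ E) = fun x => (2 : ℂ) ^ k • f x := by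
    ext x; simp [hom]
  rw [h2] at h1
  have h3 : iteratedFDeriv ℂ j (fun x => (2 : ℂ) ^ k • f x) 0 =
      (2 : ℂ) ^ k • iteratedFDeriv ℂ j f 0 :=
    iteratedFDeriv_const_smul_apply' (hf.contDiffAt.of_le le_top)
  rw [h3] at h1
  ext v
  have h4 := congrArg (fun g => g v) h1
  simp only [map_zero, ContinuousMultilinearMap.compContinuousLinearMap_apply,
    _root_.smul_apply,
    ContinuousLinearMap.id_apply] at h4
  rw [ContinuousMultilinearMap.map_smul_univ] at h4
  simp only [Finset.prod_const, Finset.card_univ, Fintype.card_fin, smul_eq_mul] at h4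
  have h5 : (2 : ℂ) ^ k ≠ 2 ^ j := by
    intro h
    apply hj
    have h6 : (2 : ℕ) ^ k = 2 ^ j := by exact_mod_cast h
    exact (Nat.pow_right_injective le_rfl h6).symm
  have h7 : ((2 : ℂ) ^ k - 2 ^ j) * iteratedFDeriv ℂ j f 0 v = 0 := by
    rw [sub_mul, h4, sub_self]
  rcases mul_eq_zero.1 h7 with h | h
  · exact absurd (sub_eq_zero.1 h) h5
  · simpa using h

/-- On the line through `x` the function is `a ^ k * f x`, whose `k`-th derivative is `k! * f x`. -/
theorem eq_zero_of_homogeneous {E : Type*} [NormedAddCommGroup E] [NormedSpace ℂ E]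
    {f : E → ℂ} (hf : ContDiff ℂ ⊤ f) {k : ℕ}
    (hom : ∀ (a : ℂ) x, f (a • x) = a ^ k * f x) (h : iteratedFDeriv ℂ k f 0 = 0) (x : E) :
    f x = 0 := by
  have h1 := (ContinuousLinearMap.toSpanSingleton ℂ x).iteratedFDeriv_comp_right hf 0
    (i := k) le_top
  have h2 : f ∘ (ContinuousLinearMap.toSpanSingleton ℂ x) = fun a : ℂ => a ^ k * f x := by
    ext a; simp [hom]
  rw [h2] at h1
  simp only [map_zero, h] at h1
  have h3 : iteratedDeriv k (fun a : ℂ => a ^ k * f x) 0 = 0 := by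
    rw [iteratedDeriv_eq_iteratedFDeriv, h1]
    simp
  rw [iteratedDeriv_mul_const_field, iteratedDeriv_pow] at h3
  simp [Nat.descFactorial_self, Nat.factorial_ne_zero] at h3
  exact h3

variable {ι : Type*}

/-- The projection to the coordinates of degree `k`. -/
def degProj (deg : ι → ℕ) (k : ℕ) : (ι → ℂ) →ₗ[ℂ] (ι → ℂ) where
  toFun x j := if deg j = k then x j else 0
  map_add' x y := by ext j; by_cases h : deg j = k <;> simp [h]
  map_smul' c x := by ext j; by_cases h : deg j = k <;> simp [h]

theorem degProj_apply (deg : ι → ℕ) (k : ℕ) (x : ι → ℂ) (j : ι) :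
    degProj deg k x j = if deg j = k then x j else 0 := rfl

theorem sum_degProj (deg : ι → ℕ) (x : ι → ℂ) {K : ℕ} (hK : ∀ j, x j ≠ 0 → deg j ≤ K) :
    ∑ k ∈ Finset.range (K + 1), degProj deg k x = x := by
  ext j
  simp only [Finset.sum_apply, degProj_apply, Finset.sum_ite_eq, Finset.mem_range]
  by_cases h : x j = 0
  · simp [h]
  · rw [if_pos (Nat.lt_succ_of_le (hK j h))]

variable [Fintype ι] {deg : ι → ℕ} {d : ℕ} {ψ : (Fin d → ℂ) → (ι → ℂ)}

/-- For a linear form `l`, the `k`-th derivative of `l ∘ ψ` at `0` sees only the degree `k` part of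
`l ∘ ψ`, and vanishes exactly when that part does. -/
theorem derivativeSpan_eq_span_degProj (hψ : ContDiff ℂ ⊤ ψ)
    (hom : ∀ (a : ℂ) t j, ψ (a • t) j = a ^ deg j * ψ t j) (s : ℕ) :
    derivativeSpan ψ s = Submodule.span ℂ {x | ∃ k ≤ s, ∃ t, x = degProj deg k (ψ t)} := by
  have key : ∀ l : (ι → ℂ) →L[ℂ] ℂ, derivativeSpan ψ s ≤ LinearMap.ker l.toLinearMap ↔
      Submodule.span ℂ {x | ∃ k ≤ s, ∃ t, x = degProj deg k (ψ t)} ≤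
        LinearMap.ker l.toLinearMap := by
    intro l
    rw [derivativeSpan_le_ker_iff hψ.contDiffAt, Submodule.span_le]
    set f : ℕ → (Fin d → ℂ) → ℂ := fun k t => l (degProj deg k (ψ t)) with hf
    have hfC : ∀ k, ContDiff ℂ ⊤ (f k) := fun k =>
      (l.comp (LinearMap.toContinuousLinearMap (degProj deg k))).contDiff.comp hψ
    have hfhom : ∀ k (a : ℂ) t, f k (a • t) = a ^ k * f k t := by
      intro k a t
      have : degProj deg k (ψ (a • t)) = a ^ k • degProj deg k (ψ t) := by
        ext j
        simp only [degProj_apply, Pi.smul_apply, smul_eq_mul, hom]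
        split_ifs with h
        · rw [h]
        · simp
      simp [hf, this]
    -- The range is chosen long enough to contain every degree that occurs and also every `k ≤ s`.
    have hsum : (l ∘ ψ) = fun t => ∑ k ∈ Finset.range (s + ∑ j, deg j + 1), f k t := by
      ext t
      simp only [hf, Function.comp_apply]
      rw [← map_sum, sum_degProj]
      intro j _
      exact (Finset.single_le_sum (f := deg) (fun _ _ => Nat.zero_le _)
        (Finset.mem_univ j)).trans (Nat.le_add_left _ _)
    have hder : ∀ k ≤ s, iteratedFDeriv ℂ k (l ∘ ψ) 0 = iteratedFDeriv ℂ k (f k) 0 := by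
      intro k hk
      rw [hsum, iteratedFDeriv_fun_sum_apply fun i _ => (hfC i).contDiffAt.of_le le_top,
        Finset.sum_eq_single k]
      · intro j _ hjk
        exact iteratedFDeriv_zero_of_homogeneous (hfC j) (hfhom j) (Ne.symm hjk)
      · intro h
        exact absurd (Finset.mem_range.2 (by omega)) h
    constructor
    · rintro h _ ⟨k, hk, t, rfl⟩
      exact eq_zero_of_homogeneous (hfC k) (hfhom k) ((hder k hk) ▸ h k hk) t
    · intro h k hk
      have : f k = fun _ => 0 := funext fun t => h ⟨k, hk, t, rfl⟩
      rw [hder k hk, this]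
      exact congrFun (iteratedFDeriv_fun_zero (𝕜 := ℂ)) 0
  exact le_antisymm (le_of_forall_ker fun l hl => (key l).2 hl)
    (le_of_forall_ker fun l hl => (key l).1 hl)

/-- The vectors supported in degrees at most `s`. -/
def degLE (deg : ι → ℕ) (s : ℕ) : Submodule ℂ (ι → ℂ) where
  carrier := {x | ∀ j, s < deg j → x j = 0}
  add_mem' := fun hx hy j hj => by simp [hx j hj, hy j hj]
  zero_mem' := fun _ _ => rfl
  smul_mem' := fun c x hx j hj => by simp [hx j hj]

/-- Stability of `Y` under `degProj` keeps the homogeneous parts of `ψ` inside `Y`; conversely the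
degree `k` part of a vector of `Y` is a combination of degree `k` parts of values of `ψ`. -/
theorem derivativeSpan_eq_inf_degLE (hψ : ContDiff ℂ ⊤ ψ)
    (hom : ∀ (a : ℂ) t j, ψ (a • t) j = a ^ deg j * ψ t j) {Y : Submodule ℂ (ι → ℂ)}
    (hY : Submodule.span ℂ (Set.range ψ) = Y) (hYdeg : ∀ k, ∀ x ∈ Y, degProj deg k x ∈ Y) (s : ℕ) :
    derivativeSpan ψ s = degLE deg s ⊓ Y := by
  rw [derivativeSpan_eq_span_degProj hψ hom]
  apply le_antisymm
  · refine Submodule.span_le.2 ?_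
    rintro _ ⟨k, hk, t, rfl⟩
    refine ⟨fun j hj => ?_, hYdeg k _ (hY ▸ Submodule.subset_span ⟨t, rfl⟩)⟩
    rw [degProj_apply, if_neg (by omega)]
  · rintro x ⟨hx, hxY⟩
    rw [← sum_degProj deg x (K := s) (fun j hj => not_lt.1 fun h => hj (hx j h))]
    refine Submodule.sum_mem _ fun k hk => ?_
    have hk' : k ≤ s := Nat.lt_succ_iff.1 (Finset.mem_range.1 hk)
    have h1 : degProj deg k x ∈ Y.map (degProj deg k) := Submodule.mem_map_of_mem hxY
    rw [← hY, Submodule.map_span] at h1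
    refine Submodule.span_mono ?_ h1
    rintro _ ⟨_, ⟨t, rfl⟩, rfl⟩
    exact ⟨k, hk', t, rfl⟩

end Homogeneous

attribute [-simp] Fin.natAdd_eq_addNat

variable {n : ℕ}

/-! ### The index set `Λ` -/

/-- The elements of `J ∖ I₀`, as column indices. -/
def colsIn (J : Lam n) : Finset (Fin n) := Finset.univ.filter fun i => Fin.natAdd n i ∈ J.1

theorem mem_rowsIn {J : Lam n} {i : Fin n} : i ∈ rowsIn J ↔ Fin.castAdd n i ∈ J.1 := by
  simp [rowsIn]

theorem mem_colsIn {J : Lam n} {i : Fin n} : i ∈ colsIn J ↔ Fin.natAdd n i ∈ J.1 := by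
  simp [colsIn]

/-- The subset of `{1, …, 2n}` with first part `P` and second part `C`. -/
def glue (P C : Finset (Fin n)) : Finset (Fin (n + n)) :=
  P.map (Fin.castAddEmb n) ∪ C.map (Fin.natAddEmb n)

theorem castAdd_ne_natAdd (i j : Fin n) : Fin.castAdd n i ≠ Fin.natAdd n j := by
  intro h
  have := congrArg Fin.val h
  simp at this
  omega

@[simp]
theorem castAdd_mem_glue {P C : Finset (Fin n)} {i : Fin n} :
    Fin.castAdd n i ∈ glue P C ↔ i ∈ P := by
  simp [glue, (castAdd_ne_natAdd _ _).symm]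

@[simp]
theorem natAdd_mem_glue {P C : Finset (Fin n)} {i : Fin n} :
    Fin.natAdd n i ∈ glue P C ↔ i ∈ C := by
  simp [glue, castAdd_ne_natAdd]

theorem card_glue (P C : Finset (Fin n)) : (glue P C).card = P.card + C.card := by
  rw [glue, Finset.card_union_of_disjoint]
  · simp
  · rw [Finset.disjoint_left]
    intro x hx hy
    obtain ⟨i, _, rfl⟩ := Finset.mem_map.1 hx
    obtain ⟨j, _, hj⟩ := Finset.mem_map.1 hy
    exact castAdd_ne_natAdd i j hj.symm

theorem finset_ext_parts {s t : Finset (Fin (n + n))}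
    (h₁ : ∀ i : Fin n, Fin.castAdd n i ∈ s ↔ Fin.castAdd n i ∈ t)
    (h₂ : ∀ i : Fin n, Fin.natAdd n i ∈ s ↔ Fin.natAdd n i ∈ t) : s = t := by
  ext x
  exact Fin.addCases h₁ h₂ x

theorem eq_glue (J : Lam n) : J.1 = glue (rowsIn J) (colsIn J) :=
  finset_ext_parts (by simp [mem_rowsIn]) (by simp [mem_colsIn])

theorem card_rowsIn_add_card_colsIn (J : Lam n) : (rowsIn J).card + (colsIn J).card = n := by
  rw [← card_glue, ← eq_glue]
  exact J.2

theorem card_colsIn (J : Lam n) : (colsIn J).card = (rowsIn J)ᶜ.card := by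
  have := card_rowsIn_add_card_colsIn J
  have h2 := Finset.card_add_card_compl (rowsIn J)
  rw [Fintype.card_fin] at h2
  omega

theorem Izero_eq : Izero n = glue Finset.univ ∅ := by
  simp [Izero, glue]

/-- The degree `d(I₀, J)`. -/
def deg (J : Lam n) : ℕ := dist (Izero n) J.1

theorem deg_eq_card_compl (J : Lam n) : deg J = (rowsIn J)ᶜ.card := by
  have h : Izero n ∩ J.1 = glue (rowsIn J) ∅ :=
    finset_ext_parts (by simp [Izero_eq, mem_rowsIn]) (by simp [Izero_eq])
  rw [deg, dist, h, card_glue, Izero_eq, card_glue, Finset.card_compl]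
  simp

theorem deg_eq_card_colsIn (J : Lam n) : deg J = (colsIn J).card := by
  rw [deg_eq_card_compl, card_colsIn]

/-- The element of `Λ` with given parts. -/
def mkLam (P C : Finset (Fin n)) (h : P.card + C.card = n) : Lam n :=
  ⟨glue P C, (card_glue P C).trans h⟩

@[simp]
theorem rowsIn_mkLam (P C : Finset (Fin n)) (h : P.card + C.card = n) :
    rowsIn (mkLam P C h) = P := by
  ext i; simp [mem_rowsIn, mkLam]

@[simp]
theorem colsIn_mkLam (P C : Finset (Fin n)) (h : P.card + C.card = n) :
    colsIn (mkLam P C h) = C := by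
  ext i; simp [mem_colsIn, mkLam]

theorem Lam_ext {J K : Lam n} (h₁ : rowsIn J = rowsIn K) (h₂ : colsIn J = colsIn K) : J = K :=
  Subtype.ext (by rw [eq_glue J, eq_glue K, h₁, h₂])

theorem card_compl_add_card_compl (J : Lam n) : (colsIn J)ᶜ.card + (rowsIn J)ᶜ.card = n := by
  rw [← card_colsIn, add_comm, Finset.card_add_card_compl, Fintype.card_fin]

/-- The index `J'` attached to `J`. -/
def dual (J : Lam n) : Lam n := mkLam (colsIn J)ᶜ (rowsIn J)ᶜ (card_compl_add_card_compl J)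

@[simp]
theorem rowsIn_dual (J : Lam n) : rowsIn (dual J) = (colsIn J)ᶜ := rowsIn_mkLam _ _ _

@[simp]
theorem colsIn_dual (J : Lam n) : colsIn (dual J) = (rowsIn J)ᶜ := colsIn_mkLam _ _ _

@[simp]
theorem dual_dual (J : Lam n) : dual (dual J) = J := Lam_ext (by simp) (by simp)

@[simp]
theorem deg_dual (J : Lam n) : deg (dual J) = deg J := by
  rw [deg_eq_card_compl, rowsIn_dual, compl_compl, deg_eq_card_colsIn]

theorem mem_Sig_iff {J K : Lam n} : (J, K) ∈ Sig n ↔ K = dual J := by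
  have h : (dual J).1 =
      (Finset.univ.filter fun i : Fin n => Fin.castAdd n i ∉ J.1).map (Fin.natAddEmb n) ∪
      (Finset.univ.filter fun i : Fin n => Fin.natAdd n i ∉ J.1).map (Fin.castAddEmb n) := by
    rw [Finset.union_comm]
    change glue _ _ = glue _ _
    congr 1 <;> ext i <;> simp [mem_rowsIn, mem_colsIn]
  rw [Subtype.ext_iff, h]
  rfl

/-- The isotropic index `{i ∉ R} ∪ {n + i | i ∈ R}`. -/
def isoIndex (R : Finset (Fin n)) : Lam n :=
  mkLam Rᶜ R (by rw [add_comm, Finset.card_add_card_compl, Fintype.card_fin])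

@[simp]
theorem rowsIn_isoIndex (R : Finset (Fin n)) : rowsIn (isoIndex R) = Rᶜ := rowsIn_mkLam _ _ _

@[simp]
theorem colsIn_isoIndex (R : Finset (Fin n)) : colsIn (isoIndex R) = R := colsIn_mkLam _ _ _

@[simp]
theorem dual_isoIndex (R : Finset (Fin n)) : dual (isoIndex R) = isoIndex R :=
  Lam_ext (by simp) (by simp)

@[simp]
theorem deg_isoIndex (R : Finset (Fin n)) : deg (isoIndex R) = R.card := by
  rw [deg_eq_card_colsIn, colsIn_isoIndex]

theorem eq_isoIndex_of_dual_eq {J : Lam n} (h : dual J = J) : J = isoIndex (colsIn J) := by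
  refine Lam_ext ?_ (by simp)
  conv_lhs => rw [← h]
  simp

theorem eps_mul_self (J : Lam n) : eps J * eps J = 1 := by
  unfold eps
  rcases Int.units_eq_one_or (Equiv.Perm.sign (sigma J)) with h | h <;> simp [h]

theorem eps_ne_zero (J : Lam n) : eps J ≠ 0 := fun h => by
  have := eps_mul_self J
  simp [h] at this

/-! ### Plücker vectors -/

variable (n) in
/-- The Plücker vector, as an alternating map. -/
def pluckerAlt : (Fin (n + n) → ℂ) [⋀^Fin n]→ₗ[ℂ] PluckerSpace n :=
  ((Pi.basisFun ℂ (Fin (n + n))).exteriorPower n).equivFun.toLinearMap.compAlternatingMap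
    (exteriorPower.ιMulti ℂ n)

@[simp]
theorem pluckerAlt_apply (v : Fin n → Fin (n + n) → ℂ) : pluckerAlt n v = plucker v := rfl

theorem span_range_plucker : Submodule.span ℂ (Set.range (plucker (n := n))) = ⊤ := by
  have h : Set.range (plucker (n := n)) =
      ((Pi.basisFun ℂ (Fin (n + n))).exteriorPower n).equivFun.toLinearMap ''
        Set.range (exteriorPower.ιMulti ℂ n) := by
    rw [← Set.range_comp]; rfl
  rw [h, ← Submodule.map_span, exteriorPower.ιMulti_span, Submodule.map_top,
    LinearMap.range_eq_top]
  exact LinearEquiv.surjective _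

theorem linearMap_ext_plucker {M : Type*} [AddCommGroup M] [Module ℂ M]
    {f g : PluckerSpace n →ₗ[ℂ] M} (h : ∀ v, f (plucker v) = g (plucker v)) : f = g :=
  LinearMap.ext_on_range span_range_plucker h

theorem linearIndependent_of_plucker_ne_zero {v : Fin n → Fin (n + n) → ℂ} (h : plucker v ≠ 0) :
    LinearIndependent ℂ v := by
  by_contra hv
  exact h ((pluckerAlt n).map_linearDependent v hv)

/-- The action on `⋀ⁿ V` of an endomorphism of `V`. -/
def extMap (g : (Fin (n + n) → ℂ) →ₗ[ℂ] (Fin (n + n) → ℂ)) :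
    PluckerSpace n →ₗ[ℂ] PluckerSpace n :=
  ((Pi.basisFun ℂ (Fin (n + n))).exteriorPower n).equivFun.toLinearMap ∘ₗ
    exteriorPower.map n g ∘ₗ
    ((Pi.basisFun ℂ (Fin (n + n))).exteriorPower n).equivFun.symm.toLinearMap

@[simp]
theorem extMap_plucker (g : (Fin (n + n) → ℂ) →ₗ[ℂ] (Fin (n + n) → ℂ))
    (v : Fin n → Fin (n + n) → ℂ) : extMap g (plucker v) = plucker fun i => g (v i) := by
  change ((Pi.basisFun ℂ (Fin (n + n))).exteriorPower n).equivFun (exteriorPower.map n g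
    (((Pi.basisFun ℂ (Fin (n + n))).exteriorPower n).equivFun.symm
      (((Pi.basisFun ℂ (Fin (n + n))).exteriorPower n).equivFun (exteriorPower.ιMulti ℂ n v)))) = _
  rw [LinearEquiv.symm_apply_apply, exteriorPower.map_apply_ιMulti]
  rfl

/-- The action on `⋀ⁿ V` of an automorphism of `V`. -/
def extEquiv (g : (Fin (n + n) → ℂ) ≃ₗ[ℂ] (Fin (n + n) → ℂ)) :
    PluckerSpace n ≃ₗ[ℂ] PluckerSpace n :=
  LinearEquiv.ofLinearMap (extMap g.toLinearMap) (extMap g.symm.toLinearMap)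
    (linearMap_ext_plucker fun v => by simp) (linearMap_ext_plucker fun v => by simp)

@[simp]
theorem extEquiv_plucker (g : (Fin (n + n) → ℂ) ≃ₗ[ℂ] (Fin (n + n) → ℂ))
    (v : Fin n → Fin (n + n) → ℂ) : extEquiv g (plucker v) = plucker fun i => g (v i) :=
  extMap_plucker g.toLinearMap v

@[simp]
theorem extEquiv_symm_plucker (g : (Fin (n + n) → ℂ) ≃ₗ[ℂ] (Fin (n + n) → ℂ))
    (v : Fin n → Fin (n + n) → ℂ) : (extEquiv g).symm (plucker v) = plucker fun i => g.symm (v i) :=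
  extMap_plucker g.symm.toLinearMap v

/-! ### The bilinear form -/

variable (n) in
/-- The form `Q`, bundled. -/
def Qform : LinearMap.BilinForm ℂ (Fin (n + n) → ℂ) :=
  LinearMap.mk₂ ℂ Q
    (fun x y z => by
      simp only [Q, ← Finset.sum_add_distrib, Pi.add_apply]
      exact Finset.sum_congr rfl fun _ _ => by ring)
    (fun c x y => by
      simp only [Q, Pi.smul_apply, smul_eq_mul, Finset.mul_sum]
      exact Finset.sum_congr rfl fun _ _ => by ring)
    (fun x y z => by
      simp only [Q, ← Finset.sum_add_distrib, Pi.add_apply]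
      exact Finset.sum_congr rfl fun _ _ => by ring)
    (fun c x y => by
      simp only [Q, Pi.smul_apply, smul_eq_mul, Finset.mul_sum]
      exact Finset.sum_congr rfl fun _ _ => by ring)

@[simp]
theorem Qform_apply (x y : Fin (n + n) → ℂ) : Qform n x y = Q x y := rfl

theorem Q_comm (x y : Fin (n + n) → ℂ) : Q x y = Q y x :=
  Finset.sum_congr rfl fun _ _ => by ring

theorem Q_eq_zero_of_mem_span {v : Fin n → Fin (n + n) → ℂ} (hQ : ∀ i j, Q (v i) (v j) = 0)
    {x y : Fin (n + n) → ℂ} (hx : x ∈ Submodule.span ℂ (Set.range v))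
    (hy : y ∈ Submodule.span ℂ (Set.range v)) : Q x y = 0 := by
  have h1 : ∀ i, Q (v i) y = 0 := by
    intro i
    refine (Submodule.span_le.2 ?_ : _ ≤ LinearMap.ker (Qform n (v i))) hy
    rintro _ ⟨j, rfl⟩
    exact hQ i j
  refine (Submodule.span_le.2 ?_ : _ ≤ LinearMap.ker ((Qform n).flip y)) hx
  rintro _ ⟨i, rfl⟩
  exact h1 i

/-- The involution `i ↔ n + i` of the indices. -/
def flipIdx (k : Fin (n + n)) : Fin (n + n) :=
  Fin.addCases (fun i => Fin.natAdd n i) (fun i => Fin.castAdd n i) k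

@[simp]
theorem flipIdx_castAdd (i : Fin n) : flipIdx (Fin.castAdd n i) = Fin.natAdd n i := by
  simp [flipIdx]

@[simp]
theorem flipIdx_natAdd (i : Fin n) : flipIdx (Fin.natAdd n i) = Fin.castAdd n i := by
  simp [flipIdx]

@[simp]
theorem flipIdx_flipIdx (k : Fin (n + n)) : flipIdx (flipIdx k) = k := by
  refine Fin.addCases (fun i => ?_) (fun i => ?_) k <;> simp

theorem Q_single (x : Fin (n + n) → ℂ) (k : Fin (n + n)) :
    Q x (Pi.single k 1) = x (flipIdx k) := by
  refine Fin.addCases (fun i => ?_) (fun i => ?_) k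
  · simp [Q, Pi.single_apply, (castAdd_ne_natAdd _ _).symm]
  · simp [Q, Pi.single_apply, castAdd_ne_natAdd]

theorem eq_zero_of_forall_Q {x : Fin (n + n) → ℂ} (h : ∀ y, Q x y = 0) : x = 0 := by
  ext k
  have := h (Pi.single (flipIdx k) 1)
  rwa [Q_single, flipIdx_flipIdx] at this

theorem Qform_isSymm : LinearMap.IsSymm (Qform n) := ⟨fun x y => Q_comm x y⟩

theorem Qform_nondegenerate : (Qform n).Nondegenerate :=
  ⟨fun _ h => eq_zero_of_forall_Q h,
    fun _ h => eq_zero_of_forall_Q fun x => by rw [Q_comm]; exact h x⟩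

theorem mem_dual {J : Lam n} {k : Fin (n + n)} : k ∈ (dual J).1 ↔ flipIdx k ∉ J.1 := by
  refine Fin.addCases (fun i => ?_) (fun i => ?_) k
  · rw [← mem_rowsIn, rowsIn_dual, Finset.mem_compl, mem_colsIn, flipIdx_castAdd]
  · rw [← mem_colsIn, colsIn_dual, Finset.mem_compl, mem_rowsIn, flipIdx_natAdd]

/-! ### The cones over the Grassmannians -/

theorem mem_affineCone_grassmannian {x : PluckerSpace n} :
    x ∈ affineCone (grassmannian n) ↔ x ≠ 0 ∧ ∃ (c : ℂ) (v : Fin n → Fin (n + n) → ℂ),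
      x = c • plucker v := by
  constructor
  · rintro ⟨hx, W, hW, v, hv, hs, hp⟩
    rw [Projectivization.submodule_mk] at hp
    have : x ∈ Submodule.span ℂ {plucker v} := hp ▸ Submodule.mem_span_singleton_self x
    obtain ⟨c, hc⟩ := Submodule.mem_span_singleton.1 this
    exact ⟨hx, c, v, hc.symm⟩
  · rintro ⟨hx, c, v, rfl⟩
    have hv : LinearIndependent ℂ v :=
      linearIndependent_of_plucker_ne_zero fun h => hx (by simp [h])
    refine ⟨hx, Submodule.span ℂ (Set.range v), ?_, v, hv, rfl, ?_⟩
    · rw [finrank_span_eq_card hv, Fintype.card_fin]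
    · rw [Projectivization.submodule_mk]
      exact Submodule.span_singleton_smul_eq (IsUnit.mk0 c fun h => hx (by simp [h])) _

theorem mem_affineCone_isotropic {x : PluckerSpace n} :
    x ∈ affineCone (isotropicGrassmannian n) ↔ x ≠ 0 ∧
      ∃ (c : ℂ) (v : Fin n → Fin (n + n) → ℂ), (∀ i j, Q (v i) (v j) = 0) ∧ x = c • plucker v := by
  constructor
  · rintro ⟨hx, W, hW, hQ, v, hv, hs, hp⟩
    rw [Projectivization.submodule_mk] at hp
    have : x ∈ Submodule.span ℂ {plucker v} := hp ▸ Submodule.mem_span_singleton_self x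
    obtain ⟨c, hc⟩ := Submodule.mem_span_singleton.1 this
    refine ⟨hx, c, v, fun i j => ?_, hc.symm⟩
    exact hQ _ (hs ▸ Submodule.subset_span ⟨i, rfl⟩) _ (hs ▸ Submodule.subset_span ⟨j, rfl⟩)
  · rintro ⟨hx, c, v, hQ, rfl⟩
    have hv : LinearIndependent ℂ v :=
      linearIndependent_of_plucker_ne_zero fun h => hx (by simp [h])
    refine ⟨hx, Submodule.span ℂ (Set.range v), ?_, ?_, v, hv, rfl, ?_⟩
    · rw [finrank_span_eq_card hv, Fintype.card_fin]
    · exact fun x hx y hy => Q_eq_zero_of_mem_span hQ hx hy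
    · rw [Projectivization.submodule_mk]
      exact Submodule.span_singleton_smul_eq (IsUnit.mk0 c fun h => hx (by simp [h])) _

/-! ### Graphs of matrices and minors -/

/-- The rows of the matrix `(1 | A)`. -/
def graph (A : Matrix (Fin n) (Fin n) ℂ) (i : Fin n) : Fin (n + n) → ℂ :=
  Fin.append ((1 : Matrix (Fin n) (Fin n) ℂ) i) (A i)

@[simp]
theorem graph_castAdd (A : Matrix (Fin n) (Fin n) ℂ) (i j : Fin n) :
    graph A i (Fin.castAdd n j) = (1 : Matrix (Fin n) (Fin n) ℂ) i j := by
  simp [graph]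

@[simp]
theorem graph_natAdd (A : Matrix (Fin n) (Fin n) ℂ) (i j : Fin n) :
    graph A i (Fin.natAdd n j) = A i j := by
  simp [graph]

theorem Q_graph (A : Matrix (Fin n) (Fin n) ℂ) (i j : Fin n) :
    Q (graph A i) (graph A j) = A j i + A i j := by
  simp [Q, Finset.sum_add_distrib, Matrix.one_apply]

/-- Every index from the first half precedes every index from the second, so the increasing
enumeration of `J` is the concatenation of those of its two parts. -/
theorem orderEmbOfFin_eq_sum_elim (J : Lam n) {r k : ℕ} (hr : (rowsIn J).card = r)
    (hk : (colsIn J).card = k) (τ : Fin r ⊕ Fin k ≃ Fin n) (hl : ∀ a, (τ (Sum.inl a) : ℕ) = a)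
    (hτ : ∀ b, (τ (Sum.inr b) : ℕ) = r + b) (x : Fin r ⊕ Fin k) :
    J.1.orderEmbOfFin J.2 (τ x) =
      Sum.elim (fun a => Fin.castAdd n ((rowsIn J).orderEmbOfFin hr a))
        (fun b => Fin.natAdd n ((colsIn J).orderEmbOfFin hk b)) x := by
  have key : (fun y => Sum.elim (fun a => Fin.castAdd n ((rowsIn J).orderEmbOfFin hr a))
        (fun b => Fin.natAdd n ((colsIn J).orderEmbOfFin hk b)) (τ.symm y)) =
      J.1.orderEmbOfFin J.2 := by
    apply Finset.orderEmbOfFin_unique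
    · intro y
      obtain ⟨y, rfl⟩ := τ.surjective y
      rcases y with a | b
      · simpa using mem_rowsIn.1 (Finset.orderEmbOfFin_mem _ hr a)
      · simpa using mem_colsIn.1 (Finset.orderEmbOfFin_mem _ hk b)
    · intro y z hyz
      obtain ⟨y, rfl⟩ := τ.surjective y
      obtain ⟨z, rfl⟩ := τ.surjective z
      rw [Fin.lt_def] at hyz
      simp only [Equiv.symm_apply_apply]
      rcases y with a | b <;> rcases z with a' | b'
      · rw [hl, hl] at hyz
        have : (rowsIn J).orderEmbOfFin hr a < (rowsIn J).orderEmbOfFin hr a' :=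
          (OrderEmbedding.lt_iff_lt _).2 hyz
        rw [Fin.lt_def] at this ⊢
        simpa only [Sum.elim_inl, Fin.val_castAdd] using this
      · simp only [Sum.elim_inl, Sum.elim_inr, Fin.lt_def, Fin.val_castAdd, Fin.val_natAdd]
        have := ((rowsIn J).orderEmbOfFin hr a).2
        omega
      · rw [hl, hτ] at hyz
        have := a'.2
        omega
      · rw [hτ, hτ] at hyz
        have : (colsIn J).orderEmbOfFin hk b < (colsIn J).orderEmbOfFin hk b' :=
          (OrderEmbedding.lt_iff_lt _).2 (Fin.lt_def.2 (by omega))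
        rw [Fin.lt_def] at this ⊢
        simp only [Sum.elim_inr, Fin.val_natAdd]
        omega
  rw [← key]
  simp

theorem plucker_graph (A : Matrix (Fin n) (Fin n) ℂ) (J : Lam n) {k : ℕ}
    (hR : (rowsIn J)ᶜ.card = k) (hC : (colsIn J).card = k) :
    plucker (graph A) J = eps J *
      (A.submatrix ((rowsIn J)ᶜ.orderEmbOfFin hR) ((colsIn J).orderEmbOfFin hC)).det := by
  subst hR
  set M : Matrix (Fin n) (Fin n) ℂ :=
    Matrix.of fun i j => graph A i (J.1.orderEmbOfFin J.2 j) with hM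
  have hn : (rowsIn J).card + (rowsIn J)ᶜ.card = n := by
    rw [Finset.card_add_card_compl, Fintype.card_fin]
  let τ : Fin (rowsIn J).card ⊕ Fin (rowsIn J)ᶜ.card ≃ Fin n :=
    finSumFinEquiv.trans (finCongr hn)
  have hσ : ∀ x, sigma J (τ x) = finSumEquivOfFinset (s := rowsIn J) rfl rfl x := by
    intro x
    simp [sigma, τ]
  have hJ := orderEmbOfFin_eq_sum_elim J rfl hC τ (fun a => by simp [τ]) (fun b => by simp [τ])
  -- Listing the rows in `I₀ ∩ J` first makes the matrix block triangular, with an identity block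
  -- and the wanted minor. The row permutation is `sigma J`, whence `eps J`.
  have hblock : (M.submatrix (sigma J) id).submatrix τ τ = Matrix.fromBlocks 1
      (Matrix.of fun a b => A ((rowsIn J).orderEmbOfFin rfl a) ((colsIn J).orderEmbOfFin hC b)) 0
      (A.submatrix ((rowsIn J)ᶜ.orderEmbOfFin rfl) ((colsIn J).orderEmbOfFin hC)) := by
    ext x y
    rcases x with a | a <;> rcases y with b | b <;>
      simp only [hM, Matrix.submatrix_apply, id, Matrix.of_apply, hσ, hJ, Sum.elim_inl,
        Sum.elim_inr, finSumEquivOfFinset_inl, finSumEquivOfFinset_inr, graph_castAdd,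
        graph_natAdd, Matrix.fromBlocks_apply₁₁, Matrix.fromBlocks_apply₁₂,
        Matrix.fromBlocks_apply₂₁, Matrix.fromBlocks_apply₂₂, Matrix.zero_apply]
    · simp [Matrix.one_apply]
    · rw [Matrix.one_apply_ne]
      intro h
      have h1 := Finset.orderEmbOfFin_mem (rowsIn J)ᶜ rfl a
      rw [h, Finset.mem_compl] at h1
      exact h1 (Finset.orderEmbOfFin_mem _ rfl b)
  have h1 : ((M.submatrix (sigma J) id).submatrix τ τ).det = eps J * M.det := by
    rw [Matrix.det_submatrix_equiv_self, Matrix.det_permute]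
    rfl
  rw [hblock, Matrix.det_fromBlocks_zero₂₁, Matrix.det_one, one_mul] at h1
  rw [plucker_apply, h1, ← mul_assoc, eps_mul_self, one_mul]

/-- A partial permutation matrix. It serves to evaluate sign factors which are known only to be
independent of the subspace. -/
theorem exists_minor_eq_one {R C : Finset (Fin n)} {k : ℕ} (hR : R.card = k) (hC : C.card = k) :
    ∃ A : Matrix (Fin n) (Fin n) ℂ,
      (A.submatrix (R.orderEmbOfFin hR) (C.orderEmbOfFin hC)).det = 1 := by
  classical
  refine ⟨Matrix.of fun i j =>
    if ∃ a, R.orderEmbOfFin hR a = i ∧ C.orderEmbOfFin hC a = j then 1 else 0, ?_⟩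
  convert Matrix.det_one (n := Fin k) (R := ℂ)
  ext a b
  simp [Matrix.one_apply]

/-! ### Reordering columns -/

theorem exists_perm_of_injective {J : Lam n} {k : Fin n → Fin (n + n)} (hk : Function.Injective k)
    (h : ∀ j, k j ∈ J.1) : ∃ σ : Equiv.Perm (Fin n), ∀ j, k j = J.1.orderEmbOfFin J.2 (σ j) := by
  have h1 : ∀ j, ∃ a, J.1.orderEmbOfFin J.2 a = k j := by
    intro j
    have h2 : Set.range (J.1.orderEmbOfFin J.2) = J.1 := Finset.range_orderEmbOfFin J.1 J.2
    exact h2.ge (h j)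
  choose f hf using h1
  have hfi : Function.Injective f := by
    intro a b hab
    apply hk
    rw [← hf a, ← hf b, hab]
  exact ⟨Equiv.ofBijective f (Finite.injective_iff_bijective.1 hfi), fun j => (hf j).symm⟩

theorem exists_det_eq_plucker {J : Lam n} {k : Fin n → Fin (n + n)} (hk : Function.Injective k)
    (h : ∀ j, k j ∈ J.1) : ∃ s : ℂ, s * s = 1 ∧ ∀ v : Fin n → Fin (n + n) → ℂ,
      (Matrix.of fun i j => v i (k j)).det = s * plucker v J := by
  obtain ⟨σ, hσ⟩ := exists_perm_of_injective hk h
  refine ⟨((Equiv.Perm.sign σ : ℤ) : ℂ), ?_, fun v => ?_⟩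
  · rcases Int.units_eq_one_or (Equiv.Perm.sign σ) with h | h <;> simp [h]
  · rw [plucker_apply, ← Matrix.det_permute']
    congr 1
    ext i j
    simp [hσ]

/-- The volume of `v₁, …, vₙ, w₁, …, wₙ`. -/
def vol (v w : Fin n → Fin (n + n) → ℂ) : ℂ :=
  (Matrix.of fun i j : Fin n ⊕ Fin n => Sum.elim v w i (finSumFinEquiv j)).det

/-- The determinant of the mutual Gram matrix. -/
def gram (v w : Fin n → Fin (n + n) → ℂ) : ℂ :=
  (Matrix.of fun i j => Q (v i) (w j)).det

/-- With the columns of `J` moved to the front, the coordinate rows become `(0 | 1)`, so the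
determinant is the `J`-minor up to the sign of the column permutation. -/
theorem exists_vol_eq_plucker {J : Lam n} {k : Fin n → Fin (n + n)} (hk : Function.Injective k)
    (h : ∀ j, k j ∉ J.1) : ∃ s : ℂ, s * s = 1 ∧ ∀ v : Fin n → Fin (n + n) → ℂ,
      vol v (fun j => Pi.single (k j) 1) = s * plucker v J := by
  have hinj : Function.Injective (finSumFinEquiv.symm ∘ Sum.elim (J.1.orderEmbOfFin J.2) k) := by
    refine finSumFinEquiv.symm.injective.comp ?_
    refine Function.Injective.sumElim (J.1.orderEmbOfFin J.2).injective hk fun a b hab => ?_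
    exact h b (hab ▸ Finset.orderEmbOfFin_mem _ J.2 a)
  let σ : Equiv.Perm (Fin n ⊕ Fin n) :=
    Equiv.ofBijective _ (Finite.injective_iff_bijective.1 hinj)
  have hσ : ∀ x, finSumFinEquiv (σ x) = Sum.elim (J.1.orderEmbOfFin J.2) k x := fun x => by
    simp [σ]
  refine ⟨((Equiv.Perm.sign σ : ℤ) : ℂ), ?_, fun v => ?_⟩
  · rcases Int.units_eq_one_or (Equiv.Perm.sign σ) with h | h <;> simp [h]
  set M : Matrix (Fin n ⊕ Fin n) (Fin n ⊕ Fin n) ℂ := Matrix.of fun i j =>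
    Sum.elim v (fun j => Pi.single (k j) 1) i (finSumFinEquiv j) with hM
  have hblock : M.submatrix id σ = Matrix.fromBlocks
      (Matrix.of fun i j => v i (J.1.orderEmbOfFin J.2 j)) (Matrix.of fun i j => v i (k j)) 0 1 := by
    ext x y
    rcases x with a | a <;> rcases y with b | b <;>
      simp only [hM, Matrix.submatrix_apply, id, Matrix.of_apply, hσ, Sum.elim_inl,
        Sum.elim_inr, Matrix.fromBlocks_apply₁₁, Matrix.fromBlocks_apply₁₂,
        Matrix.fromBlocks_apply₂₁, Matrix.fromBlocks_apply₂₂, Matrix.zero_apply]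
    · rw [Pi.single_eq_of_ne]
      intro hab
      exact h a (hab ▸ Finset.orderEmbOfFin_mem _ J.2 b)
    · simp [Pi.single_apply, Matrix.one_apply, hk.eq_iff, eq_comm]
  have h1 : (M.submatrix id σ).det = (Equiv.Perm.sign σ : ℤ) * M.det := by
    rw [Matrix.det_permute']
  rw [hblock, Matrix.det_fromBlocks_zero₂₁, Matrix.det_one, mul_one] at h1
  rw [plucker_apply, h1, ← mul_assoc]
  have : ((Equiv.Perm.sign σ : ℤ) : ℂ) * ((Equiv.Perm.sign σ : ℤ) : ℂ) = 1 := by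
    rcases Int.units_eq_one_or (Equiv.Perm.sign σ) with h | h <;> simp [h]
  rw [this, one_mul]
  rfl

/-- The rows of `(1 | -Aᵀ)` span the orthogonal complement of those of `(1 | A)`. Both sides equal
the Schur complement determinant `det (w₂ - w₁ A)`. -/
theorem vol_graph (A : Matrix (Fin n) (Fin n) ℂ) (w : Fin n → Fin (n + n) → ℂ) :
    vol (graph A) w = gram (graph (-A.transpose)) w := by
  set w₁ : Matrix (Fin n) (Fin n) ℂ := Matrix.of fun i j => w i (Fin.castAdd n j)
  set w₂ : Matrix (Fin n) (Fin n) ℂ := Matrix.of fun i j => w i (Fin.natAdd n j)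
  have h1 : (Matrix.of fun i j : Fin n ⊕ Fin n => Sum.elim (graph A) w i (finSumFinEquiv j)) =
      Matrix.fromBlocks 1 A w₁ w₂ := by
    ext x y
    rcases x with a | a <;> rcases y with b | b <;> simp [w₁, w₂]
  have h2 : (Matrix.of fun i j => Q (graph (-A.transpose) i) (w j)) =
      (w₂ - w₁ * A).transpose := by
    ext i j
    simp only [Q, Matrix.of_apply, graph_castAdd, graph_natAdd, Matrix.transpose_apply,
      Matrix.sub_apply, Matrix.mul_apply, Matrix.neg_apply, Finset.sum_add_distrib, w₁, w₂]
    rw [sub_eq_add_neg, ← Finset.sum_neg_distrib]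
    congr 1
    · simp [Matrix.one_apply]
    · exact Finset.sum_congr rfl fun _ _ => by ring
  rw [vol, gram, h1, h2, Matrix.det_transpose, Matrix.det_fromBlocks_one₁₁]

theorem flipIdx_injective : Function.Injective (flipIdx (n := n)) := fun a b h => by
  rw [← flipIdx_flipIdx a, h, flipIdx_flipIdx]

/-- On coordinate vectors, `vol` picks out the coordinate `J` and `gram` the coordinate `dual J`,
each up to a sign. The common factor `a` makes the ratio of the signs explicit. -/
theorem exists_vol_gram_eq {J : Lam n} {k : Fin n → Fin (n + n)} (hk : Function.Injective k)
    (h : ∀ j, k j ∉ J.1) : ∃ a : ℂ, a ≠ 0 ∧ ∀ v : Fin n → Fin (n + n) → ℂ,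
      vol v (fun j => Pi.single (k j) 1) = a * (eps J * plucker v J) ∧
      gram v (fun j => Pi.single (k j) 1) =
        a * ((-1) ^ deg J * eps (dual J) * plucker v (dual J)) := by
  obtain ⟨s, hs, hv⟩ := exists_vol_eq_plucker hk h
  obtain ⟨t, ht, hg⟩ := exists_det_eq_plucker (J := dual J) (flipIdx_injective.comp hk)
    (fun j => by rw [mem_dual]; simpa using h j)
  have hg' : ∀ v : Fin n → Fin (n + n) → ℂ,
      gram v (fun j => Pi.single (k j) 1) = t * plucker v (dual J) := by
    intro v
    rw [← hg v, gram]
    congr 1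
    ext i j
    simp [Q_single]
  have hRd : (rowsIn J)ᶜ.card = deg J := (deg_eq_card_compl J).symm
  have hCd : (colsIn J).card = deg J := (deg_eq_card_colsIn J).symm
  -- The signs do not depend on `v`, so their ratio can be read off from `vol_graph` for a matrix
  -- whose minor at `J` is `1`.
  obtain ⟨A, hA⟩ := exists_minor_eq_one hRd hCd
  have e1 : plucker (graph A) J = eps J := by
    rw [plucker_graph A J hRd hCd, hA, mul_one]
  have e2 : plucker (graph (-A.transpose)) (dual J) = (-1) ^ deg J * eps (dual J) := by
    rw [plucker_graph _ (dual J) (k := deg J) (by simpa using hCd) (by simpa using hRd)]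
    have : (-A.transpose).submatrix ((rowsIn (dual J))ᶜ.orderEmbOfFin (by simpa using hCd))
        ((colsIn (dual J)).orderEmbOfFin (by simpa using hRd)) =
        -(A.submatrix ((rowsIn J)ᶜ.orderEmbOfFin hRd) ((colsIn J).orderEmbOfFin hCd)).transpose := by
      ext a b
      simp
    rw [this, Matrix.det_neg, Matrix.det_transpose, hA]
    simp [mul_comm]
  have key := vol_graph A fun j => Pi.single (k j) 1
  rw [hv, hg', e1, e2] at key
  have hJ := eps_mul_self J
  have hJ' := eps_mul_self (dual J)
  have hd : ((-1 : ℂ) ^ deg J) * (-1) ^ deg J = 1 := by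
    rw [← mul_pow]; simp
  refine ⟨s * eps J, fun h0 => ?_, fun v => ⟨?_, ?_⟩⟩
  · have : (s * eps J) * (s * eps J) = 1 := by linear_combination (eps J * eps J) * hs + hJ
    rw [h0] at this
    simp at this
  · rw [hv]
    linear_combination (-s * plucker v J) * hJ
  · rw [hg', key]
    linear_combination (-t * plucker v (dual J) * (eps (dual J) * eps (dual J))) * hd -
      t * plucker v (dual J) * hJ'

/-! ### The two summands of `⋀ⁿ V` -/

variable (n) in
/-- For `c = ±1`, the eigenspaces of the star operator. -/
def eigen (c : ℂ) : Submodule ℂ (PluckerSpace n) where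
  carrier := {x | ∀ J, eps J * x J = c * ((-1) ^ deg J * eps (dual J) * x (dual J))}
  add_mem' := fun {x y} hx hy J => by
    simp only [Pi.add_apply]
    linear_combination hx J + hy J
  zero_mem' := fun J => by simp
  smul_mem' := fun a x hx J => by
    simp only [Pi.smul_apply, smul_eq_mul]
    linear_combination a * hx J

theorem mem_eigen {c : ℂ} {x : PluckerSpace n} :
    x ∈ eigen n c ↔ ∀ J, eps J * x J = c * ((-1) ^ deg J * eps (dual J) * x (dual J)) := Iff.rfl

theorem eq_zero_of_mem_eigen {x : PluckerSpace n} (h₁ : x ∈ eigen n 1) (h₂ : x ∈ eigen n (-1)) :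
    x = 0 := by
  ext J
  have h : eps J * x J = 0 := by linear_combination (h₁ J + h₂ J) / 2
  exact (mul_eq_zero.1 h).resolve_left (eps_ne_zero J)

theorem exists_injective_compl (J : Lam n) :
    ∃ k : Fin n → Fin (n + n), Function.Injective k ∧ ∀ j, k j ∉ J.1 := by
  have h : J.1ᶜ.card = n := by
    rw [Finset.card_compl, Fintype.card_fin, show J.1.card = n from J.2]
    omega
  exact ⟨J.1ᶜ.orderEmbOfFin h, (J.1ᶜ.orderEmbOfFin h).injective, fun j =>
    Finset.mem_compl.1 (Finset.orderEmbOfFin_mem _ h j)⟩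

theorem plucker_mem_eigen {v : Fin n → Fin (n + n) → ℂ} {c : ℂ}
    (h : ∀ w, vol v w = c * gram v w) : plucker v ∈ eigen n c := by
  intro J
  obtain ⟨k, hk, hkJ⟩ := exists_injective_compl J
  obtain ⟨a, ha, hv⟩ := exists_vol_gram_eq hk hkJ
  have := h fun j => Pi.single (k j) 1
  rw [(hv v).1, (hv v).2] at this
  apply mul_left_cancel₀ ha
  linear_combination this

theorem vol_eq_of_plucker_mem_eigen {v : Fin n → Fin (n + n) → ℂ} {c : ℂ}
    (h : plucker v ∈ eigen n c) (w : Fin n → Fin (n + n) → ℂ) : vol v w = c * gram v w := by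
  classical
  let f : MultilinearMap ℂ (fun _ : Fin n => Fin (n + n) → ℂ) ℂ :=
    ((Matrix.detRowAlternating.compLinearMap (LinearMap.funLeft ℂ ℂ
      (finSumFinEquiv (m := n) (n := n)))).toMultilinearMap.currySum
        (N := fun _ => Fin (n + n) → ℂ)) v
  let g : MultilinearMap ℂ (fun _ : Fin n => Fin (n + n) → ℂ) ℂ :=
    (Matrix.detRowAlternating.compLinearMap
      (LinearMap.pi fun i => Qform n (v i))).toMultilinearMap
  have hf : ∀ w, f w = vol v w := by
    intro w
    simp only [f, vol, MultilinearMap.currySum_apply]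
    change Matrix.det _ = Matrix.det _
    congr 1
  have hg : ∀ w, g w = gram v w := by
    intro w
    rw [gram, ← Matrix.det_transpose]
    rfl
  -- Multilinearity in `w` reduces to coordinate vectors: distinct ones give the eigenspace equation
  -- for the complementary index set, repeated ones make both sides zero.
  have key : f = c • g := by
    refine Basis.ext_multilinear (fun _ => Pi.basisFun ℂ (Fin (n + n))) fun k => ?_
    simp only [Pi.basisFun_apply, _root_.smul_apply, hf, hg, smul_eq_mul]
    by_cases hk : Function.Injective k
    · have hcard : (Finset.univ.image k)ᶜ.card = n := by
        rw [Finset.card_compl, Finset.card_image_of_injective _ hk]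
        simp
      obtain ⟨a, -, hv⟩ := exists_vol_gram_eq (J := ⟨(Finset.univ.image k)ᶜ, hcard⟩) hk
        (fun j => by simp)
      rw [(hv v).1, (hv v).2, h]
      ring
    · obtain ⟨i, j, hij, hne⟩ : ∃ i j, k i = k j ∧ i ≠ j := by
        simpa [Function.Injective] using hk
      have h1 : vol v (fun j => Pi.single (k j) 1) = 0 := by
        refine Matrix.det_zero_of_row_eq (i := Sum.inr i) (j := Sum.inr j) (by simpa) ?_
        ext x
        simp [hij]
      have h2 : gram v (fun j => Pi.single (k j) 1) = 0 := by
        refine Matrix.det_zero_of_column_eq hne fun x => ?_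
        simp [hij]
      rw [h1, h2, mul_zero]
  rw [← hf, ← hg, key]
  rfl

/-- The Gram matrix of `(v, w)` against `(v, w')` is `M P M'ᵀ`; its corner `Q (v i) (v j)` vanishes.
A second factor `P` makes it block triangular, and `det P ^ 2 = 1`. -/
theorem vol_mul_vol {v : Fin n → Fin (n + n) → ℂ} (hv : ∀ i j, Q (v i) (v j) = 0)
    (w w' : Fin n → Fin (n + n) → ℂ) : vol v w * vol v w' = gram v w * gram v w' := by
  set M : Matrix (Fin n ⊕ Fin n) (Fin n ⊕ Fin n) ℂ :=
    Matrix.of fun i j => Sum.elim v w i (finSumFinEquiv j) with hM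
  set M' : Matrix (Fin n ⊕ Fin n) (Fin n ⊕ Fin n) ℂ :=
    Matrix.of fun i j => Sum.elim v w' i (finSumFinEquiv j) with hM'
  set P : Matrix (Fin n ⊕ Fin n) (Fin n ⊕ Fin n) ℂ := Matrix.fromBlocks 0 1 1 0 with hP
  have hPP : P * P = 1 := by
    simp [hP, Matrix.fromBlocks_multiply]
  have h1 : M * P * M'.transpose * P = Matrix.fromBlocks
      (Matrix.of fun i j => Q (v i) (w' j)) 0 (Matrix.of fun i j => Q (w i) (w' j))
      (Matrix.of fun i j => Q (v i) (w j)).transpose := by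
    have h2 : M * P * M'.transpose = Matrix.of fun i j => Q (Sum.elim v w i) (Sum.elim v w' j) := by
      ext i j
      simp only [Matrix.mul_apply, hM, hM', hP, Matrix.of_apply, Matrix.transpose_apply,
        Fintype.sum_sum_type, Q, finSumFinEquiv_apply_left, finSumFinEquiv_apply_right,
        Matrix.fromBlocks_apply₁₁, Matrix.fromBlocks_apply₁₂, Matrix.fromBlocks_apply₂₁,
        Matrix.fromBlocks_apply₂₂, Matrix.zero_apply, mul_zero, Finset.sum_const_zero,
        Matrix.one_apply, mul_ite, mul_one, Finset.sum_ite_eq', Finset.mem_univ, if_true,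
        zero_add, add_zero]
      rw [← Finset.sum_add_distrib]
      exact Finset.sum_congr rfl fun _ _ => by ring
    rw [h2]
    ext i j
    rcases i with i | i <;> rcases j with j | j <;>
      simp [Matrix.mul_apply, hP, Matrix.one_apply, hv, Q_comm]
  have h3 := congrArg Matrix.det h1
  rw [Matrix.det_fromBlocks_zero₁₂, Matrix.det_mul, Matrix.det_mul, Matrix.det_mul,
    Matrix.det_transpose, Matrix.det_transpose] at h3
  have h4 : P.det * P.det = 1 := by rw [← Matrix.det_mul, hPP, Matrix.det_one]
  change M.det * M'.det = (Matrix.of fun i j => Q (v i) (w j)).det *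
    (Matrix.of fun i j => Q (v i) (w' j)).det
  linear_combination h3 - M.det * M'.det * h4

/-- By `vol_mul_vol`, `vol v` and `gram v` agree up to a sign at one `w₀` with nonzero volume, and
the same identity then propagates this sign to every `w`. -/
theorem plucker_mem_eigen_of_isotropic {v : Fin n → Fin (n + n) → ℂ}
    (hv : ∀ i j, Q (v i) (v j) = 0) : plucker v ∈ eigen n 1 ∨ plucker v ∈ eigen n (-1) := by
  have h := vol_mul_vol hv
  by_cases h0 : ∀ w, vol v w = 0
  · refine Or.inl (plucker_mem_eigen fun w => ?_)
    have h1 := h w w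
    rw [h0, zero_mul] at h1
    rw [h0, one_mul, mul_self_eq_zero.1 h1.symm]
  · push Not at h0
    obtain ⟨w₀, h0⟩ := h0
    rcases mul_self_eq_mul_self_iff.1 (h w₀ w₀) with h1 | h1
    · refine Or.inl (plucker_mem_eigen fun w => mul_right_cancel₀ h0 ?_)
      rw [h w w₀, ← h1]; ring
    · refine Or.inr (plucker_mem_eigen fun w => mul_right_cancel₀ h0 ?_)
      rw [h w w₀, h1]; ring

/-- A linear form vanishing on the range would give a linear relation among the `v i`, because `Q`
is nondegenerate. -/
theorem surjective_pi_Qform {v : Fin n → Fin (n + n) → ℂ} (hv : LinearIndependent ℂ v) :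
    Function.Surjective (LinearMap.pi fun i => Qform n (v i)) := by
  rw [← LinearMap.range_eq_top]
  by_contra hne
  obtain ⟨f, hf, hker⟩ := Submodule.exists_le_ker_of_lt_top _ (lt_top_iff_ne_top.2 hne)
  have hfx : ∀ y : Fin n → ℂ, f y = ∑ i, y i * f (Pi.single i 1) := fun y => by
    conv_lhs => rw [pi_eq_sum_univ' y]
    simp
  have h0 : ∑ i, f (Pi.single i 1) • v i = 0 := by
    refine eq_zero_of_forall_Q fun x => ?_
    have h1 : f (LinearMap.pi (fun i => Qform n (v i)) x) = 0 := hker ⟨x, rfl⟩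
    rw [hfx] at h1
    rw [← Qform_apply, map_sum, LinearMap.sum_apply, ← h1]
    exact Finset.sum_congr rfl fun i _ => by simp [mul_comm]
  have h2 := Fintype.linearIndependent_iff.1 hv _ h0
  refine hf (LinearMap.ext fun y => ?_)
  rw [hfx]
  simp [h2]

/-- Take vectors `u` dual to `v` under `Q` and replace `u i` by `v j`. The volume vanishes because
`v j` is repeated, while the Gram determinant becomes `Q (v i) (v j)`. -/
theorem isotropic_of_plucker_mem_eigen {v : Fin n → Fin (n + n) → ℂ} {c : ℂ} (hc : c ≠ 0)
    (hv : plucker v ≠ 0) (h : plucker v ∈ eigen n c) (i j : Fin n) : Q (v i) (v j) = 0 := by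
  classical
  choose u hu using fun l => surjective_pi_Qform (linearIndependent_of_plucker_ne_zero hv)
    (Pi.single l 1)
  have hu' : ∀ l k, Q (v k) (u l) = (1 : Matrix (Fin n) (Fin n) ℂ) k l := fun l k => by
    have := congrFun (hu l) k
    simpa [Pi.single_apply, Matrix.one_apply] using this
  have h1 := vol_eq_of_plucker_mem_eigen h (Function.update u i (v j))
  have h2 : vol v (Function.update u i (v j)) = 0 := by
    refine Matrix.det_zero_of_row_eq (i := Sum.inl j) (j := Sum.inr i) (by simp) ?_
    ext x
    simp only [Matrix.of_apply, Sum.elim_inl, Sum.elim_inr, Function.update_self]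
  have h3 : gram v (Function.update u i (v j)) = Q (v i) (v j) := by
    have : (Matrix.of fun k l => Q (v k) (Function.update u i (v j) l)) =
        (1 : Matrix (Fin n) (Fin n) ℂ).updateCol i fun k => Q (v k) (v j) := by
      ext k l
      by_cases hl : l = i
      · subst hl; simp
      · simp [hl, hu']
    rw [gram, this, ← Matrix.cramer_apply, Matrix.cramer_one]
    rfl
  rw [h2, h3] at h1
  exact (mul_eq_zero.1 h1.symm).resolve_left hc

theorem mem_eigen_of_mem_affineCone {x : PluckerSpace n}
    (hx : x ∈ affineCone (isotropicGrassmannian n)) : x ∈ eigen n 1 ∨ x ∈ eigen n (-1) := by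
  obtain ⟨-, c, v, hv, rfl⟩ := mem_affineCone_isotropic.1 hx
  exact (plucker_mem_eigen_of_isotropic hv).imp (Submodule.smul_mem _ _) (Submodule.smul_mem _ _)

theorem mem_affineCone_isotropic_of_mem_eigen {x : PluckerSpace n} {c : ℂ} (hc : c ≠ 0)
    (hx : x ∈ affineCone (grassmannian n)) (h : x ∈ eigen n c) :
    x ∈ affineCone (isotropicGrassmannian n) := by
  obtain ⟨h0, a, v, rfl⟩ := mem_affineCone_grassmannian.1 hx
  have ha : a ≠ 0 := fun h => h0 (by simp [h])
  have hv : plucker v ≠ 0 := fun h => h0 (by simp [h])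
  rw [Submodule.smul_mem_iff _ ha] at h
  exact mem_affineCone_isotropic.2 ⟨h0, a, v, isotropic_of_plucker_mem_eigen hc hv h, rfl⟩

/-! ### Isotropic subspaces span `⋀ⁿ V` -/

/-- Write `b i` as half the sum of `b i + b' i` and `b i - b' i` and expand multilinearly: for every
choice of signs the resulting vectors span an isotropic subspace. -/
theorem plucker_mem_span_of_orthogonal {b b' : Fin n → Fin (n + n) → ℂ}
    (hb : ∀ i j, i ≠ j → Q (b i) (b j) = 0) (hb' : ∀ i j, i ≠ j → Q (b' i) (b' j) = 0)
    (hbb' : ∀ i j, Q (b i) (b' j) = 0) (h : ∀ i, Q (b i) (b i) + Q (b' i) (b' i) = 0) :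
    plucker b ∈ Submodule.span ℂ (affineCone (isotropicGrassmannian n)) := by
  have h1 : b = (fun i => (1 / 2 : ℂ) • (b i + b' i)) + fun i => (1 / 2 : ℂ) • (b i - b' i) := by
    ext i x
    simp
    ring
  have h2 := (pluckerAlt n).toMultilinearMap.map_add_univ
    (fun i => (1 / 2 : ℂ) • (b i + b' i)) (fun i => (1 / 2 : ℂ) • (b i - b' i))
  rw [← h1] at h2
  change plucker b = _ at h2
  rw [h2]
  refine Submodule.sum_mem _ fun s _ => ?_
  change plucker _ ∈ _
  set w : Fin n → Fin (n + n) → ℂ := s.piecewise (fun i => (1 / 2 : ℂ) • (b i + b' i))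
    (fun i => (1 / 2 : ℂ) • (b i - b' i)) with hw
  obtain ⟨ε, hε, hwε⟩ : ∃ ε : Fin n → ℂ, (∀ i, ε i * ε i = 1) ∧
      ∀ i, w i = (1 / 2 : ℂ) • (b i + ε i • b' i) := by
    refine ⟨fun i => if i ∈ s then 1 else -1, fun i => ?_, fun i => ?_⟩
    · by_cases hi : i ∈ s <;> simp [hi]
    · by_cases hi : i ∈ s <;> simp [hw, hi, sub_eq_add_neg]
  have hbb'' : ∀ i j, Q (b' i) (b j) = 0 := fun i j => by rw [Q_comm, hbb']
  have hiso : ∀ i j, Q (w i) (w j) = 0 := by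
    intro i j
    rw [hwε, hwε, ← Qform_apply]
    simp only [map_add, map_smul, LinearMap.add_apply, LinearMap.smul_apply, Qform_apply, hbb',
      hbb'', smul_eq_mul]
    by_cases hij : i = j
    · subst hij
      linear_combination (1 / 4 : ℂ) * h i + (1 / 4 * Q (b' i) (b' i)) * hε i
    · rw [hb i j hij, hb' i j hij]; ring
  by_cases h0 : plucker w = 0
  · rw [h0]; exact Submodule.zero_mem _
  · exact Submodule.subset_span (mem_affineCone_isotropic.2 ⟨h0, 1, w, hiso, by simp⟩)

theorem span_affineCone_isotropic :
    Submodule.span ℂ (affineCone (isotropicGrassmannian n)) = ⊤ := by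
  classical
  have : Invertible (2 : ℂ) := invertibleOfNonzero two_ne_zero
  obtain ⟨B, hB⟩ := LinearMap.BilinForm.exists_orthogonal_basis (B := Qform n)
    Qform_isSymm
  have hB0 := hB.not_isOrtho_basis_self_of_separatingLeft Qform_nondegenerate.1
  have hBne : ∀ i j, i ≠ j → Q (B i) (B j) = 0 := fun i j hij => hB hij
  rw [eq_top_iff, ← span_range_plucker]
  have key : ∀ k : Fin n → Fin (finrank ℂ (Fin (n + n) → ℂ)),
      plucker (fun j => B (k j)) ∈ Submodule.span ℂ (affineCone (isotropicGrassmannian n)) := by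
    intro k
    by_cases hk : Function.Injective k
    · have hcard : (Finset.univ.image k)ᶜ.card = n := by
        rw [Finset.card_compl, Finset.card_image_of_injective _ hk]
        simp
      set l := (Finset.univ.image k)ᶜ.orderEmbOfFin hcard with hl
      have hlk : ∀ i j, k i ≠ l j := fun i j hij => by
        have := Finset.orderEmbOfFin_mem _ hcard j
        rw [← hl, ← hij] at this
        simp at this
      -- The `n` basis vectors not chosen by `k` play the role of `b'`; a square root rescales each
      -- so that its norm is opposite to that of its partner.
      have : ∀ i, ∃ a : ℂ, a * a = -(Q (B (k i)) (B (k i)) / Q (B (l i)) (B (l i))) := fun i => by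
        obtain ⟨a, ha⟩ := IsAlgClosed.exists_pow_nat_eq
          (-(Q (B (k i)) (B (k i)) / Q (B (l i)) (B (l i)))) (n := 2) (by norm_num)
        exact ⟨a, by rw [← ha]; ring⟩
      choose a ha using this
      refine plucker_mem_span_of_orthogonal (b' := fun i => a i • B (l i)) ?_ ?_ ?_ ?_
      · exact fun i j hij => hBne _ _ fun h => hij (hk h)
      · intro i j hij
        rw [← Qform_apply]
        simp [hBne _ _ fun h => hij (l.injective h)]
      · intro i j
        rw [← Qform_apply]
        simp [hBne _ _ (hlk i j)]
      · intro i
        have h0 : Q (B (l i)) (B (l i)) ≠ 0 := hB0 (l i)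
        have h1 : Q (a i • B (l i)) (a i • B (l i)) = a i * a i * Q (B (l i)) (B (l i)) := by
          rw [← Qform_apply]
          simp only [map_smul, LinearMap.smul_apply, Qform_apply, smul_eq_mul]
          ring
        rw [h1, ha]
        field_simp
        ring
    · obtain ⟨i, j, hij, hne⟩ : ∃ i j, k i = k j ∧ i ≠ j := by
        simpa [Function.Injective] using hk
      have : pluckerAlt n (fun j => B (k j)) = 0 :=
        (pluckerAlt n).map_eq_zero_of_eq _ (by rw [hij]) hne
      rw [← pluckerAlt_apply, this]
      exact Submodule.zero_mem _
  have hq : (Submodule.mkQ (Submodule.span ℂ (affineCone (isotropicGrassmannian n)))).compAlternatingMap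
      (pluckerAlt n) = 0 := by
    refine Basis.ext_alternating B fun k _ => ?_
    simpa using key k
  refine Submodule.span_le.2 ?_
  rintro _ ⟨v, rfl⟩
  have := congrArg (fun f => f v) hq
  simpa using this

/-- The isotropic vectors span everything and each lies in one of two eigenspaces with zero
intersection, so those in an eigenspace must span it. -/
theorem span_affineCone_inf_eigen {c : ℂ} (hc : c = 1 ∨ c = -1) :
    Submodule.span ℂ (affineCone (isotropicGrassmannian n) ∩ eigen n c) = eigen n c := by
  apply le_antisymm (Submodule.span_le.2 Set.inter_subset_right)
  intro x hx
  have h1 : x ∈ Submodule.span ℂ (affineCone (isotropicGrassmannian n)) := by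
    rw [span_affineCone_isotropic]; trivial
  have h2 : affineCone (isotropicGrassmannian n) ⊆
      (affineCone (isotropicGrassmannian n) ∩ eigen n c) ∪
        (affineCone (isotropicGrassmannian n) ∩ eigen n (-c)) := by
    intro y hy
    have := mem_eigen_of_mem_affineCone hy
    rcases hc with rfl | rfl
    · exact this.imp (fun h => ⟨hy, h⟩) fun h => ⟨hy, h⟩
    · exact this.symm.imp (fun h => ⟨hy, h⟩) fun h => ⟨hy, by simpa using h⟩
  have h3 := Submodule.span_mono h2 h1
  rw [Submodule.span_union] at h3
  obtain ⟨a, ha, b, hb, rfl⟩ := Submodule.mem_sup.1 h3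
  have ha' : a ∈ eigen n c := (Submodule.span_le.2 Set.inter_subset_right) ha
  have hb' : b ∈ eigen n (-c) := (Submodule.span_le.2 Set.inter_subset_right) hb
  have hb'' : b ∈ eigen n c := by simpa using Submodule.sub_mem _ hx ha'
  have hb0 : b = 0 := by
    rcases hc with rfl | rfl
    · exact eq_zero_of_mem_eigen hb'' hb'
    · exact eq_zero_of_mem_eigen (by simpa using hb') hb''
  rw [hb0, add_zero]
  exact ha

/-! ### The affine chart at `I₀` -/

variable (n) in
/-- `I₀`, as an element of `Λ`. -/
def baseIndex : Lam n := isoIndex ∅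

theorem baseIndex_val : (baseIndex n).1 = Izero n := by
  rw [eq_glue, Izero_eq]
  simp [baseIndex]

theorem eq_baseIndex_of_deg_eq_zero {J : Lam n} (h : deg J = 0) : J = baseIndex n := by
  refine Lam_ext ?_ ?_
  · have h1 : (rowsIn J)ᶜ = ∅ := by rwa [deg_eq_card_compl, Finset.card_eq_zero] at h
    rw [← compl_compl (rowsIn J), h1]
    simp [baseIndex]
  · have h1 : colsIn J = ∅ := by rwa [deg_eq_card_colsIn, Finset.card_eq_zero] at h
    simp [baseIndex, h1]

theorem plucker_baseIndex (v : Fin n → Fin (n + n) → ℂ) :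
    plucker v (baseIndex n) = (Matrix.of fun i j => v i (Fin.castAdd n j)).det := by
  have h : (fun j : Fin n => Fin.castAdd n j) =
      (baseIndex n).1.orderEmbOfFin (baseIndex n).2 := by
    apply Finset.orderEmbOfFin_unique
    · intro x
      rw [← mem_rowsIn]
      simp [baseIndex]
    · intro a b hab
      exact Fin.lt_def.2 hab
  rw [plucker_apply, ← h]

theorem plucker_graph_baseIndex (A : Matrix (Fin n) (Fin n) ℂ) :
    plucker (graph A) (baseIndex n) = 1 := by
  rw [plucker_baseIndex]
  simp only [graph_castAdd]
  exact Matrix.det_one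

theorem plucker_graph_smul (a : ℂ) (A : Matrix (Fin n) (Fin n) ℂ) (J : Lam n) :
    plucker (graph (a • A)) J = a ^ deg J * plucker (graph A) J := by
  have hR : (rowsIn J)ᶜ.card = deg J := (deg_eq_card_compl J).symm
  have hC : (colsIn J).card = deg J := (deg_eq_card_colsIn J).symm
  rw [plucker_graph _ J hR hC, plucker_graph A J hR hC]
  change _ * (a • A.submatrix _ _).det = _
  rw [Matrix.det_smul, Fintype.card_fin]
  ring

theorem plucker_graph_zero : plucker (graph (0 : Matrix (Fin n) (Fin n) ℂ)) = e (baseIndex n) := by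
  ext J
  by_cases h : J = baseIndex n
  · subst h
    simp [plucker_graph_baseIndex, e]
  · have := plucker_graph_smul 0 (0 : Matrix (Fin n) (Fin n) ℂ) J
    rw [zero_smul, zero_pow fun h0 => h (eq_baseIndex_of_deg_eq_zero h0), zero_mul] at this
    rw [this, e, Pi.single_eq_of_ne h]

theorem plucker_mul (M : Matrix (Fin n) (Fin n) ℂ) (v : Fin n → Fin (n + n) → ℂ) :
    plucker (fun i => ∑ j, M i j • v j) = M.det • plucker v := by
  ext J
  rw [Pi.smul_apply, plucker_apply, plucker_apply, smul_eq_mul, ← Matrix.det_mul]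
  congr 1
  ext i j
  simp [Matrix.mul_apply]

/-- The left square block is invertible; multiplying the rows by its inverse brings them to the form
`(1 | A)`. -/
theorem exists_graph_of_ne_zero {v : Fin n → Fin (n + n) → ℂ}
    (h : plucker v (baseIndex n) ≠ 0) :
    ∃ A, plucker v = plucker v (baseIndex n) • plucker (graph A) ∧
      ∀ i, graph A i ∈ Submodule.span ℂ (Set.range v) := by
  rw [plucker_baseIndex] at h
  set P : Matrix (Fin n) (Fin n) ℂ := Matrix.of fun i j => v i (Fin.castAdd n j) with hP
  have hu : IsUnit P.det := IsUnit.mk0 _ h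
  have hg : graph (Matrix.of fun i j => ∑ l, P⁻¹ i l * v l (Fin.natAdd n j)) =
      fun i => ∑ l, P⁻¹ i l • v l := by
    ext i k
    refine Fin.addCases (fun j => ?_) (fun j => ?_) k
    · rw [graph_castAdd, ← Matrix.nonsing_inv_mul P hu, Matrix.mul_apply]
      simp [hP]
    · simp
  refine ⟨Matrix.of fun i j => ∑ l, P⁻¹ i l * v l (Fin.natAdd n j), ?_, fun i => ?_⟩
  · rw [hg, plucker_mul, plucker_baseIndex, smul_smul, ← hP, ← Matrix.det_mul,
      Matrix.mul_nonsing_inv P hu, Matrix.det_one, one_smul]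
  · rw [hg]
    exact Submodule.sum_mem _ fun l _ =>
      Submodule.smul_mem _ _ (Submodule.subset_span ⟨l, rfl⟩)

variable (n) in
/-- The skew-symmetric matrices. -/
def skew : Submodule ℂ (Matrix (Fin n) (Fin n) ℂ) where
  carrier := {A | ∀ i j, A j i + A i j = 0}
  add_mem' := fun {A B} hA hB i j => by
    simp only [Matrix.add_apply]
    linear_combination hA i j + hB i j
  zero_mem' := fun i j => by simp
  smul_mem' := fun a A hA i j => by
    simp only [Matrix.smul_apply, smul_eq_mul]
    linear_combination a * hA i j

theorem graph_mem_affineCone_grassmannian (A : Matrix (Fin n) (Fin n) ℂ) :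
    plucker (graph A) ∈ affineCone (grassmannian n) :=
  mem_affineCone_grassmannian.2 ⟨fun h => by
    have := plucker_graph_baseIndex A
    simp [h] at this, 1, graph A, by simp⟩

theorem graph_mem_affineCone_isotropic {A : Matrix (Fin n) (Fin n) ℂ} (hA : A ∈ skew n) :
    plucker (graph A) ∈ affineCone (isotropicGrassmannian n) :=
  mem_affineCone_isotropic.2 ⟨fun h => by
    have := plucker_graph_baseIndex A
    simp [h] at this, 1, graph A, fun i j => by rw [Q_graph, hA], by simp⟩

theorem exists_graph_of_mem_grassmannian {x : PluckerSpace n}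
    (hx : x ∈ affineCone (grassmannian n)) (h : x (baseIndex n) ≠ 0) :
    ∃ A, x = x (baseIndex n) • plucker (graph A) := by
  obtain ⟨-, c, v, rfl⟩ := mem_affineCone_grassmannian.1 hx
  rw [Pi.smul_apply, smul_eq_mul] at h
  obtain ⟨A, hA, -⟩ := exists_graph_of_ne_zero (right_ne_zero_of_mul h)
  refine ⟨A, ?_⟩
  conv_lhs => rw [hA]
  rw [smul_smul]
  rfl

theorem exists_graph_of_mem_isotropic {x : PluckerSpace n}
    (hx : x ∈ affineCone (isotropicGrassmannian n)) (h : x (baseIndex n) ≠ 0) :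
    ∃ A ∈ skew n, x = x (baseIndex n) • plucker (graph A) := by
  obtain ⟨-, c, v, hv, rfl⟩ := mem_affineCone_isotropic.1 hx
  rw [Pi.smul_apply, smul_eq_mul] at h
  obtain ⟨A, hA, hs⟩ := exists_graph_of_ne_zero (right_ne_zero_of_mul h)
  refine ⟨A, fun i j => ?_, ?_⟩
  · rw [← Q_graph]
    exact Q_eq_zero_of_mem_span hv (hs i) (hs j)
  · conv_lhs => rw [hA]
    rw [smul_smul]
    rfl

/-- The index of the Plücker coordinate which is, up to sign, an entry of `A` on graphs. -/
def entryIndex (i j : Fin n) : Lam n :=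
  mkLam {i}ᶜ {j} (by
    have := Finset.card_add_card_compl ({i} : Finset (Fin n))
    rw [Fintype.card_fin] at this
    simp only [Finset.card_singleton] at this ⊢
    omega)

theorem plucker_graph_entryIndex (A : Matrix (Fin n) (Fin n) ℂ) (i j : Fin n) :
    plucker (graph A) (entryIndex i j) = eps (entryIndex i j) * A i j := by
  have hR : (rowsIn (entryIndex i j))ᶜ = {i} := by simp [entryIndex]
  have hC : colsIn (entryIndex i j) = {j} := by simp [entryIndex]
  have hR1 : (rowsIn (entryIndex i j))ᶜ.card = 1 := by rw [hR]; simp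
  have hC1 : (colsIn (entryIndex i j)).card = 1 := by rw [hC]; simp
  have h1 := Finset.orderEmbOfFin_mem _ hR1 0
  have h2 := Finset.orderEmbOfFin_mem _ hC1 0
  rw [plucker_graph A _ hR1 hC1, Matrix.det_fin_one, Matrix.submatrix_apply]
  rw [Finset.mem_singleton.1 (hR.subset h1), Finset.mem_singleton.1 (hC.subset h2)]

/-- A linear map which recovers `A` from the Plücker vector of its graph. -/
def entries : PluckerSpace n →ₗ[ℂ] Matrix (Fin n) (Fin n) ℂ where
  toFun x := Matrix.of fun i j => eps (entryIndex i j) * x (entryIndex i j)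
  map_add' x y := by ext i j; simp [mul_add]
  map_smul' a x := by ext i j; simp; ring

theorem entries_plucker_graph (A : Matrix (Fin n) (Fin n) ℂ) : entries (plucker (graph A)) = A := by
  ext i j
  simp only [entries, LinearMap.coe_mk, AddHom.coe_mk, Matrix.of_apply, plucker_graph_entryIndex]
  rw [← mul_assoc, eps_mul_self, one_mul]

/-! ### Analyticity -/

theorem analyticAt_plucker {E : Type*} [NormedAddCommGroup E] [NormedSpace ℂ E]
    {f : E → Fin n → Fin (n + n) → ℂ} {x : E}
    (hf : ∀ i k, AnalyticAt ℂ (fun t => f t i k) x) : AnalyticAt ℂ (fun t => plucker (f t)) x := by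
  rw [analyticAt_pi_iff]
  intro J
  simp only [plucker_apply, Matrix.det_apply, Matrix.of_apply]
  refine Finset.analyticAt_fun_sum _ fun σ _ => ?_
  have : AnalyticAt ℂ (fun t => ∏ i, f t (σ i) (J.1.orderEmbOfFin J.2 i)) x :=
    Finset.analyticAt_fun_prod _ fun i _ => hf _ _
  exact this.const_smul

theorem analyticAt_linearMap {E F : Type*} [NormedAddCommGroup E] [NormedSpace ℂ E]
    [FiniteDimensional ℂ E] [NormedAddCommGroup F] [NormedSpace ℂ F] (f : E →ₗ[ℂ] F) (x : E) :
    AnalyticAt ℂ f x :=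
  (LinearMap.toContinuousLinearMap f).analyticAt x

theorem analyticAt_plucker_graph {E : Type*} [NormedAddCommGroup E] [NormedSpace ℂ E]
    [FiniteDimensional ℂ E] (L : E →ₗ[ℂ] Matrix (Fin n) (Fin n) ℂ) (x : E) :
    AnalyticAt ℂ (fun t => plucker (graph (L t))) x := by
  refine analyticAt_plucker fun i k => ?_
  refine Fin.addCases (fun j => ?_) (fun j => ?_) k
  · simp only [graph_castAdd]
    exact analyticAt_const
  · simp only [graph_natAdd]
    exact analyticAt_linearMap (LinearMap.proj (R := ℂ) (φ := fun _ : Fin n => ℂ) j ∘ₗ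
      LinearMap.proj (R := ℂ) (φ := fun _ : Fin n => Fin n → ℂ) i ∘ₗ
        (Matrix.ofLinearEquiv ℂ).symm.toLinearMap ∘ₗ L) x

/-- Coordinates on a space of matrices. -/
def coords (N : Submodule ℂ (Matrix (Fin n) (Fin n) ℂ)) : (Fin (finrank ℂ N) → ℂ) ≃ₗ[ℂ] N :=
  (finBasis ℂ N).equivFun.symm

/-- The chart given by the graphs of the matrices in `N`. -/
def chart (N : Submodule ℂ (Matrix (Fin n) (Fin n) ℂ)) (t : Fin (finrank ℂ N) → ℂ) :
    PluckerSpace n :=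
  plucker (graph (coords N t : Matrix (Fin n) (Fin n) ℂ))

theorem analyticAt_chart (N : Submodule ℂ (Matrix (Fin n) (Fin n) ℂ))
    (t : Fin (finrank ℂ N) → ℂ) : AnalyticAt ℂ (chart N) t :=
  analyticAt_plucker_graph (N.subtype ∘ₗ (coords N).toLinearMap) t

theorem exists_chart_eq {N : Submodule ℂ (Matrix (Fin n) (Fin n) ℂ)}
    {A : Matrix (Fin n) (Fin n) ℂ} (hA : A ∈ N) : ∃ t, chart N t = plucker (graph A) :=
  ⟨(coords N).symm ⟨A, hA⟩, by simp [chart]⟩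

theorem chart_zero (N : Submodule ℂ (Matrix (Fin n) (Fin n) ℂ)) :
    chart N 0 = e (baseIndex n) := by
  simp [chart, plucker_graph_zero]

/-- The form `l` is the coordinate at `I₀`; the projection `m` reads the entries of `A` from the
degree one coordinates and then passes to coordinates on `N`. -/
theorem exists_isAffineChart {N : Submodule ℂ (Matrix (Fin n) (Fin n) ℂ)}
    {X : Set (ℙ ℂ (PluckerSpace n))} (h₁ : ∀ A ∈ N, plucker (graph A) ∈ affineCone X)
    (h₂ : ∀ x ∈ affineCone X, x (baseIndex n) ≠ 0 →
      ∃ A ∈ N, x = x (baseIndex n) • plucker (graph A)) :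
    ∃ l m, IsAffineChart X (chart N) l m := by
  obtain ⟨g, hg⟩ := (N.subtype ∘ₗ (coords N).toLinearMap).exists_leftInverse_of_injective
    (LinearMap.ker_eq_bot.2 (N.injective_subtype.comp (coords N).injective))
  refine ⟨ContinuousLinearMap.proj (baseIndex n),
    LinearMap.toContinuousLinearMap (g ∘ₗ entries), ?_, ?_, ?_, ?_, ?_⟩
  · exact analyticAt_chart N
  · exact fun t => h₁ _ (coords N t).2
  · exact fun t => plucker_graph_baseIndex _
  · intro t
    change g (entries (plucker (graph _))) = t
    rw [entries_plucker_graph]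
    exact congrArg (fun f => f t) hg
  · intro x hx hl
    obtain ⟨A, hA, hxA⟩ := h₂ x hx hl
    obtain ⟨t, ht⟩ := exists_chart_eq hA
    exact ⟨t, by rw [ht]; exact hxA⟩

theorem IsAffineChart.map {E : Type*} [NormedAddCommGroup E] [NormedSpace ℂ E]
    {X Y : Set (ℙ ℂ E)} {d : ℕ} {ψ : (Fin d → ℂ) → E} {l : E →L[ℂ] ℂ} {m : E →L[ℂ] (Fin d → ℂ)}
    (h : IsAffineChart X ψ l m) (Φ : E ≃L[ℂ] E)
    (hΦ : ∀ x, Φ x ∈ affineCone Y ↔ x ∈ affineCone X) :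
    IsAffineChart Y (Φ ∘ ψ) (l ∘L (Φ.symm : E →L[ℂ] E)) (m ∘L (Φ.symm : E →L[ℂ] E)) where
  analyticAt t := (Φ.analyticAt _).comp (h.analyticAt t)
  mem t := (hΦ _).2 (h.mem t)
  form t := by simp [h.form]
  proj t := by simp [h.proj]
  eq_smul x hx hl := by
    have hx' : Φ.symm x ∈ affineCone X := by rw [← hΦ]; simpa using hx
    obtain ⟨t, ht⟩ := h.eq_smul _ hx' (by simpa using hl)
    refine ⟨t, ?_⟩
    have := congrArg Φ ht
    simpa using this

theorem derivativeSpan_map {E : Type*} [NormedAddCommGroup E] [NormedSpace ℂ E] {d : ℕ}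
    {ψ : (Fin d → ℂ) → E} (Φ : E ≃L[ℂ] E) (s : ℕ) :
    derivativeSpan (Φ ∘ ψ) s = (derivativeSpan ψ s).map Φ.toLinearEquiv.toLinearMap := by
  rw [derivativeSpan, derivativeSpan, Submodule.map_span]
  congr 1
  ext x
  simp only [Set.mem_ofPred_eq, Set.mem_image, Φ.iteratedFDeriv_comp_left]
  constructor
  · rintro ⟨k, hk, c, rfl⟩
    exact ⟨_, ⟨k, hk, c, rfl⟩, rfl⟩
  · rintro ⟨_, ⟨k, hk, c, rfl⟩, rfl⟩
    exact ⟨k, hk, c, rfl⟩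

/-! ### Isometries -/

theorem extEquiv_mem_grassmannian_iff (g : (Fin (n + n) → ℂ) ≃ₗ[ℂ] (Fin (n + n) → ℂ))
    {x : PluckerSpace n} :
    extEquiv g x ∈ affineCone (grassmannian n) ↔ x ∈ affineCone (grassmannian n) := by
  simp only [mem_affineCone_grassmannian, ne_eq, LinearEquiv.map_eq_zero_iff]
  refine and_congr_right fun _ => ⟨?_, ?_⟩
  · rintro ⟨c, v, h⟩
    refine ⟨c, fun i => g.symm (v i), ?_⟩
    rw [← extEquiv_symm_plucker, ← map_smul, ← h, LinearEquiv.symm_apply_apply]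
  · rintro ⟨c, v, rfl⟩
    exact ⟨c, fun i => g (v i), by rw [map_smul, extEquiv_plucker]⟩

theorem extEquiv_mem_isotropic_iff {g : (Fin (n + n) → ℂ) ≃ₗ[ℂ] (Fin (n + n) → ℂ)}
    (hg : ∀ x y, Q (g x) (g y) = Q x y) {x : PluckerSpace n} :
    extEquiv g x ∈ affineCone (isotropicGrassmannian n) ↔
      x ∈ affineCone (isotropicGrassmannian n) := by
  simp only [mem_affineCone_isotropic, ne_eq, LinearEquiv.map_eq_zero_iff]
  refine and_congr_right fun _ => ⟨?_, ?_⟩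
  · rintro ⟨c, v, hv, h⟩
    refine ⟨c, fun i => g.symm (v i), fun i j => ?_, ?_⟩
    · rw [← hg]; simpa using hv i j
    · rw [← extEquiv_symm_plucker, ← map_smul, ← h, LinearEquiv.symm_apply_apply]
  · rintro ⟨c, v, hv, rfl⟩
    exact ⟨c, fun i => g (v i), fun i j => by rw [hg, hv], by rw [map_smul, extEquiv_plucker]⟩

/-- The map `x ↦ x (1 A; 0 1)` on row vectors. -/
def shear (A : Matrix (Fin n) (Fin n) ℂ) :
    (Fin (n + n) → ℂ) →ₗ[ℂ] (Fin (n + n) → ℂ) where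
  toFun x := Fin.append (fun i => x (Fin.castAdd n i))
    (fun j => x (Fin.natAdd n j) + ∑ i, x (Fin.castAdd n i) * A i j)
  map_add' x y := by
    ext k
    refine Fin.addCases (fun j => ?_) (fun j => ?_) k
    · simp
    · simp [add_mul, Finset.sum_add_distrib]; ring
  map_smul' a x := by
    ext k
    refine Fin.addCases (fun j => ?_) (fun j => ?_) k
    · simp
    · simp [mul_add, Finset.mul_sum, mul_assoc]

@[simp]
theorem shear_castAdd (A : Matrix (Fin n) (Fin n) ℂ) (x : Fin (n + n) → ℂ) (i : Fin n) :
    shear A x (Fin.castAdd n i) = x (Fin.castAdd n i) := by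
  simp [shear]

@[simp]
theorem shear_natAdd (A : Matrix (Fin n) (Fin n) ℂ) (x : Fin (n + n) → ℂ) (j : Fin n) :
    shear A x (Fin.natAdd n j) = x (Fin.natAdd n j) + ∑ i, x (Fin.castAdd n i) * A i j := by
  simp [shear]

theorem shear_neg_shear (A : Matrix (Fin n) (Fin n) ℂ) (x : Fin (n + n) → ℂ) :
    shear (-A) (shear A x) = x := by
  ext k
  refine Fin.addCases (fun j => ?_) (fun j => ?_) k <;> simp

/-- The automorphism `x ↦ x (1 A; 0 1)`. -/
def shearEquiv (A : Matrix (Fin n) (Fin n) ℂ) :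
    (Fin (n + n) → ℂ) ≃ₗ[ℂ] (Fin (n + n) → ℂ) :=
  LinearEquiv.ofLinearMap (shear A) (shear (-A))
    (LinearMap.ext fun x => by simpa using shear_neg_shear (-A) x)
    (LinearMap.ext fun x => by simpa using shear_neg_shear A x)

@[simp]
theorem shearEquiv_apply (A : Matrix (Fin n) (Fin n) ℂ) (x : Fin (n + n) → ℂ) :
    shearEquiv A x = shear A x := rfl

theorem Q_shear {A : Matrix (Fin n) (Fin n) ℂ} (hA : A ∈ skew n) (x y : Fin (n + n) → ℂ) :
    Q (shear A x) (shear A y) = Q x y := by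
  have h1 : ∑ j, x (Fin.castAdd n j) * ∑ i, y (Fin.castAdd n i) * A i j =
      -∑ j, (∑ i, x (Fin.castAdd n i) * A i j) * y (Fin.castAdd n j) := by
    simp only [Finset.mul_sum, Finset.sum_mul]
    rw [Finset.sum_comm, ← Finset.sum_neg_distrib]
    refine Finset.sum_congr rfl fun i _ => ?_
    rw [← Finset.sum_neg_distrib]
    refine Finset.sum_congr rfl fun j _ => ?_
    linear_combination x (Fin.castAdd n j) * y (Fin.castAdd n i) * hA j i
  simp only [Q, shear_castAdd, shear_natAdd, mul_add, add_mul, Finset.sum_add_distrib]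
  rw [h1]
  ring

theorem shear_graph_zero (A : Matrix (Fin n) (Fin n) ℂ) (i : Fin n) :
    shear A (graph 0 i) = graph A i := by
  ext k
  refine Fin.addCases (fun j => ?_) (fun j => ?_) k
  · simp
  · simp [Matrix.one_apply]

/-- The involution of the indices which exchanges `i` and `n + i` for `i ∈ R`. -/
def swapIdx (R : Finset (Fin n)) (k : Fin (n + n)) : Fin (n + n) :=
  Fin.addCases (fun i => if i ∈ R then Fin.natAdd n i else Fin.castAdd n i)
    (fun i => if i ∈ R then Fin.castAdd n i else Fin.natAdd n i) k

@[simp]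
theorem swapIdx_castAdd (R : Finset (Fin n)) (i : Fin n) :
    swapIdx R (Fin.castAdd n i) = if i ∈ R then Fin.natAdd n i else Fin.castAdd n i := by
  simp [swapIdx]

@[simp]
theorem swapIdx_natAdd (R : Finset (Fin n)) (i : Fin n) :
    swapIdx R (Fin.natAdd n i) = if i ∈ R then Fin.castAdd n i else Fin.natAdd n i := by
  simp [swapIdx]

theorem swapIdx_swapIdx (R : Finset (Fin n)) (k : Fin (n + n)) :
    swapIdx R (swapIdx R k) = k := by
  refine Fin.addCases (fun i => ?_) (fun i => ?_) k <;> by_cases h : i ∈ R <;> simp [h]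

/-- `swapIdx`, as a permutation. -/
def swapPerm (R : Finset (Fin n)) : Equiv.Perm (Fin (n + n)) :=
  ⟨swapIdx R, swapIdx R, swapIdx_swapIdx R, swapIdx_swapIdx R⟩

/-- The isometry which exchanges the coordinates `i` and `n + i` for `i ∈ R`. -/
def swapEquiv (R : Finset (Fin n)) : (Fin (n + n) → ℂ) ≃ₗ[ℂ] (Fin (n + n) → ℂ) :=
  LinearEquiv.funCongrLeft ℂ ℂ (swapPerm R)

@[simp]
theorem swapEquiv_apply (R : Finset (Fin n)) (x : Fin (n + n) → ℂ) (k : Fin (n + n)) :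
    swapEquiv R x k = x (swapIdx R k) := rfl

theorem Q_swapEquiv (R : Finset (Fin n)) (x y : Fin (n + n) → ℂ) :
    Q (swapEquiv R x) (swapEquiv R y) = Q x y := by
  refine Finset.sum_congr rfl fun i _ => ?_
  by_cases h : i ∈ R
  · simp [h]; ring
  · simp [h]

theorem extEquiv_swapEquiv_self (R : Finset (Fin n)) (x : PluckerSpace n) :
    extEquiv (swapEquiv R) (extEquiv (swapEquiv R) x) = x := by
  have : (extEquiv (swapEquiv R)).toLinearMap ∘ₗ (extEquiv (swapEquiv R)).toLinearMap =
      LinearMap.id := by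
    refine linearMap_ext_plucker fun v => ?_
    simp only [LinearMap.comp_apply, LinearEquiv.coe_coe, extEquiv_plucker, LinearMap.id_apply]
    congr 1
    ext i k
    simp [swapIdx_swapIdx]
  exact congrArg (fun f => f x) this

/-- The action of `swapPerm` on `Λ`. -/
def swapLam (R : Finset (Fin n)) (J : Lam n) : Lam n :=
  ⟨J.1.map (swapPerm R).toEmbedding, (Finset.card_map _).trans J.2⟩

theorem mem_swapLam {R : Finset (Fin n)} {J : Lam n} {k : Fin (n + n)} :
    k ∈ (swapLam R J).1 ↔ swapIdx R k ∈ J.1 := by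
  simp only [swapLam, Finset.mem_map_equiv]
  rfl

theorem exists_extEquiv_swapEquiv_apply (R : Finset (Fin n)) (J : Lam n) :
    ∃ s : ℂ, s ≠ 0 ∧ ∀ x, extEquiv (swapEquiv R) x J = s * x (swapLam R J) := by
  obtain ⟨s, hs, h⟩ := exists_det_eq_plucker (J := swapLam R J)
    (k := fun j => swapIdx R (J.1.orderEmbOfFin J.2 j))
    ((swapPerm R).injective.comp (J.1.orderEmbOfFin J.2).injective)
    (fun j => by
      rw [mem_swapLam, swapIdx_swapIdx]
      exact Finset.orderEmbOfFin_mem _ J.2 j)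
  refine ⟨s, fun h0 => by simp [h0] at hs, fun x => ?_⟩
  have : (LinearMap.proj J ∘ₗ (extEquiv (swapEquiv R)).toLinearMap : PluckerSpace n →ₗ[ℂ] ℂ) =
      s • LinearMap.proj (swapLam R J) := by
    refine linearMap_ext_plucker fun v => ?_
    simp only [LinearMap.comp_apply, LinearEquiv.coe_coe, extEquiv_plucker, LinearMap.proj_apply,
      LinearMap.smul_apply, smul_eq_mul]
    rw [← h, plucker_apply]
    rfl
  exact congrArg (fun f => f x) this

theorem swapLam_isoIndex (R S : Finset (Fin n)) :
    swapLam R (isoIndex S) = isoIndex (symmDiff S R) := by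
  refine Lam_ext ?_ ?_
  · ext i
    rw [mem_rowsIn, mem_swapLam, swapIdx_castAdd]
    by_cases hi : i ∈ R
    · rw [if_pos hi, ← mem_colsIn]
      simp [hi]
    · rw [if_neg hi, ← mem_rowsIn]
      simp [hi]
  · ext i
    rw [mem_colsIn, mem_swapLam, swapIdx_natAdd]
    by_cases hi : i ∈ R
    · rw [if_pos hi, ← mem_rowsIn]
      simp [Finset.mem_symmDiff, hi]
    · rw [if_neg hi, ← mem_colsIn]
      simp [Finset.mem_symmDiff, hi]

theorem extEquiv_swapEquiv_baseIndex_ne_zero {R : Finset (Fin n)} {x : PluckerSpace n} :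
    extEquiv (swapEquiv R) x (baseIndex n) ≠ 0 ↔ x (isoIndex R) ≠ 0 := by
  obtain ⟨s, hs, h⟩ := exists_extEquiv_swapEquiv_apply R (baseIndex n)
  rw [h, baseIndex, swapLam_isoIndex,
    show symmDiff (∅ : Finset (Fin n)) R = R from bot_symmDiff R]
  simp [hs]

/-! ### Isotropic coordinate charts cover the isotropic Grassmannian -/

theorem Q_eq_sum_flipIdx (x y : Fin (n + n) → ℂ) : Q x y = ∑ l, x l * y (flipIdx l) := by
  rw [Fin.sum_univ_add, Q, Finset.sum_add_distrib]
  simp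

theorem flipIdx_mem_isoIndex {R : Finset (Fin n)} {k : Fin (n + n)} :
    flipIdx k ∈ (isoIndex R).1 ↔ k ∉ (isoIndex R).1 := by
  conv_lhs => rw [← dual_isoIndex R, mem_dual, flipIdx_flipIdx]

theorem castAdd_mem_isoIndex {R : Finset (Fin n)} {i : Fin n} :
    Fin.castAdd n i ∈ (isoIndex R).1 ↔ i ∉ R := by
  rw [← mem_rowsIn]; simp

theorem natAdd_mem_isoIndex {R : Finset (Fin n)} {i : Fin n} :
    Fin.natAdd n i ∈ (isoIndex R).1 ↔ i ∈ R := by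
  rw [← mem_colsIn]; simp

theorem exists_isoIndex_exchange {R : Finset (Fin n)} {k : Fin (n + n)} :
    ∃ R' : Finset (Fin n), k ∈ (isoIndex R').1 ∧
      ∀ l, l ≠ k → l ≠ flipIdx k → (l ∈ (isoIndex R').1 ↔ l ∈ (isoIndex R).1) := by
  refine Fin.addCases (fun i => ?_) (fun i => ?_) k
  · refine ⟨R.erase i, by simp [castAdd_mem_isoIndex], fun l => ?_⟩
    refine Fin.addCases (fun j => ?_) (fun j => ?_) l
    · intro h1 _
      have : j ≠ i := fun h => h1 (by rw [h])
      simp [castAdd_mem_isoIndex, this]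
    · intro _ h1
      have : j ≠ i := fun h => h1 (by rw [h, flipIdx_castAdd])
      simp [natAdd_mem_isoIndex, this]
  · refine ⟨insert i R, by simp [natAdd_mem_isoIndex], fun l => ?_⟩
    refine Fin.addCases (fun j => ?_) (fun j => ?_) l
    · intro _ h1
      have : j ≠ i := fun h => h1 (by rw [h, flipIdx_natAdd])
      simp [castAdd_mem_isoIndex, this]
    · intro h1 _
      have : j ≠ i := fun h => h1 (by rw [h])
      simp [natAdd_mem_isoIndex, this]

/-- The vectors whose coordinates in `J` vanish. -/
def coordKer (J : Lam n) : Submodule ℂ (Fin (n + n) → ℂ) where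
  carrier := {u | ∀ k ∈ J.1, u k = 0}
  add_mem' := fun hx hy k hk => by simp [hx k hk, hy k hk]
  zero_mem' := fun _ _ => rfl
  smul_mem' := fun c x hx k hk => by simp [hx k hk]

theorem exists_mem_coordKer {v : Fin n → Fin (n + n) → ℂ} (hv : LinearIndependent ℂ v) {J : Lam n}
    (h : plucker v J = 0) : ∃ u ∈ Submodule.span ℂ (Set.range v) ⊓ coordKer J, u ≠ 0 := by
  rw [plucker_apply] at h
  obtain ⟨a, ha, hM⟩ := Matrix.exists_vecMul_eq_zero_iff.2 h
  refine ⟨∑ i, a i • v i, ⟨Submodule.sum_mem _ fun i _ => Submodule.smul_mem _ _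
    (Submodule.subset_span ⟨i, rfl⟩), fun k hk => ?_⟩, fun h0 => ?_⟩
  · have h2 : Set.range (J.1.orderEmbOfFin J.2) = J.1 := Finset.range_orderEmbOfFin J.1 J.2
    obtain ⟨j, rfl⟩ := h2.ge hk
    simpa [Matrix.vecMul, dotProduct] using congrFun hM j
  · exact ha (funext (Fintype.linearIndependent_iff.1 hv a h0))

/-- Choose `R` minimizing the dimension of the intersection of `W` with the vectors vanishing on
`isoIndex R`. If it contains some `u` with `u k ≠ 0`, exchanging `flipIdx k` for `k` in the index
makes it strictly smaller. -/
theorem exists_plucker_isoIndex_ne_zero {v : Fin n → Fin (n + n) → ℂ}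
    (hv : LinearIndependent ℂ v) (hQ : ∀ i j, Q (v i) (v j) = 0) :
    ∃ R : Finset (Fin n), plucker v (isoIndex R) ≠ 0 := by
  set W := Submodule.span ℂ (Set.range v) with hW
  obtain ⟨R, hR⟩ := Finite.exists_min
    fun R : Finset (Fin n) => finrank ℂ ↥(W ⊓ coordKer (isoIndex R))
  refine ⟨R, fun h => ?_⟩
  obtain ⟨u, ⟨huW, hu⟩, hu0⟩ := exists_mem_coordKer hv h
  obtain ⟨k, hk⟩ := Function.ne_iff.1 hu0
  have hkR : k ∉ (isoIndex R).1 := fun h => hk (hu k h)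
  obtain ⟨R', hkR', hR'⟩ := exists_isoIndex_exchange (R := R) (k := k)
  refine absurd (hR R') (not_le.2 (Submodule.finrank_lt_finrank_of_lt ?_))
  refine lt_of_le_of_ne ?_ fun heq => ?_
  · rintro y ⟨hyW, hy⟩
    refine ⟨hyW, fun l hl => ?_⟩
    have hlk : l ≠ k := fun h => hkR (h ▸ hl)
    by_cases hlf : l = flipIdx k
    -- In `Q u y` only the term `u k * y (flipIdx k)` survives, so isotropy of `W` forces the
    -- coordinate of `y` at the removed index to vanish.
    · have h1 : Q u y = 0 := Q_eq_zero_of_mem_span hQ huW hyW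
      rw [Q_eq_sum_flipIdx, Finset.sum_eq_single k] at h1
      · rw [hlf]
        exact (mul_eq_zero.1 h1).resolve_left hk
      · intro m _ hm
        by_cases hmR : m ∈ (isoIndex R).1
        · rw [hu m hmR, zero_mul]
        · have h2 := flipIdx_mem_isoIndex.2 hmR
          rw [hy (flipIdx m) ((hR' _ (fun h => hkR (h ▸ h2))
            fun h => hm (flipIdx_injective h)).2 h2), mul_zero]
      · simp
    · exact hy l ((hR' l hlk hlf).2 hl)
  · have : u ∈ W ⊓ coordKer (isoIndex R') := heq ▸ ⟨huW, hu⟩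
    exact hk (this.2 k hkR')

theorem exists_isoIndex_ne_zero {x : PluckerSpace n}
    (hx : x ∈ affineCone (isotropicGrassmannian n)) :
    ∃ R : Finset (Fin n), x (isoIndex R) ≠ 0 := by
  obtain ⟨h0, c, v, hv, rfl⟩ := mem_affineCone_isotropic.1 hx
  have hc : c ≠ 0 := fun h => h0 (by simp [h])
  obtain ⟨R, hR⟩ := exists_plucker_isoIndex_ne_zero
    (linearIndependent_of_plucker_ne_zero fun h => h0 (by simp [h])) hv
  exact ⟨R, by simp [hc, hR]⟩

/-! ### Connectedness -/

/-- The part of the cone over the isotropic Grassmannian where a coordinate does not vanish. -/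
def chartSet (R : Finset (Fin n)) : Set (PluckerSpace n) :=
  {x ∈ affineCone (isotropicGrassmannian n) | x (isoIndex R) ≠ 0}

theorem mem_chartSet_iff {R : Finset (Fin n)} {x : PluckerSpace n} : x ∈ chartSet R ↔
    ∃ c : ℂ, c ≠ 0 ∧ ∃ t, x = extEquiv (swapEquiv R) (c • chart (skew n) t) := by
  constructor
  · rintro ⟨hx, hR⟩
    have h1 := (extEquiv_mem_isotropic_iff (Q_swapEquiv R)).2 hx
    have h2 := extEquiv_swapEquiv_baseIndex_ne_zero.2 hR
    obtain ⟨A, hA, h⟩ := exists_graph_of_mem_isotropic h1 h2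
    obtain ⟨t, ht⟩ := exists_chart_eq hA
    refine ⟨_, h2, t, ?_⟩
    rw [ht, ← h, extEquiv_swapEquiv_self]
  · rintro ⟨c, hc, t, rfl⟩
    have h1 : chart (skew n) t (baseIndex n) = 1 := plucker_graph_baseIndex _
    refine ⟨(extEquiv_mem_isotropic_iff (Q_swapEquiv R)).2 ?_,
      extEquiv_swapEquiv_baseIndex_ne_zero.1 ?_⟩
    · obtain ⟨h0, a, v, hv, h⟩ :=
        mem_affineCone_isotropic.1 (graph_mem_affineCone_isotropic (coords (skew n) t).2)
      refine mem_affineCone_isotropic.2 ⟨smul_ne_zero hc h0, c * a, v, hv, ?_⟩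
      rw [mul_smul, ← h]
      rfl
    · rw [extEquiv_swapEquiv_self]
      simp [h1, hc]

theorem continuous_linearEquiv (Φ : PluckerSpace n ≃ₗ[ℂ] PluckerSpace n) : Continuous Φ :=
  LinearMap.continuous_of_finiteDimensional Φ.toLinearMap

theorem continuous_chart (N : Submodule ℂ (Matrix (Fin n) (Fin n) ℂ)) : Continuous (chart N) :=
  continuous_iff_continuousAt.2 fun t => (analyticAt_chart N t).continuousAt

/-- The chart is a continuous image of the product of `ℂ ∖ {0}` (the scalar) and an affine space
(the skew matrices). -/
theorem isPreconnected_chartSet (R : Finset (Fin n)) : IsPreconnected (chartSet R) := by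
  have h : chartSet R = (fun p : ℂ × (Fin (finrank ℂ (skew n)) → ℂ) =>
      extEquiv (swapEquiv R) (p.1 • chart (skew n) p.2)) '' ({0}ᶜ ×ˢ Set.univ) := by
    ext x
    rw [mem_chartSet_iff]
    constructor
    · rintro ⟨c, hc, t, rfl⟩
      exact ⟨(c, t), by simp [hc], rfl⟩
    · rintro ⟨⟨c, t⟩, hc, rfl⟩
      exact ⟨c, by simpa using hc, t, rfl⟩
  rw [h]
  refine IsPreconnected.image ?_ _ (Continuous.continuousOn ?_)
  · refine IsPreconnected.prod ?_ isPreconnected_univ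
    refine (isConnected_compl_singleton_of_one_lt_rank ?_ (0 : ℂ)).isPreconnected
    rw [Complex.rank_real_complex]
    exact_mod_cast Nat.one_lt_two
  · exact (continuous_linearEquiv _).comp
      (continuous_fst.smul ((continuous_chart _).comp continuous_snd))

/-- The matrix `E_pq - E_qp` has a nonzero principal minor on `{p, q}`. -/
theorem exists_skew_isoIndex_ne_zero {p q : Fin n} (hpq : p ≠ q) :
    ∃ A ∈ skew n, plucker (graph A) (isoIndex {p, q}) ≠ 0 := by
  classical
  refine ⟨Matrix.single p q 1 - Matrix.single q p 1, fun i j => ?_, ?_⟩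
  · simp only [Matrix.sub_apply, Matrix.single_apply]
    simp only [and_comm]
    ring
  set A : Matrix (Fin n) (Fin n) ℂ := Matrix.single p q 1 - Matrix.single q p 1 with hA
  have hR : (rowsIn (isoIndex {p, q}))ᶜ.card = 2 := by simp [Finset.card_pair hpq]
  have hC : (colsIn (isoIndex {p, q})).card = 2 := by simp [Finset.card_pair hpq]
  rw [plucker_graph A _ hR hC, Matrix.det_fin_two]
  refine mul_ne_zero (eps_ne_zero _) ?_
  have hrc : ∀ a, (rowsIn (isoIndex {p, q}))ᶜ.orderEmbOfFin hR a =
      (colsIn (isoIndex {p, q})).orderEmbOfFin hC a := by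
    intro a
    simp
  simp only [Matrix.submatrix_apply, hrc]
  have h0 := Finset.orderEmbOfFin_mem _ hC 0
  have h1 := Finset.orderEmbOfFin_mem _ hC 1
  have h01 : (colsIn (isoIndex {p, q})).orderEmbOfFin hC 0 ≠
      (colsIn (isoIndex {p, q})).orderEmbOfFin hC 1 := fun h => by
    have := (Finset.orderEmbOfFin _ hC).injective h
    simp at this
  generalize (colsIn (isoIndex {p, q})).orderEmbOfFin hC 0 = a at *
  generalize (colsIn (isoIndex {p, q})).orderEmbOfFin hC 1 = b at *
  simp only [colsIn_isoIndex, Finset.mem_insert, Finset.mem_singleton] at h0 h1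
  rcases h0 with rfl | rfl <;> rcases h1 with rfl | rfl
  · exact absurd rfl h01
  · simp [hA, hpq, hpq.symm]
  · simp [hA, hpq, hpq.symm]
  · exact absurd rfl h01

theorem symmDiff_insert_insert {R : Finset (Fin n)} {p q : Fin n} (hp : p ∉ R) (hq : q ∉ R) :
    symmDiff R (insert p (insert q R)) = {p, q} := by
  ext i
  simp only [Finset.mem_symmDiff, Finset.mem_insert, Finset.mem_singleton]
  by_cases h1 : i = p
  · subst h1; simp [hp]
  · by_cases h2 : i = q
    · subst h2; simp [hq]
    · simp [h1, h2]

/-- Two charts which differ by an exchange of two indices meet. -/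
theorem exists_chart_apply_ne_zero {R : Finset (Fin n)} {p q : Fin n} (hp : p ∉ R) (hq : q ∉ R)
    (hpq : p ≠ q) : ∃ t, extEquiv (swapEquiv (insert p (insert q R))) (chart (skew n) t)
      (isoIndex R) ≠ 0 := by
  obtain ⟨A, hA, h⟩ := exists_skew_isoIndex_ne_zero hpq
  obtain ⟨t, ht⟩ := exists_chart_eq hA
  refine ⟨t, ?_⟩
  obtain ⟨s, hs, hx⟩ := exists_extEquiv_swapEquiv_apply (insert p (insert q R)) (isoIndex R)
  rw [hx, swapLam_isoIndex, symmDiff_insert_insert hp hq, ht]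
  exact mul_ne_zero hs h

theorem even_card_induction {α : Type*} [DecidableEq α] {P : Finset α → Prop} (h0 : P ∅)
    (hs : ∀ R p q, p ∉ R → q ∉ R → p ≠ q → P R → P (insert p (insert q R)))
    (R : Finset α) (hR : Even R.card) : P R := by
  induction hk : R.card using Nat.strong_induction_on generalizing R with
  | _ k ih =>
    rcases R.eq_empty_or_nonempty with rfl | ⟨p, hp⟩
    · exact h0
    have h1 : (R.erase p).card + 1 = R.card := Finset.card_erase_add_one hp
    have hne : (R.erase p).Nonempty := by
      rw [← Finset.card_pos]
      rcases hR with ⟨m, hm⟩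
      omega
    obtain ⟨q, hq⟩ := hne
    have h2 : ((R.erase p).erase q).card + 1 = (R.erase p).card := Finset.card_erase_add_one hq
    have h3 := hs ((R.erase p).erase q) p q (by simp) (by simp) (Finset.ne_of_mem_erase hq).symm
      (ih _ (by omega) _ (by
        rcases hR with ⟨m, hm⟩
        exact ⟨m - 1, by omega⟩) rfl)
    rwa [Finset.insert_erase hq, Finset.insert_erase hp] at h3

variable (n) in
/-- The component of the cone containing `e_{I₀}`. -/
def baseComponent : Set (PluckerSpace n) :=
  connectedComponentIn (affineCone (isotropicGrassmannian n)) (e (baseIndex n))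

theorem e_baseIndex_mem : e (baseIndex n) ∈ affineCone (isotropicGrassmannian n) := by
  rw [← plucker_graph_zero]
  exact graph_mem_affineCone_isotropic (Submodule.zero_mem _)

/-- Each chart is connected, and adding two indices to `R` gives a chart meeting the previous one.
-/
theorem chartSet_subset_baseComponent {R : Finset (Fin n)} (hR : Even R.card) :
    chartSet R ⊆ baseComponent n := by
  refine even_card_induction (P := fun R => chartSet R ⊆ baseComponent n) ?_ ?_ R hR
  · refine (isPreconnected_chartSet ∅).subset_connectedComponentIn ⟨e_baseIndex_mem, ?_⟩
      fun x hx => hx.1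
    change e (baseIndex n) (baseIndex n) ≠ 0
    simp [e]
  · intro R p q hp hq hpq ih
    obtain ⟨t, ht⟩ := exists_chart_apply_ne_zero hp hq hpq
    set y := extEquiv (swapEquiv (insert p (insert q R))) (chart (skew n) t) with hy
    have hy1 : y ∈ chartSet (insert p (insert q R)) :=
      mem_chartSet_iff.2 ⟨1, one_ne_zero, t, by rw [one_smul]⟩
    have hy2 : y ∈ chartSet R := ⟨hy1.1, ht⟩
    have h1 := (isPreconnected_chartSet (insert p (insert q R))).subset_connectedComponentIn hy1
      (F := affineCone (isotropicGrassmannian n)) fun x hx => hx.1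
    rwa [← connectedComponentIn_eq (ih hy2)] at h1

/-- At a self-dual index the eigenspace equation relates a coordinate to itself, so a nonzero value
determines the eigenvalue by the parity of `R`. -/
theorem apply_isoIndex_of_mem_eigen {c : ℂ} {x : PluckerSpace n} (hx : x ∈ eigen n c)
    {R : Finset (Fin n)} (h : x (isoIndex R) ≠ 0) : c * (-1) ^ R.card = 1 := by
  have h1 := hx (isoIndex R)
  rw [dual_isoIndex, deg_isoIndex] at h1
  have h2 : eps (isoIndex R) * x (isoIndex R) ≠ 0 := mul_ne_zero (eps_ne_zero _) h
  apply mul_right_cancel₀ h2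
  linear_combination -h1

/-- The two eigenspaces are closed and meet only in `0`, which is not in the cone, so the component
stays in one of them. Conversely a point of `eigen n 1` lies in a chart with `R` even. -/
theorem baseComponent_eq :
    baseComponent n = affineCone (isotropicGrassmannian n) ∩ eigen n 1 := by
  apply Set.Subset.antisymm
  · intro x hx
    have hsub : baseComponent n ⊆ affineCone (isotropicGrassmannian n) :=
      connectedComponentIn_subset _ _
    refine ⟨hsub hx, ?_⟩
    by_contra hx1
    have hcl : ∀ c, IsClosed (eigen n c : Set (PluckerSpace n)) := fun c =>
      Submodule.closed_of_finiteDimensional _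
    have he1 : e (baseIndex n) ∈ eigen n 1 := by
      refine (mem_eigen_of_mem_affineCone e_baseIndex_mem).resolve_right fun h => ?_
      have h2 := apply_isoIndex_of_mem_eigen h (R := ∅) (by
        change e (baseIndex n) (baseIndex n) ≠ 0
        simp [e])
      norm_num at h2
    obtain ⟨z, hz, hz1, hz2⟩ := isPreconnected_closed_iff.1
      (isPreconnected_connectedComponentIn (x := e (baseIndex n))
        (F := affineCone (isotropicGrassmannian n))) _ _ (hcl 1) (hcl (-1))
      (fun y hy => mem_eigen_of_mem_affineCone (hsub hy))
      ⟨_, mem_connectedComponentIn e_baseIndex_mem, he1⟩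
      ⟨x, hx, (mem_eigen_of_mem_affineCone (hsub hx)).resolve_left hx1⟩
    exact (hsub hz).1 (eq_zero_of_mem_eigen hz1 hz2)
  · rintro x ⟨hx, hx1⟩
    obtain ⟨R, hR⟩ := exists_isoIndex_ne_zero hx
    refine chartSet_subset_baseComponent (R := R) ?_ ⟨hx, hR⟩
    have h1 := apply_isoIndex_of_mem_eigen hx1 hR
    rw [one_mul] at h1
    by_contra hodd
    rw [(Nat.not_even_iff_odd.1 hodd).neg_one_pow] at h1
    norm_num at h1

/-! ### Linear spans of charts -/

theorem chart_mem_chartSet (t : Fin (finrank ℂ (skew n)) → ℂ) :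
    chart (skew n) t ∈ chartSet (∅ : Finset (Fin n)) := by
  refine ⟨graph_mem_affineCone_isotropic (coords (skew n) t).2, ?_⟩
  change chart (skew n) t (baseIndex n) ≠ 0
  rw [chart, plucker_graph_baseIndex]
  exact one_ne_zero

theorem eq_zero_of_eventually_eq_zero {E : Type*} [NormedAddCommGroup E] [NormedSpace ℂ E]
    {f : E → ℂ} (hf : ∀ x, AnalyticAt ℂ f x) {x₀ : E} (h : ∀ᶠ x in 𝓝 x₀, f x = 0) (x : E) :
    f x = 0 := by
  have h1 : AnalyticOnNhd ℂ f Set.univ := fun y _ => hf y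
  exact h1.eqOn_zero_of_preconnected_of_eventuallyEq_zero isPreconnected_univ
    (Set.mem_univ x₀) h (Set.mem_univ x)

theorem chartSet_subset_span {R : Finset (Fin n)} (hR : Even R.card) :
    chartSet R ⊆ Submodule.span ℂ (Set.range (chart (skew n))) := by
  refine even_card_induction (P := fun R =>
    chartSet R ⊆ Submodule.span ℂ (Set.range (chart (skew n)))) ?_ ?_ R hR
  · rintro x ⟨hx, hx0⟩
    obtain ⟨A, hA, h⟩ := exists_graph_of_mem_isotropic hx hx0
    obtain ⟨t, ht⟩ := exists_chart_eq hA
    rw [h, ← ht]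
    exact Submodule.smul_mem _ _ (Submodule.subset_span ⟨t, rfl⟩)
  · intro R p q hp hq hpq ih
    obtain ⟨t₀, ht₀⟩ := exists_chart_apply_ne_zero hp hq hpq
    set R' := insert p (insert q R) with hR'
    have key : Submodule.span ℂ (Set.range fun t => extEquiv (swapEquiv R') (chart (skew n) t)) ≤
        Submodule.span ℂ (Set.range (chart (skew n))) := by
      refine le_of_forall_ker fun l hl => Submodule.span_le.2 ?_
      rintro _ ⟨t, rfl⟩
      -- A linear form killing the span vanishes on the overlap of the two charts, a nonempty open
      -- part of the new one, hence on all of it by the identity theorem.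
      refine eq_zero_of_eventually_eq_zero
        (f := fun t => l (extEquiv (swapEquiv R') (chart (skew n) t))) (x₀ := t₀) ?_ ?_ t
      · intro t
        exact (analyticAt_linearMap (l.toLinearMap ∘ₗ (extEquiv (swapEquiv R')).toLinearMap) _).comp
          (analyticAt_chart _ t)
      · have hcont : Continuous fun t => extEquiv (swapEquiv R') (chart (skew n) t) (isoIndex R) :=
          (continuous_apply _).comp ((continuous_linearEquiv _).comp (continuous_chart _))
        filter_upwards [hcont.continuousAt.eventually_ne ht₀] with t ht
        have h1 : extEquiv (swapEquiv R') (chart (skew n) t) ∈ chartSet R' :=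
          mem_chartSet_iff.2 ⟨1, one_ne_zero, t, by rw [one_smul]⟩
        exact hl (ih ⟨h1.1, ht⟩)
    intro x hx
    obtain ⟨c, -, t, rfl⟩ := mem_chartSet_iff.1 hx
    rw [map_smul]
    exact Submodule.smul_mem _ _ (key (Submodule.subset_span ⟨t, rfl⟩))

theorem span_chart_skew : Submodule.span ℂ (Set.range (chart (skew n))) = eigen n 1 := by
  apply le_antisymm
  · refine Submodule.span_le.2 ?_
    rintro _ ⟨t, rfl⟩
    have := chartSet_subset_baseComponent (by simp) (chart_mem_chartSet t)
    rw [baseComponent_eq] at this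
    exact this.2
  · rw [← span_affineCone_inf_eigen (Or.inl rfl)]
    refine Submodule.span_le.2 ?_
    rintro x ⟨hx, hx1⟩
    obtain ⟨R, hR⟩ := exists_isoIndex_ne_zero hx
    refine chartSet_subset_span (R := R) ?_ ⟨hx, hR⟩
    have h1 := apply_isoIndex_of_mem_eigen hx1 hR
    rw [one_mul] at h1
    by_contra hodd
    rw [(Nat.not_even_iff_odd.1 hodd).neg_one_pow] at h1
    norm_num at h1

/-- The graphs contain, up to scalars, the Plücker vectors of all `v` near `graph 0`; a linear form
vanishing on them vanishes identically by analyticity in `v`. -/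
theorem span_chart_top :
    Submodule.span ℂ (Set.range (chart (⊤ : Submodule ℂ (Matrix (Fin n) (Fin n) ℂ)))) = ⊤ := by
  rw [eq_top_iff, ← span_range_plucker]
  refine le_of_forall_ker fun l hl => Submodule.span_le.2 ?_
  rintro _ ⟨v, rfl⟩
  have han : ∀ v : Fin n → Fin (n + n) → ℂ, AnalyticAt ℂ (fun v => plucker (n := n) v) v := by
    refine fun v => analyticAt_plucker fun i k => ?_
    exact analyticAt_linearMap (LinearMap.proj (R := ℂ) (φ := fun _ : Fin (n + n) => ℂ) k ∘ₗ
      LinearMap.proj (R := ℂ) (φ := fun _ : Fin n => Fin (n + n) → ℂ) i) v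
  refine eq_zero_of_eventually_eq_zero (f := fun v => l (plucker v)) (x₀ := graph 0) ?_ ?_ v
  · exact fun v => (l.analyticAt _).comp (han v)
  · have hcont : ContinuousAt (fun v => plucker (n := n) v (baseIndex n)) (graph 0) :=
      (continuous_apply _).continuousAt.comp (han _).continuousAt
    filter_upwards [hcont.eventually_ne (by rw [plucker_graph_baseIndex]; exact one_ne_zero)]
      with w hw
    obtain ⟨A, hA, -⟩ := exists_graph_of_ne_zero hw
    obtain ⟨t, ht⟩ := exists_chart_eq (N := ⊤) (A := A) trivial
    refine hl ?_
    rw [hA, ← ht]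
    exact Submodule.smul_mem _ _ (Submodule.subset_span ⟨t, rfl⟩)

/-! ### Transitivity -/

theorem smul_mem_grassmannian_iff {c : ℂ} (hc : c ≠ 0) {x : PluckerSpace n} :
    c • x ∈ affineCone (grassmannian n) ↔ x ∈ affineCone (grassmannian n) := by
  simp only [mem_affineCone_grassmannian, ne_eq, smul_eq_zero, hc, false_or]
  refine and_congr_right fun _ => ⟨?_, ?_⟩
  · rintro ⟨a, v, h⟩
    exact ⟨c⁻¹ * a, v, by rw [mul_smul, ← h, inv_smul_smul₀ hc]⟩
  · rintro ⟨a, v, rfl⟩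
    exact ⟨c * a, v, by rw [mul_smul]⟩

theorem smul_mem_isotropic_iff {c : ℂ} (hc : c ≠ 0) {x : PluckerSpace n} :
    c • x ∈ affineCone (isotropicGrassmannian n) ↔ x ∈ affineCone (isotropicGrassmannian n) := by
  simp only [mem_affineCone_isotropic, ne_eq, smul_eq_zero, hc, false_or]
  refine and_congr_right fun _ => ⟨?_, ?_⟩
  · rintro ⟨a, v, hv, h⟩
    exact ⟨c⁻¹ * a, v, hv, by rw [mul_smul, ← h, inv_smul_smul₀ hc]⟩
  · rintro ⟨a, v, hv, rfl⟩
    exact ⟨c * a, v, hv, by rw [mul_smul]⟩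

/-- A linear automorphism of `⋀ⁿ V` which preserves both Grassmannians. -/
structure Preserves (Φ : PluckerSpace n ≃L[ℂ] PluckerSpace n) : Prop where
  grassmannian : ∀ x, Φ x ∈ affineCone (grassmannian n) ↔ x ∈ affineCone (grassmannian n)
  isotropic : ∀ x, Φ x ∈ affineCone (isotropicGrassmannian n) ↔
    x ∈ affineCone (isotropicGrassmannian n)

theorem Preserves.trans {Φ Ψ : PluckerSpace n ≃L[ℂ] PluckerSpace n} (hΦ : Preserves Φ)
    (hΨ : Preserves Ψ) : Preserves (Φ.trans Ψ) :=
  ⟨fun x => (hΨ.1 _).trans (hΦ.1 x), fun x => (hΨ.2 _).trans (hΦ.2 x)⟩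

theorem preserves_extEquiv {g : (Fin (n + n) → ℂ) ≃ₗ[ℂ] (Fin (n + n) → ℂ)}
    (hg : ∀ x y, Q (g x) (g y) = Q x y) : Preserves (extEquiv g).toContinuousLinearEquiv :=
  ⟨fun _ => extEquiv_mem_grassmannian_iff g, fun _ => extEquiv_mem_isotropic_iff hg⟩

theorem preserves_smul {c : ℂ} (hc : c ≠ 0) : Preserves
    (LinearEquiv.smulOfNeZero ℂ (PluckerSpace n) c hc).toContinuousLinearEquiv :=
  ⟨fun _ => smul_mem_grassmannian_iff hc, fun _ => smul_mem_isotropic_iff hc⟩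

/-- A shear by a skew matrix moves `e_{I₀}` to any point of the central chart; scalars and
coordinate swaps reach the other points. -/
theorem exists_preserves_of_mem {y : PluckerSpace n}
    (hy : y ∈ affineCone (isotropicGrassmannian n)) :
    ∃ Φ : PluckerSpace n ≃L[ℂ] PluckerSpace n, Preserves Φ ∧ Φ (e (baseIndex n)) = y := by
  obtain ⟨R, hR⟩ := exists_isoIndex_ne_zero hy
  obtain ⟨c, hc, t, rfl⟩ := mem_chartSet_iff.1 (⟨hy, hR⟩ : y ∈ chartSet R)
  obtain ⟨Φ, hΦ, hΦe⟩ : ∃ Φ : PluckerSpace n ≃L[ℂ] PluckerSpace n, Preserves Φ ∧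
      Φ (e (baseIndex n)) = chart (skew n) t := by
    refine ⟨(extEquiv (shearEquiv (coords (skew n) t).1)).toContinuousLinearEquiv,
      preserves_extEquiv fun x y => ?_, ?_⟩
    · rw [shearEquiv_apply, shearEquiv_apply, Q_shear (coords (skew n) t).2]
    · rw [← plucker_graph_zero, LinearEquiv.coe_toContinuousLinearEquiv', extEquiv_plucker]
      simp only [shearEquiv_apply, shear_graph_zero]
      rfl
  refine ⟨_, (hΦ.trans (preserves_smul hc)).trans (preserves_extEquiv (Q_swapEquiv R)), ?_⟩
  rw [ContinuousLinearEquiv.trans_apply, ContinuousLinearEquiv.trans_apply, hΦe]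
  rfl

/-! ### The star operator -/

variable (n) in
/-- The star operator of `⋀ⁿ V`. -/
def star : PluckerSpace n →ₗ[ℂ] PluckerSpace n where
  toFun x K := (-1) ^ deg K * eps K * eps (dual K) * x (dual K)
  map_add' x y := by ext K; simp [mul_add]
  map_smul' a x := by ext K; simp; ring

theorem star_apply (x : PluckerSpace n) (K : Lam n) :
    star n x K = (-1) ^ deg K * eps K * eps (dual K) * x (dual K) := rfl

theorem star_e (J : Lam n) :
    star n (e J) = ((-1) ^ deg J * eps J * eps (dual J)) • e (dual J) := by
  ext K
  rw [star_apply, Pi.smul_apply, e, e, Pi.single_apply, Pi.single_apply, smul_eq_mul]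
  by_cases h : K = dual J
  · subst h
    simp
    ring
  · rw [if_neg h, if_neg fun h' => h (by rw [← h', dual_dual])]
    simp

theorem neg_one_pow_mul_self (k : ℕ) : ((-1 : ℂ) ^ k) * (-1) ^ k = 1 := by
  rw [← mul_pow]; simp

theorem mem_eigen_iff_star {c : ℂ} {x : PluckerSpace n} : x ∈ eigen n c ↔ x = c • star n x := by
  rw [mem_eigen, funext_iff]
  refine forall_congr' fun J => ?_
  rw [Pi.smul_apply, star_apply, smul_eq_mul]
  have h := eps_mul_self J
  constructor
  · intro h1
    linear_combination eps J * h1 - x J * h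
  · intro h1
    linear_combination eps J * h1 +
      (c * (-1) ^ deg J * eps (dual J) * x (dual J)) * h

theorem star_star (x : PluckerSpace n) : star n (star n x) = x := by
  ext K
  simp only [star_apply, dual_dual, deg_dual]
  linear_combination ((-1) ^ deg K * (-1) ^ deg K * x K * eps (dual K) * eps (dual K)) *
    eps_mul_self K + ((-1) ^ deg K * (-1) ^ deg K * x K) * eps_mul_self (dual K) +
    x K * neg_one_pow_mul_self (deg K)

theorem add_smul_star_mem_eigen {c : ℂ} (hc : c * c = 1) (x : PluckerSpace n) :
    x + c • star n x ∈ eigen n c := by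
  rw [mem_eigen_iff_star, map_add, map_smul, star_star, smul_add, smul_smul, hc, one_smul,
    add_comm]

theorem eq_half_smul_of_mem_eigen {c : ℂ} {x : PluckerSpace n} (h : x ∈ eigen n c) :
    x = (1 / 2 : ℂ) • (x + c • star n x) := by
  rw [← mem_eigen_iff_star.1 h, ← two_smul ℂ x, smul_smul]
  norm_num

theorem degProj_mem_eigen {c : ℂ} (k : ℕ) {x : PluckerSpace n} (hx : x ∈ eigen n c) :
    degProj deg k x ∈ eigen n c := by
  intro J
  rw [degProj_apply, degProj_apply, deg_dual]
  split_ifs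
  · exact hx J
  · simp

/-! ### Osculating spaces at the base point -/

theorem contDiff_chart (N : Submodule ℂ (Matrix (Fin n) (Fin n) ℂ)) : ContDiff ℂ ⊤ (chart N) :=
  contDiff_iff_contDiffAt.2 fun t => (analyticAt_chart N t).contDiffAt

theorem chart_smul (N : Submodule ℂ (Matrix (Fin n) (Fin n) ℂ)) (a : ℂ)
    (t : Fin (finrank ℂ N) → ℂ) (J : Lam n) : chart N (a • t) J = a ^ deg J * chart N t J := by
  rw [chart, map_smul, Submodule.coe_smul, plucker_graph_smul]
  rfl

theorem derivativeSpan_chart_skew (s : ℕ) :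
    derivativeSpan (chart (skew n)) s = degLE deg s ⊓ eigen n 1 :=
  derivativeSpan_eq_inf_degLE (contDiff_chart _) (chart_smul _) span_chart_skew
    (fun k _ hx => degProj_mem_eigen k hx) s

theorem derivativeSpan_chart_top (s : ℕ) :
    derivativeSpan (chart (⊤ : Submodule ℂ (Matrix (Fin n) (Fin n) ℂ))) s = degLE deg s := by
  rw [derivativeSpan_eq_inf_degLE (contDiff_chart _) (chart_smul _) span_chart_top
    (fun _ _ _ => trivial) s, inf_top_eq]

/-! ### Spinor varieties -/

theorem rep_mem_affineCone {E : Type*} [NormedAddCommGroup E] [NormedSpace ℂ E]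
    {X : Set (ℙ ℂ E)} {p : ℙ ℂ E} : p.rep ∈ affineCone X ↔ p ∈ X := by
  constructor
  · rintro ⟨h, hp⟩
    rwa [Projectivization.mk_rep] at hp
  · exact fun hp => ⟨p.rep_nonzero, by rwa [Projectivization.mk_rep]⟩

section Spinor

variable {S : Set (ℙ ℂ (PluckerSpace n))}

theorem IsSpinorVariety.affineCone_subset (hS : IsSpinorVariety S) :
    affineCone S ⊆ affineCone (isotropicGrassmannian n) := by
  obtain ⟨x, -, h⟩ := hS
  rw [h]
  exact connectedComponentIn_subset _ _

/-- A homeomorphism preserving the isotropic cone permutes its components, so `Φ` carries the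
component of `e_{I₀}` onto the cone over `S`. -/
theorem IsSpinorVariety.mem_affineCone_iff (hS : IsSpinorVariety S)
    {Φ : PluckerSpace n ≃L[ℂ] PluckerSpace n} (hΦ : Preserves Φ)
    (he : Φ (e (baseIndex n)) ∈ affineCone S) (x : PluckerSpace n) :
    Φ x ∈ affineCone S ↔ x ∈ baseComponent n := by
  obtain ⟨y, -, h⟩ := hS
  have h1 : Φ.toHomeomorph '' affineCone (isotropicGrassmannian n) =
      affineCone (isotropicGrassmannian n) := by
    ext z
    constructor
    · rintro ⟨w, hw, rfl⟩
      exact (hΦ.isotropic w).2 hw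
    · intro hz
      refine ⟨Φ.symm z, ?_, Φ.apply_symm_apply z⟩
      rw [← hΦ.isotropic, Φ.apply_symm_apply]
      exact hz
  have h2 := Φ.toHomeomorph.image_connectedComponentIn (e_baseIndex_mem (n := n))
  rw [h1] at h2
  rw [h] at he
  have h3 : affineCone S = Φ.toHomeomorph '' baseComponent n := by
    rw [h, connectedComponentIn_eq he, baseComponent, h2]
    rfl
  rw [h3]
  exact Φ.injective.mem_set_image

theorem IsSpinorVariety.linearSpan_eq (hS : IsSpinorVariety S)
    {Φ : PluckerSpace n ≃L[ℂ] PluckerSpace n} (hΦ : Preserves Φ)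
    (he : Φ (e (baseIndex n)) ∈ affineCone S) :
    linearSpan S = (eigen n 1).map Φ.toLinearEquiv.toLinearMap := by
  have h : affineCone S = Φ.toLinearEquiv.toLinearMap '' baseComponent n := by
    ext z
    constructor
    · intro hz
      refine ⟨Φ.symm z, ?_, Φ.apply_symm_apply z⟩
      rw [← hS.mem_affineCone_iff hΦ he, Φ.apply_symm_apply]
      exact hz
    · rintro ⟨w, hw, rfl⟩
      exact (hS.mem_affineCone_iff hΦ he w).2 hw
  rw [linearSpan, h, ← Submodule.map_span, baseComponent_eq,
    span_affineCone_inf_eigen (Or.inl rfl)]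

theorem IsSpinorVariety.isOsculatingSpace (hS : IsSpinorVariety S)
    {Φ : PluckerSpace n ≃L[ℂ] PluckerSpace n} (hΦ : Preserves Φ)
    (he : Φ (e (baseIndex n)) ∈ affineCone S) (h0 : Φ (e (baseIndex n)) ≠ 0) (s : ℕ) :
    IsOsculatingSpace S (Projectivization.mk ℂ _ h0) s
      ((degLE deg s ⊓ eigen n 1).map Φ.toLinearEquiv.toLinearMap) := by
  set X : Set (ℙ ℂ (PluckerSpace n)) :=
    Projectivization.map Φ.toLinearEquiv.toLinearMap Φ.injective ⁻¹' S with hX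
  have hcone : ∀ x, Φ x ∈ affineCone S ↔ x ∈ affineCone X := by
    intro x
    constructor
    · rintro ⟨h, hx⟩
      have hx0 : x ≠ 0 := fun h' => h (by rw [h', map_zero])
      exact ⟨hx0, hx⟩
    · rintro ⟨h, hx⟩
      exact ⟨by simpa using h, hx⟩
  have hcone' : ∀ x, x ∈ affineCone X ↔ x ∈ baseComponent n := fun x =>
    (hcone x).symm.trans (hS.mem_affineCone_iff hΦ he x)
  obtain ⟨l, m, hlm⟩ := exists_isAffineChart (N := skew n) (X := X)
    (fun A hA => by
      rw [hcone']
      obtain ⟨t, ht⟩ := exists_chart_eq hA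
      rw [← ht]
      exact chartSet_subset_baseComponent (by simp) (chart_mem_chartSet t))
    (fun x hx h => exists_graph_of_mem_isotropic
      (connectedComponentIn_subset _ _ ((hcone' x).1 hx)) h)
  have h1 := (hlm.map Φ hcone).isOsculatingSpace s
  rw [derivativeSpan_map, derivativeSpan_chart_skew] at h1
  convert h1 using 2
  rw [Function.comp_apply, chart_zero]

theorem isOsculatingSpace_grassmannian {Φ : PluckerSpace n ≃L[ℂ] PluckerSpace n}
    (hΦ : Preserves Φ) (h0 : Φ (e (baseIndex n)) ≠ 0) (s : ℕ) :
    IsOsculatingSpace (grassmannian n) (Projectivization.mk ℂ _ h0) s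
      ((degLE deg s).map Φ.toLinearEquiv.toLinearMap) := by
  obtain ⟨l, m, hlm⟩ := exists_isAffineChart (N := ⊤) (X := grassmannian n)
    (fun A _ => graph_mem_affineCone_grassmannian A)
    (fun x hx h => by
      obtain ⟨A, hA⟩ := exists_graph_of_mem_grassmannian hx h
      exact ⟨A, trivial, hA⟩)
  have h1 := (hlm.map Φ hΦ.grassmannian).isOsculatingSpace s
  rw [derivativeSpan_map, derivativeSpan_chart_top] at h1
  convert h1 using 2
  rw [Function.comp_apply, chart_zero]

theorem IsOsculatingSpace.unique {E : Type*} [NormedAddCommGroup E] [NormedSpace ℂ E]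
    {X : Set (ℙ ℂ E)} {p : ℙ ℂ E} {s : ℕ} {T T' : Submodule ℂ E} (h : IsOsculatingSpace X p s T)
    (h' : IsOsculatingSpace X p s T') : T = T' := by
  obtain ⟨d, φ, hφ⟩ := h.1
  rw [h.2 d φ hφ, h'.2 d φ hφ]

/-- The only degree that can exceed `2 * (n / 2)` is `n` with `n` odd. Its single index is
self-dual, and the coordinate there vanishes on `eigen n 1`. -/
theorem degLE_inf_eigen_eq {s : ℕ} (hs : 2 * (n / 2) ≤ s) :
    degLE deg s ⊓ eigen n 1 = eigen n 1 := by
  refine inf_eq_right.2 fun x hx J hJ => ?_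
  by_contra hne
  have hle : deg J ≤ n := by
    rw [deg_eq_card_colsIn]
    exact (Finset.card_le_univ _).trans (by simp)
  have hcols : colsIn J = Finset.univ := by
    rw [← Finset.card_eq_iff_eq_univ, ← deg_eq_card_colsIn, Fintype.card_fin]
    omega
  have hrows : rowsIn J = ∅ := by
    have := card_rowsIn_add_card_colsIn J
    rw [← Finset.card_eq_zero]
    rw [hcols, Finset.card_univ, Fintype.card_fin] at this
    omega
  have hJ' : J = isoIndex Finset.univ := Lam_ext (by simp [hrows]) (by simp [hcols])
  rw [hJ'] at hne
  have h1 := apply_isoIndex_of_mem_eigen hx hne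
  rw [Finset.card_univ, Fintype.card_fin, one_mul] at h1
  have heven : Even n := by
    by_contra hodd
    rw [(Nat.not_even_iff_odd.1 hodd).neg_one_pow] at h1
    norm_num at h1
  obtain ⟨m, rfl⟩ := heven
  omega

/-! ### Coordinate points -/

theorem neg_one_pow_card_symmDiff (R S : Finset (Fin n)) :
    (-1 : ℂ) ^ (symmDiff R S).card = (-1) ^ R.card * (-1) ^ S.card := by
  have h1 : (symmDiff R S).card = (R \ S).card + (S \ R).card := by
    rw [symmDiff_def]
    exact Finset.card_union_of_disjoint disjoint_sdiff_sdiff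
  have h2 := Finset.card_sdiff_add_card_inter R S
  have h3 := Finset.card_sdiff_add_card_inter S R
  rw [Finset.inter_comm] at h3
  rw [h1, ← h2, ← h3, pow_add, pow_add, pow_add]
  linear_combination -((-1) ^ (R \ S).card * (-1) ^ (S \ R).card) *
    neg_one_pow_mul_self (R ∩ S).card

theorem dist_isoIndex (R : Finset (Fin n)) (J : Lam n) :
    dist (isoIndex R).1 J.1 = deg (swapLam R J) := by
  have h : (baseIndex n).1 = (swapLam R (isoIndex R)).1 := by
    rw [swapLam_isoIndex, symmDiff_self]
    rfl
  rw [deg, dist, dist, ← baseIndex_val, h]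
  simp only [swapLam]
  rw [← Finset.map_inter, Finset.card_map, Finset.card_map]

theorem swapLam_dual (R : Finset (Fin n)) (J : Lam n) :
    swapLam R (dual J) = dual (swapLam R J) := by
  apply Subtype.ext
  ext k
  rw [mem_swapLam, mem_dual, mem_dual, mem_swapLam]
  refine not_congr ?_
  refine Fin.addCases (fun i => ?_) (fun i => ?_) k <;> by_cases h : i ∈ R <;> simp [h]

theorem swapLam_swapLam (R : Finset (Fin n)) (J : Lam n) : swapLam R (swapLam R J) = J := by
  apply Subtype.ext
  ext k
  rw [mem_swapLam, mem_swapLam, swapIdx_swapIdx]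

/-- Membership in an eigenspace is read off from the parity of an isotropic index with nonzero
coordinate, and swapping by `R` shifts this parity by that of `R`. -/
theorem extEquiv_swapEquiv_mem_baseComponent {R : Finset (Fin n)} {z : PluckerSpace n} :
    extEquiv (swapEquiv R) z ∈ baseComponent n ↔
      z ∈ affineCone (isotropicGrassmannian n) ∩ eigen n ((-1) ^ R.card) := by
  have hC := extEquiv_mem_isotropic_iff (Q_swapEquiv R) (x := z)
  by_cases hz : z ∈ affineCone (isotropicGrassmannian n)
  swap
  · rw [baseComponent_eq]
    exact ⟨fun h => absurd (hC.1 h.1) hz, fun h => absurd h.1 hz⟩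
  obtain ⟨R', hR'⟩ := exists_isoIndex_ne_zero hz
  obtain ⟨s, hs, hsx⟩ := exists_extEquiv_swapEquiv_apply R (isoIndex (symmDiff R' R))
  have hne : extEquiv (swapEquiv R) z (isoIndex (symmDiff R' R)) ≠ 0 := by
    rw [hsx, swapLam_isoIndex, symmDiff_symmDiff_cancel_right]
    exact mul_ne_zero hs hR'
  constructor
  · intro h
    rw [baseComponent_eq] at h
    have h1 := apply_isoIndex_of_mem_eigen h.2 hne
    rw [neg_one_pow_card_symmDiff, one_mul] at h1
    refine ⟨hz, ?_⟩
    rcases mem_eigen_of_mem_affineCone hz with h2 | h2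
    · have h3 := apply_isoIndex_of_mem_eigen h2 hR'
      rw [show ((-1 : ℂ) ^ R.card) = 1 by
        linear_combination h1 - (-1) ^ R.card * h3]
      exact h2
    · have h3 := apply_isoIndex_of_mem_eigen h2 hR'
      rw [show ((-1 : ℂ) ^ R.card) = -1 by
        linear_combination -h1 - (-1) ^ R.card * h3]
      exact h2
  · rintro ⟨-, h⟩
    refine chartSet_subset_baseComponent (R := symmDiff R' R) ?_ ⟨hC.2 hz, hne⟩
    have h1 := apply_isoIndex_of_mem_eigen h hR'
    by_contra hodd
    have h2 := neg_one_pow_card_symmDiff R' R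
    rw [(Nat.not_even_iff_odd.1 hodd).neg_one_pow, mul_comm, h1] at h2
    norm_num at h2

theorem exists_swapEquiv_e_baseIndex (R : Finset (Fin n)) :
    ∃ a : ℂ, a ≠ 0 ∧ extEquiv (swapEquiv R) (e (baseIndex n)) = a • e (isoIndex R) := by
  obtain ⟨s, hs, h⟩ := exists_extEquiv_swapEquiv_apply R (isoIndex R)
  refine ⟨s, hs, ?_⟩
  ext J
  by_cases hJ : J = isoIndex R
  · subst hJ
    rw [h, swapLam_isoIndex, symmDiff_self, Pi.smul_apply]
    simp [e, baseIndex]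
  · obtain ⟨s', -, h'⟩ := exists_extEquiv_swapEquiv_apply R J
    have hne : swapLam R J ≠ baseIndex n := fun h => hJ (by
      rw [← swapLam_swapLam R J, h, baseIndex, swapLam_isoIndex,
        show symmDiff (∅ : Finset (Fin n)) R = R from bot_symmDiff R])
    rw [h', Pi.smul_apply, e, e, Pi.single_eq_of_ne hne, Pi.single_eq_of_ne hJ]
    simp

theorem map_swapEquiv_eigen (R : Finset (Fin n)) :
    (eigen n 1).map (extEquiv (swapEquiv R)).toLinearMap = eigen n ((-1) ^ R.card) := by
  rw [← span_affineCone_inf_eigen (Or.inl rfl), ← baseComponent_eq, Submodule.map_span,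
    ← span_affineCone_inf_eigen (neg_one_pow_eq_or ℂ R.card)]
  congr 1
  ext z
  rw [← extEquiv_swapEquiv_mem_baseComponent]
  constructor
  · rintro ⟨w, hw, rfl⟩
    rw [LinearEquiv.coe_coe, extEquiv_swapEquiv_self]
    exact hw
  · exact fun h => ⟨_, h, extEquiv_swapEquiv_self R z⟩

/-- The swap permutes the coordinates up to nonzero factors and turns the distance from `I₀` into
the distance from `isoIndex R`. -/
theorem mem_map_swapEquiv_degLE {R : Finset (Fin n)} {s : ℕ} {x : PluckerSpace n} :
    x ∈ (degLE deg s).map (extEquiv (swapEquiv R)).toLinearMap ↔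
      ∀ J, s < dist (isoIndex R).1 J.1 → x J = 0 := by
  have h1 : x ∈ (degLE deg s).map (extEquiv (swapEquiv R)).toLinearMap ↔
      extEquiv (swapEquiv R) x ∈ degLE deg s := by
    constructor
    · rintro ⟨w, hw, rfl⟩
      rw [LinearEquiv.coe_coe, extEquiv_swapEquiv_self]
      exact hw
    · exact fun h => ⟨_, h, extEquiv_swapEquiv_self R x⟩
  rw [h1]
  constructor
  · intro h J hJ
    rw [dist_isoIndex] at hJ
    have h2 := h _ hJ
    obtain ⟨a, ha, h3⟩ := exists_extEquiv_swapEquiv_apply R (swapLam R J)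
    rw [h3, swapLam_swapLam] at h2
    exact (mul_eq_zero.1 h2).resolve_left ha
  · intro h J hJ
    obtain ⟨a, ha, h3⟩ := exists_extEquiv_swapEquiv_apply R J
    rw [h3, h (swapLam R J) (by rwa [dist_isoIndex, swapLam_swapLam]), mul_zero]

theorem pairVector_eq (R : Finset (Fin n)) (J : Lam n) :
    pairVector (isoIndex R) J (dual J) =
      eps J • (e J + (-1 : ℂ) ^ R.card • star n (e J)) := by
  have h1 : dist (Izero n) (isoIndex R).1 = R.card := deg_isoIndex R
  rw [pairVector, h1, star_e, smul_add, smul_smul, smul_smul, pow_add]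
  congr 2
  rw [show dist (Izero n) J.1 = deg J from rfl]
  linear_combination -((-1) ^ R.card * (-1) ^ deg J * eps (dual J)) * eps_mul_self J

/-- At a self-dual index the symmetrized vector is `2 e_J` or `0` according to the parity of the
distance; this is why `Σ_s` keeps only even diagonal pairs. -/
theorem e_add_star_of_dual_eq (R : Finset (Fin n)) {J : Lam n} (h : dual J = J) :
    e J + (-1 : ℂ) ^ R.card • star n (e J) =
      (1 + (-1 : ℂ) ^ dist (isoIndex R).1 J.1) • e J := by
  have hJ := eq_isoIndex_of_dual_eq h
  have h1 : (-1 : ℂ) ^ dist (isoIndex R).1 J.1 = (-1) ^ R.card * (-1) ^ deg J := by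
    rw [dist_isoIndex, hJ, swapLam_isoIndex, deg_isoIndex, deg_isoIndex,
      neg_one_pow_card_symmDiff, mul_comm]
  rw [h1, star_e, h, add_smul, one_smul, smul_smul, mul_assoc _ (eps J), eps_mul_self, mul_one]

/-- An eigenvector equals half its symmetrization `x + c • star x`, so the symmetrized basis vectors
of bounded distance generate; up to nonzero scalars these are the listed generators or zero. -/
theorem explicitSpan_eq (R : Finset (Fin n)) (s : ℕ) :
    explicitSpan (isoIndex R) s =
      ((degLE deg s).map (extEquiv (swapEquiv R)).toLinearMap) ⊓ eigen n ((-1) ^ R.card) := by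
  have hc := neg_one_pow_mul_self R.card
  have hdual : ∀ J : Lam n, dist (isoIndex R).1 (dual J).1 = dist (isoIndex R).1 J.1 := fun J => by
    rw [dist_isoIndex, dist_isoIndex, swapLam_dual, deg_dual]
  have hmem : ∀ J : Lam n, dist (isoIndex R).1 J.1 ≤ s → e J + (-1 : ℂ) ^ R.card • star n (e J) ∈
      ((degLE deg s).map (extEquiv (swapEquiv R)).toLinearMap) ⊓ eigen n ((-1) ^ R.card) := by
    refine fun J hJ => ⟨mem_map_swapEquiv_degLE.2 fun K hK => ?_, add_smul_star_mem_eigen hc _⟩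
    have h1 : K ≠ J := fun h => by rw [h] at hK; omega
    have h2 : K ≠ dual J := fun h => by rw [h, hdual] at hK; omega
    rw [star_e]
    simp [e, h1, h2]
  apply le_antisymm
  · refine Submodule.span_le.2 ?_
    rintro x (⟨J, hJ, rfl⟩ | ⟨J, J', hJ, rfl⟩)
    · rcases hJ with ⟨-, -, h⟩ | ⟨hJ, hd, -, heven⟩
      · exact absurd rfl h
      have h1 := hmem J hd
      rw [e_add_star_of_dual_eq R (mem_Sig_iff.1 hJ).symm, heven.neg_one_pow] at h1
      exact (Submodule.smul_mem_iff _ (by norm_num)).1 h1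
    · have hJ1 : (J, J') ∈ Sig n ∧ dist (isoIndex R).1 J.1 ≤ s := by
        rcases hJ with ⟨h1, h2, -⟩ | ⟨h1, h2, -⟩ <;> exact ⟨h1, h2⟩
      rw [mem_Sig_iff.1 hJ1.1, pairVector_eq]
      exact Submodule.smul_mem _ _ (hmem J hJ1.2)
  · rintro x ⟨hx, hxe⟩
    rw [SetLike.mem_coe, mem_map_swapEquiv_degLE] at hx
    rw [eq_half_smul_of_mem_eigen hxe]
    refine Submodule.smul_mem _ _ ?_
    have hsum : x + (-1 : ℂ) ^ R.card • star n x =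
        ∑ J, x J • (e J + (-1 : ℂ) ^ R.card • star n (e J)) := by
      have h1 : x = ∑ J, x J • e J := by
        conv_lhs => rw [pi_eq_sum_univ' x]
        rfl
      have h2 : star n x = ∑ J, x J • star n (e J) := by
        conv_lhs => rw [h1]
        simp
      rw [h2]
      nth_rw 1 [h1]
      rw [Finset.smul_sum, ← Finset.sum_add_distrib]
      exact Finset.sum_congr rfl fun J _ => by rw [smul_add, smul_comm]
    rw [hsum]
    refine Submodule.sum_mem _ fun J _ => ?_
    by_cases hJs : s < dist (isoIndex R).1 J.1
    · rw [hx J hJs, zero_smul]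
      exact Submodule.zero_mem _
    refine Submodule.smul_mem _ _ ?_
    push Not at hJs
    by_cases hJd : dual J = J
    · rw [e_add_star_of_dual_eq R hJd]
      by_cases heven : Even (dist (isoIndex R).1 J.1)
      · exact Submodule.smul_mem _ _ (Submodule.subset_span
          (Or.inl ⟨J, Or.inr ⟨mem_Sig_iff.2 hJd.symm, hJs, rfl, heven⟩, rfl⟩))
      · rw [(Nat.not_even_iff_odd.1 heven).neg_one_pow]
        simp
    · have h1 : pairVector (isoIndex R) J (dual J) ∈ explicitSpan (isoIndex R) s :=
        Submodule.subset_span (Or.inr ⟨J, dual J,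
          Or.inl ⟨mem_Sig_iff.2 rfl, hJs, fun h => hJd h.symm⟩, rfl⟩)
      rw [pairVector_eq] at h1
      exact (Submodule.smul_mem_iff _ (eps_ne_zero J)).1 h1

/-- A coordinate point of the isotropic Grassmannian has an isotropic index. -/
theorem eq_isoIndex_of_e_mem {I : Lam n} (h : e I ∈ affineCone (isotropicGrassmannian n)) :
    I = isoIndex (colsIn I) := by
  obtain ⟨R, hR⟩ := exists_isoIndex_ne_zero h
  have : isoIndex R = I := by
    by_contra hne
    exact hR (by rw [e, Pi.single_eq_of_ne hne])
  rw [← this, colsIn_isoIndex]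

end Spinor

/-! ### Dimensions -/

/-- The projection to the vectors of degree at most `s`. -/
def truncate {ι : Type*} (deg : ι → ℕ) (s : ℕ) : (ι → ℂ) →ₗ[ℂ] (ι → ℂ) where
  toFun x j := if deg j ≤ s then x j else 0
  map_add' x y := by ext j; by_cases h : deg j ≤ s <;> simp [h]
  map_smul' c x := by ext j; by_cases h : deg j ≤ s <;> simp [h]

theorem truncate_apply {ι : Type*} (deg : ι → ℕ) (s : ℕ) (x : ι → ℂ) (j : ι) :
    truncate deg s x j = if deg j ≤ s then x j else 0 := rfl

theorem isProj_degLE_inf_eigen (s : ℕ) : LinearMap.IsProj (degLE deg s ⊓ eigen n 1)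
    ((1 / 2 : ℂ) • (truncate deg s + star n ∘ₗ truncate deg s)) where
  map_mem x := by
    refine ⟨fun J hJ => ?_, ?_⟩
    · simp [star_apply, truncate_apply, not_le.2 hJ]
    · have := add_smul_star_mem_eigen (c := 1) (by norm_num) (truncate deg s x)
      rw [one_smul] at this
      exact Submodule.smul_mem _ _ this
  map_id x hx := by
    have h1 : truncate deg s x = x := by
      ext J
      rw [truncate_apply]
      split_ifs with h
      · rfl
      · exact (hx.1 J (not_le.1 h)).symm
    have h2 := eq_half_smul_of_mem_eigen hx.2
    rw [one_smul] at h2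
    simpa [h1] using h2.symm

/-- The rank of a projection is its trace. The star operator has a diagonal entry only at self-dual
indices, where it is `(-1) ^ deg J`. -/
theorem two_mul_finrank_eq_sum (s : ℕ) :
    2 * (finrank ℂ ↥(degLE deg s ⊓ eigen n 1) : ℂ) =
      ∑ J : Lam n, if deg J ≤ s then 1 + (if dual J = J then (-1) ^ deg J else 0) else 0 := by
  rw [← (isProj_degLE_inf_eigen (n := n) s).trace, map_smul, smul_eq_mul, ← mul_assoc,
    LinearMap.trace_eq_matrix_trace ℂ (Pi.basisFun ℂ (Lam n)), Matrix.trace]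
  norm_num
  refine Finset.sum_congr rfl fun J _ => ?_
  simp only [star_apply, truncate_apply, deg_dual, Pi.single_apply]
  by_cases h : deg J ≤ s
  · by_cases h' : dual J = J
    · simp [h, h', mul_assoc, eps_mul_self]
    · simp [h, h']
  · simp [h]

theorem card_deg_eq (k : ℕ) :
    (Finset.univ.filter fun J : Lam n => deg J = k).card = n.choose k * n.choose k := by
  have : (Finset.univ.filter fun J : Lam n => deg J = k).card =
      (Finset.powersetCard k (Finset.univ : Finset (Fin n)) ×ˢ
        Finset.powersetCard k (Finset.univ : Finset (Fin n))).card := by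
    refine Finset.card_bij (fun J _ => ((rowsIn J)ᶜ, colsIn J)) ?_ ?_ ?_
    · intro J hJ
      rw [Finset.mem_filter] at hJ
      simp only [Finset.mem_product, Finset.mem_powersetCard, Finset.subset_univ, true_and]
      rw [← deg_eq_card_compl, ← deg_eq_card_colsIn]
      exact ⟨hJ.2, hJ.2⟩
    · intro J _ K _ h
      rw [Prod.mk.injEq] at h
      exact Lam_ext (compl_injective h.1) h.2
    · rintro ⟨A, B⟩ h
      simp only [Finset.mem_product, Finset.mem_powersetCard, Finset.subset_univ, true_and] at h
      have hc : Aᶜ.card + B.card = n := by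
        rw [h.2, ← h.1, add_comm, Finset.card_add_card_compl, Fintype.card_fin]
      exact ⟨mkLam Aᶜ B hc, by simp [deg_eq_card_colsIn, h.2], by simp⟩
  rw [this, Finset.card_product, Finset.card_powersetCard, Finset.card_univ, Fintype.card_fin]

theorem card_deg_eq_and_dual_eq (k : ℕ) :
    (Finset.univ.filter fun J : Lam n => deg J = k ∧ dual J = J).card = n.choose k := by
  have : (Finset.univ.filter fun J : Lam n => deg J = k ∧ dual J = J).card =
      (Finset.powersetCard k (Finset.univ : Finset (Fin n))).card := by
    refine Finset.card_bij (fun J _ => colsIn J) ?_ ?_ ?_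
    · intro J hJ
      rw [Finset.mem_filter] at hJ
      simp only [Finset.mem_powersetCard, Finset.subset_univ, true_and]
      rw [← deg_eq_card_colsIn]
      exact hJ.2.1
    · intro J hJ K hK h
      rw [Finset.mem_filter] at hJ hK
      rw [eq_isoIndex_of_dual_eq hJ.2.2, eq_isoIndex_of_dual_eq hK.2.2, h]
    · intro A h
      simp only [Finset.mem_powersetCard, Finset.subset_univ, true_and] at h
      exact ⟨isoIndex A, by simp [h], by simp⟩
  rw [this, Finset.card_powersetCard, Finset.card_univ, Fintype.card_fin]

theorem two_mul_finrank_eq (s : ℕ) :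
    2 * (finrank ℂ ↥(degLE deg s ⊓ eigen n 1) : ℂ) =
      ∑ k ∈ Finset.range (s + 1), ((n.choose k : ℂ) * n.choose k + (-1) ^ k * n.choose k) := by
  rw [two_mul_finrank_eq_sum, ← Finset.sum_filter,
    ← Finset.sum_fiberwise_of_maps_to (t := Finset.range (s + 1)) (g := deg)
      (fun J hJ => Finset.mem_range.2 (Nat.lt_succ_of_le (Finset.mem_filter.1 hJ).2))]
  refine Finset.sum_congr rfl fun k hk => ?_
  have hk' : k ≤ s := Nat.lt_succ_iff.1 (Finset.mem_range.1 hk)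
  have h1 : ((Finset.univ.filter fun J : Lam n => deg J ≤ s).filter fun J => deg J = k) =
      Finset.univ.filter fun J : Lam n => deg J = k := by
    ext J
    simp only [Finset.mem_filter, Finset.mem_univ, true_and, and_iff_right_iff_imp]
    omega
  rw [h1, Finset.sum_add_distrib]
  congr 1
  · simp [card_deg_eq]
  · rw [← Finset.sum_filter, Finset.filter_filter, ← card_deg_eq_and_dual_eq (n := n) k,
      Finset.sum_congr rfl (g := fun _ => (-1 : ℂ) ^ k)
        (fun J hJ => by rw [(Finset.mem_filter.1 hJ).2.1])]
    simp [mul_comm]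

/-- The term `k = 0` gives the constant `2`. For odd `k`, changing the sign of `n.choose k` to plus
costs `2 * n.choose k`; there are `⌈s/2⌉ = (s + 1) / 2` odd numbers up to `s`. -/
theorem sum_choose_eq (n s : ℕ) :
    ∑ k ∈ Finset.range (s + 1), ((n.choose k : ℚ) * n.choose k + (-1) ^ k * n.choose k) =
      2 + ∑ k ∈ Finset.Icc 1 s, (n.choose k : ℚ) * ((n.choose k : ℚ) + 1) -
        2 * ∑ k ∈ Finset.Icc 1 ((s + 1) / 2), (n.choose (2 * k - 1) : ℚ) := by
  induction s with
  | zero => norm_num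
  | succ s ih =>
    rw [Finset.sum_range_succ, ih, Finset.sum_Icc_succ_top (by omega)]
    rcases Nat.even_or_odd' s with ⟨m, rfl | rfl⟩
    · rw [show (2 * m + 1 + 1) / 2 = m + 1 by omega, show (2 * m + 1) / 2 = m by omega,
        Finset.sum_Icc_succ_top (by omega), show 2 * (m + 1) - 1 = 2 * m + 1 by omega,
        Odd.neg_one_pow ⟨m, rfl⟩]
      ring
    · rw [show (2 * m + 1 + 1 + 1) / 2 = m + 1 by omega, show (2 * m + 1 + 1) / 2 = m + 1 by omega,
        Even.neg_one_pow ⟨m + 1, by ring⟩]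
      ring

theorem finrank_degLE_inf_eigen (s : ℕ) :
    (finrank ℂ ↥(degLE deg s ⊓ eigen n 1) : ℚ) - 1 =
      (1 / 2) * ∑ k ∈ Finset.Icc 1 s, (n.choose k : ℚ) * ((n.choose k : ℚ) + 1) -
        ∑ k ∈ Finset.Icc 1 ((s + 1) / 2), (n.choose (2 * k - 1) : ℚ) := by
  have h1 : 2 * (finrank ℂ ↥(degLE deg s ⊓ eigen n 1) : ℚ) =
      ∑ k ∈ Finset.range (s + 1), ((n.choose k : ℚ) * n.choose k + (-1) ^ k * n.choose k) := by
    have := two_mul_finrank_eq (n := n) s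
    exact_mod_cast this
  rw [sum_choose_eq] at h1
  linear_combination (1 / 2 : ℚ) * h1

end SpinorPlucker

end

open SpinorPlucker in
/-- Osculating spaces of a Spinor variety `S ⊆ ℙ(⋀ⁿ V)` in its Plücker embedding;
`linearSpan S` is `⋀ⁿ V₊`. -/
theorem mainTheorem5 (n : ℕ) (S : Set (ℙ ℂ (PluckerSpace n))) (hS : IsSpinorVariety S) :
    S = {p | p ∈ grassmannian n ∧ p.submodule ≤ linearSpan S} ∧
    ∀ p ∈ S, ∀ s : ℕ, ∃ T TG : Submodule ℂ (PluckerSpace n),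
      IsOsculatingSpace S p s T ∧
      IsOsculatingSpace (grassmannian n) p s TG ∧
      (∀ I : Lam n, p = coordPoint I → T = explicitSpan I s) ∧
      T = TG ⊓ linearSpan S ∧
      (2 * (n / 2) ≤ s → T = linearSpan S) ∧
      (1 ≤ s → s < 2 * (n / 2) →
        (Module.finrank ℂ T : ℚ) - 1 =
          (1 / 2) * ∑ k ∈ Finset.Icc 1 s, (n.choose k : ℚ) * ((n.choose k : ℚ) + 1) -
            ∑ k ∈ Finset.Icc 1 ((s + 1) / 2), (n.choose (2 * k - 1) : ℚ)) := by
  constructor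
  · ext p
    constructor
    · intro hp
      have h1 := rep_mem_affineCone.2 hp
      obtain ⟨W, hW, -, hWp⟩ := rep_mem_affineCone.1 (hS.affineCone_subset h1)
      refine ⟨⟨W, hW, hWp⟩, ?_⟩
      rw [Projectivization.submodule_eq, Submodule.span_singleton_le_iff_mem]
      exact Submodule.subset_span h1
    · rintro ⟨hG, hp⟩
      -- Any point of the cone over `S` gives an automorphism moving the base component to `S`,
      -- which reduces the claim to `eigen n 1`.
      obtain ⟨y, hy, hyS⟩ : ∃ y ∈ affineCone (isotropicGrassmannian n), y ∈ affineCone S := by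
        obtain ⟨y, hy, h⟩ := hS
        exact ⟨y, hy, h ▸ mem_connectedComponentIn hy⟩
      obtain ⟨Φ, hΦ, rfl⟩ := exists_preserves_of_mem hy
      rw [Projectivization.submodule_eq, Submodule.span_singleton_le_iff_mem,
        hS.linearSpan_eq hΦ hyS] at hp
      obtain ⟨z, hz, hzp⟩ := hp
      have hzp' : Φ z = p.rep := hzp
      rw [← rep_mem_affineCone, ← hzp', hS.mem_affineCone_iff hΦ hyS, baseComponent_eq]
      refine ⟨mem_affineCone_isotropic_of_mem_eigen one_ne_zero ?_ hz, hz⟩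
      rw [← hΦ.grassmannian, hzp', rep_mem_affineCone]
      exact hG
  · intro p hp s
    have hrep := rep_mem_affineCone.2 hp
    obtain ⟨Φ, hΦ, hΦe⟩ := exists_preserves_of_mem (hS.affineCone_subset hrep)
    have he : Φ (e (baseIndex n)) ∈ affineCone S := by rw [hΦe]; exact hrep
    have h0 : Φ (e (baseIndex n)) ≠ 0 := he.1
    have hmk : Projectivization.mk ℂ _ h0 = p := by
      simp only [hΦe, Projectivization.mk_rep]
    have hT := hS.isOsculatingSpace hΦ he h0 s
    have hTG := isOsculatingSpace_grassmannian hΦ h0 s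
    rw [hmk] at hT hTG
    refine ⟨_, _, hT, hTG, fun I hI => ?_, ?_, fun hs => ?_, fun _ _ => ?_⟩
    · subst hI
      have hI : e I ∈ affineCone S := ⟨e_ne_zero I, hp⟩
      have hIR := eq_isoIndex_of_e_mem (hS.affineCone_subset hI)
      -- At a coordinate point the coordinate swap is another automorphism taking `e_{I₀}` to a
      -- multiple of `e_I`. Uniqueness of the osculating space allows it to replace `Φ`, and its
      -- image is the explicit span.
      obtain ⟨a, ha, hae⟩ := exists_swapEquiv_e_baseIndex (colsIn I)
      rw [← hIR] at hae
      have hP := preserves_extEquiv (Q_swapEquiv (colsIn I))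
      have hne : a • e I ≠ 0 := smul_ne_zero ha (e_ne_zero I)
      have hmk' : Projectivization.mk ℂ _ hne = coordPoint I :=
        (Projectivization.mk_eq_mk_iff' ℂ _ _ _ _).2 ⟨a, rfl⟩
      have hae' : (extEquiv (swapEquiv (colsIn I))).toContinuousLinearEquiv (e (baseIndex n)) =
        a • e I := hae
      have he' : (extEquiv (swapEquiv (colsIn I))).toContinuousLinearEquiv (e (baseIndex n)) ∈
          affineCone S := by
        rw [hae']
        exact ⟨hne, by rw [hmk']; exact hp⟩
      have hT' := hS.isOsculatingSpace hP he' he'.1 s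
      simp only [hae', hmk'] at hT'
      rw [hT.unique hT']
      conv_rhs => rw [hIR, explicitSpan_eq, ← map_swapEquiv_eigen]
      exact Submodule.map_inf _ (extEquiv (swapEquiv (colsIn I))).injective
    · rw [hS.linearSpan_eq hΦ he]
      exact Submodule.map_inf _ Φ.injective
    · rw [hS.linearSpan_eq hΦ he, degLE_inf_eigen_eq hs]
    · rw [LinearEquiv.finrank_map_eq, finrank_degLE_inf_eigen]
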